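/- Let $p$ be a prime, $G=PGL_2^+(\mathbb Z[1/p])$ (classes in $PGL_2(\mathbb Z[1/p])$ of matrices of positive determinant), $\Gamma=PSL_2(\mathbb Z)\subseteq G$, $\sigma_{p^n}$ the class of $\mathrm{diag}(p^n,1)$; the sets $\Gamma\sigma_{p^n}\Gamma$, $n\ge 0$, partition $G$. Let $\mathcal L(G)\subseteq B(\ell^2(G))$ be the von Neumann algebra generated by the left translations, with trace $\tau(x)=\langle x\delta_e,\delta_e\rangle$, and identify $x\in\mathcal L(G)$ with the vector $x\delta_e\in\ell^2(G)$, i.e. with $\sum_g x(g)g$. Let $\mathcal L(\Gamma)\subseteq\mathcal L(G)$ be the von Neumann subalgebra generated by $\Gamma$, and $E=E^{\mathcal L(G)}_{\mathcal L(\Gamma)}$ the trace-preserving conditional expectation. Let $\mathcal H_0=\mathbb C(\Gamma\backslash G/\Gamma)$ be the Hecke algebra of double cosets, acting on $\ell^2(\Gamma\backslash G)$, $\mathcal H$ the von Neumann algebra it generates there, with the trace $\langle\,\cdot\,\delta_\Gamma,\delta_\Gamma\rangle$. Let $X=X^*\in\mathcal L(G)\cap\ell^2(\Gamma\sigma_p\Gamma)$.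 For $n\ge0$ let $X_n$ be the projection of $X^n$ onto $\ell^2(\Gamma\sigma_{p^n}\Gamma)$, and for a set $A\subseteq G$ that is a finite union of sets $a\Gamma b$ ($a,b\in G$), let $X_A\in\mathcal L(G)$ be the projection onto $\ell^2(A)$ of $\sum_{e\in I}X_e$, where $I$ is a finite set such that $A\subseteq\bigcup_{e\in I}\Gamma\sigma_{p^e}\Gamma$ (so, if $A\subseteq\Gamma\sigma_{p^e}\Gamma$, $X_A$ is the projection of $X_e$). (1) Suppose $p$ is odd; let $\tau_p$ be the trace of $\mathcal L(F_{(p+1)/2})$, where $F_{(p+1)/2}$ is the free group on $(p+1)/2$ generators, and $\chi_1\in\mathbb C[F_{(p+1)/2}]$ the sum of the words of length one. The map $[\Gamma\sigma_p\Gamma]^n\mapsto X^n$, $n\ge 0$, extends to a trace-preserving unital $*$-homomorphism $\mathcal H_0\to\mathcal L(G)$ if and only if $\tau(X^n)=\tau_p(\chi_1^n)$ for all $n\ge 0$. The same holds with $\mathcal H$ in place of $\mathcal H_0$. (2) The following are equivalent. (a) There are a unitary representation $\pi$ of $G$ on a Hilbert space $H$ and a unitary $U:H\to\ell^2(\Gamma)$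 intertwining $\pi|_\Gamma$ and the left regular representation of $\Gamma$ (i.e. $\dim_\Gamma H=1$) such that, with $\eta=U^{-1}\delta_e$, $$X=\sum_{\theta\in\Gamma\sigma_p\Gamma}\langle\pi(\theta)\eta,\eta\rangle\,\theta .$$ (b) $(X_{\Gamma\sigma})^*=X_{\sigma^{-1}\Gamma}$ for all $\sigma\in G$, and $X_{\sigma_1\Gamma}X_{\Gamma\sigma_2}=X_{\sigma_1\Gamma\sigma_2}$ for all $\sigma_1,\sigma_2\in G$. If these conditions hold, then there is a unital algebra homomorphism $\Psi$ from $\mathcal H_0$ to the linear endomorphisms of $\mathcal L(\Gamma)$ such that $\Psi([\Gamma\sigma_{p^n}\Gamma])(a)=E(X_naX_n)$ for all $n\ge 0$ and $a\in\mathcal L(\Gamma)$ (in particular $\Psi([\Gamma\sigma_p\Gamma])(a)=E(XaX)$). The maps $\Psi([\Gamma\sigma_{p^n}\Gamma])$ are completely positive, and $\Psi$ takes values in the algebra generated by the completely positive maps on $\mathcal L(\Gamma)$. (3) Condition (b) holds if, for all $\sigma_1,\sigma_2\in G$ and all $r_1,\dots,r_m\in\Gamma$ such that $\Gamma\sigma_1\Gamma$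 is the disjoint union of the cosets $\Gamma\sigma_1r_j$, $$X_{\Gamma\sigma_1\Gamma}X_{\Gamma\sigma_2}=\sum_{j=1}^m X_{\Gamma\sigma_1r_j\sigma_2}.$$ Condition (b) also holds if, for all $n\ge1$ and $\sigma\in G$, left multiplication by $X_n$ acts on the elements $X_{\Gamma\sigma}$ as $[\Gamma\sigma_{p^n}\Gamma]$ acts on the basis of $\ell^2(\Gamma\backslash G)$, i.e. $X_nX_{\Gamma\sigma}=\sum X_{\Gamma\sigma'}$, the sum being over the cosets $\Gamma\sigma'\subseteq\Gamma\sigma_{p^n}\Gamma\sigma$. -/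

import Mathlib

open scoped Pointwise ComplexOrder MatrixGroups

noncomputable section

namespace HeckeRep

/-! ### The Hilbert space `ℓ²(ι)` and bounded operators given by matrices -/

/-- The Hilbert space `ℓ²(ι)`. -/
abbrev L2 (ι : Type) : Type := lp (fun _ : ι => ℂ) 2

/-- The algebra of bounded operators on `ℓ²(ι)`. -/
abbrev BL2 (ι : Type) : Type := L2 ι →L[ℂ] L2 ι

open Classical in
/-- The canonical basis vector `δ_i` of `ℓ²(ι)`. -/
def delta {ι : Type} (i : ι) : L2 ι := lp.single 2 i (1 : ℂ)

/-- The bounded operator `T` has matrix `M`: `⟨T δ_j, δ_i⟩ = M i j`. Such a `T` is unique. -/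
def HasMatrix {ι : Type} (T : BL2 ι) (M : ι → ι → ℂ) : Prop :=
  ∀ i j, (T (delta j) : ι → ℂ) i = M i j

open Classical in
/-- The bounded operator on `ℓ²(ι)` with matrix `M` (zero if `M` is not the matrix of a bounded
operator, which does not occur in the uses made of it below). -/
def ofMatrix {ι : Type} (M : ι → ι → ℂ) : BL2 ι :=
  if h : ∃ T : BL2 ι, HasMatrix T M then h.choose else 0

theorem ofMatrix_spec {ι : Type} {M : ι → ι → ℂ} (h : ∃ T : BL2 ι, HasMatrix T M) :
    HasMatrix (ofMatrix M) M := by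
  rw [ofMatrix, dif_pos h]; exact h.choose_spec

theorem l2_hasSum {ι : Type} (v : L2 ι) : HasSum (fun i => ‖v i‖ ^ 2) (‖v‖ ^ 2) := by
  have h := lp.hasSum_norm (p := 2) (by norm_num) v
  simpa using h

theorem l2_sum_le {ι : Type} (v : L2 ι) (s : Finset ι) : ∑ i ∈ s, ‖v i‖ ^ 2 ≤ ‖v‖ ^ 2 :=
  sum_le_hasSum s (fun _ _ => sq_nonneg _) (l2_hasSum v)

theorem mem_l2 {ι : Type} {f : ι → ℂ} {C : ℝ} (h : ∀ s : Finset ι, ∑ i ∈ s, ‖f i‖ ^ 2 ≤ C) :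
    Memℓp f 2 := by
  refine memℓp_gen' (C := C) fun s => ?_
  simpa using h s

/-- A linear map given by coordinates and a uniform bound defines a bounded operator. -/
theorem exists_operator {ι : Type} (F : L2 ι →ₗ[ℂ] (ι → ℂ)) (C : ℝ) (hC : 0 ≤ C)
    (h : ∀ v, ∀ s : Finset ι, ∑ i ∈ s, ‖F v i‖ ^ 2 ≤ C ^ 2 * ‖v‖ ^ 2) :
    ∃ S : BL2 ι, ∀ v i, (S v : ι → ℂ) i = F v i := by
  refine ⟨LinearMap.mkContinuous
    { toFun := fun v => ⟨F v, mem_l2 (h v)⟩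
      map_add' := fun v w => Subtype.ext (F.map_add v w)
      map_smul' := fun c v => Subtype.ext (F.map_smul c v) } C fun v => ?_, fun _ _ => rfl⟩
  refine lp.norm_le_of_forall_sum_le (by norm_num) (by positivity) fun s => ?_
  have := h v s
  rw [← mul_pow] at this
  simpa using this

/-- The unitary operator on `ℓ²(ι)` given by a permutation: `(permOp e f) i = f (e i)`. -/
def permOp {ι : Type} (e : ι ≃ ι) : BL2 ι :=
  LinearMap.mkContinuous
    { toFun := fun f => ⟨fun i => f (e i), mem_l2 (C := ‖f‖ ^ 2) fun s => by
        have h := l2_sum_le f (s.map e.toEmbedding)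
        rwa [Finset.sum_map] at h⟩
      map_add' := fun _ _ => rfl
      map_smul' := fun _ _ => rfl } 1 (fun f => by
        refine lp.norm_le_of_forall_sum_le (by norm_num) (by positivity) fun s => ?_
        have h := l2_sum_le f (s.map e.toEmbedding)
        rw [Finset.sum_map] at h
        simp only [ENNReal.toReal_ofNat, Real.rpow_two, one_mul]
        exact h)

/-- The restriction of a vector of `ℓ²(ι)` to a subset. -/
def restrictVec {ι : Type} (A : Set ι) : L2 ι →ₗ[ℂ] L2 ι where
  toFun v := ⟨A.indicator v, mem_l2 (C := ‖v‖ ^ 2) fun s => by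
    refine le_trans (Finset.sum_le_sum fun i _ => ?_) (l2_sum_le v s)
    gcongr
    exact norm_indicator_le_norm_self _ _⟩
  map_add' v w := Subtype.ext (Set.indicator_add A (v : ι → ℂ) w)
  map_smul' c v := Subtype.ext (Set.indicator_const_smul A c (v : ι → ℂ))

open Classical in
/-- Block truncations of the matrix of a bounded operator are bounded. -/
theorem exists_block {ι Q : Type} (T : BL2 ι) (f k : ι → Q) :
    ∃ S : BL2 ι, HasMatrix S fun i j => if f i = k j then (T (delta j) : ι → ℂ) i else 0 := by
  have key : ∀ (v : L2 ι) (F : Finset Q),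
      ∑ q ∈ F, ‖restrictVec {j | k j = q} v‖ ^ 2 ≤ ‖v‖ ^ 2 := by
    intro v F
    have h1 : HasSum (fun j => ∑ q ∈ F, ‖(restrictVec {j | k j = q} v : ι → ℂ) j‖ ^ 2)
        (∑ q ∈ F, ‖restrictVec {j | k j = q} v‖ ^ 2) :=
      hasSum_sum fun q _ => l2_hasSum _
    refine hasSum_le (fun j => ?_) h1 (l2_hasSum v)
    have h2 : ∀ q, ‖(restrictVec {j | k j = q} v : ι → ℂ) j‖ ^ 2 =
        if k j = q then ‖v j‖ ^ 2 else 0 := by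
      intro q
      change ‖Set.indicator {j | k j = q} (v : ι → ℂ) j‖ ^ 2 = _
      by_cases hq : k j = q <;> simp [Set.indicator, hq]
    simp only [h2, Finset.sum_ite_eq]
    split_ifs
    · exact le_rfl
    · positivity
  obtain ⟨S, hS⟩ := exists_operator
    { toFun := fun v i => (T (restrictVec {j | k j = f i} v) : ι → ℂ) i
      map_add' := fun v w => by funext i; simp
      map_smul' := fun c v => by funext i; simp } ‖T‖ (norm_nonneg T) (by
    intro v s
    change ∑ i ∈ s, ‖(T (restrictVec {j | k j = f i} v) : ι → ℂ) i‖ ^ 2 ≤ _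
    rw [← Finset.sum_fiberwise_of_maps_to (g := f) (t := s.image f)
      (fun i hi => Finset.mem_image_of_mem f hi)]
    calc _ ≤ ∑ q ∈ s.image f, ‖T (restrictVec {j | k j = q} v)‖ ^ 2 := by
          refine Finset.sum_le_sum fun q _ => ?_
          refine le_trans (le_of_eq (Finset.sum_congr rfl fun i hi => ?_))
            (l2_sum_le (T (restrictVec {j | k j = q} v)) (s.filter fun i => f i = q))
          rw [(Finset.mem_filter.1 hi).2]
      _ ≤ ∑ q ∈ s.image f, ‖T‖ ^ 2 * ‖restrictVec {j | k j = q} v‖ ^ 2 := by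
          refine Finset.sum_le_sum fun q _ => ?_
          rw [← mul_pow]
          gcongr
          exact T.le_opNorm _
      _ ≤ _ := by
          rw [← Finset.mul_sum]
          gcongr
          exact key v _)
  refine ⟨S, fun i j => ?_⟩
  rw [hS]
  change (T (restrictVec {j | k j = f i} (delta j)) : ι → ℂ) i = _
  have h3 : restrictVec {j | k j = f i} (delta j) = if f i = k j then delta j else 0 := by
    refine lp.ext (funext fun l => ?_)
    change Set.indicator {j | k j = f i} (delta j : ι → ℂ) l = _
    by_cases hl : l = j
    · subst hl
      by_cases h : f i = k l
      · simp [h]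
      · rw [if_neg h, Set.indicator_of_notMem (fun h' => h h'.symm)]
        simp
    · have : (delta j : ι → ℂ) l = 0 := by
        simp [delta, lp.single_apply, hl]
      split_ifs <;> simp [Set.indicator, this]
  rw [h3]
  by_cases h : f i = k j
  · simp only [if_pos h]
  · simp only [if_neg h, map_zero]
    rfl

/-- Matrices with entries zero or one, and with boundedly many ones in each row and each column,
define bounded operators. -/
theorem exists_incidence {ι : Type} (N N' : ι → Finset ι) (d d' : ℕ)
    (hN : ∀ i, (N i).card ≤ d) (hN' : ∀ i, (N' i).card ≤ d')
    (hNN' : ∀ i j, j ∈ N i → i ∈ N' j) :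
    ∃ S : BL2 ι, HasMatrix S fun i j => open Classical in if j ∈ N i then 1 else 0 := by
  classical
  obtain ⟨S, hS⟩ := exists_operator
    { toFun := fun v i => ∑ j ∈ N i, (v : ι → ℂ) j
      map_add' := fun v w => by funext i; exact Finset.sum_add_distrib
      map_smul' := fun c v => by funext i; simp [Finset.mul_sum] }
    (Real.sqrt (d * d')) (Real.sqrt_nonneg _) (by
    intro v s
    change ∑ i ∈ s, ‖∑ j ∈ N i, (v : ι → ℂ) j‖ ^ 2 ≤ _
    rw [Real.sq_sqrt (by positivity)]
    calc _ ≤ ∑ i ∈ s, (d : ℝ) * ∑ j ∈ N i, ‖v j‖ ^ 2 := by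
          refine Finset.sum_le_sum fun i _ => ?_
          calc ‖∑ j ∈ N i, (v : ι → ℂ) j‖ ^ 2 ≤ (∑ j ∈ N i, ‖v j‖) ^ 2 := by
                gcongr
                exact norm_sum_le _ _
            _ ≤ ((N i).card : ℝ) * ∑ j ∈ N i, ‖v j‖ ^ 2 := sq_sum_le_card_mul_sum_sq
            _ ≤ _ := by
                gcongr
                exact hN i
      _ = (d : ℝ) * ∑ i ∈ s, ∑ j ∈ N i, ‖v j‖ ^ 2 := by rw [Finset.mul_sum]
      _ = (d : ℝ) * ∑ j ∈ s.biUnion N, ∑ i ∈ s.filter (fun i => j ∈ N i), ‖v j‖ ^ 2 := by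
          congr 1
          refine Finset.sum_comm' fun i j => ?_
          simp only [Finset.mem_biUnion, Finset.mem_filter]
          tauto
      _ ≤ (d : ℝ) * ∑ j ∈ s.biUnion N, (d' : ℝ) * ‖v j‖ ^ 2 := by
          gcongr with j _
          rw [Finset.sum_const, nsmul_eq_mul]
          gcongr
          refine le_trans (Finset.card_le_card fun i hi => ?_) (hN' j)
          exact hNN' i j (Finset.mem_filter.1 hi).2
      _ ≤ _ := by
          rw [← Finset.mul_sum, ← mul_assoc]
          gcongr
          exact l2_sum_le v _)
  refine ⟨S, fun i j => ?_⟩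
  rw [hS]
  change ∑ l ∈ N i, (delta j : ι → ℂ) l = _
  have : ∀ l, (delta j : ι → ℂ) l = if l = j then 1 else 0 := fun l => by
    simp [delta, lp.single_apply, Pi.single_apply]
  simp only [this, Finset.sum_ite_eq']

/-! ### Group von Neumann algebras -/

section Group

variable {G : Type} [Group G]

/-- Left translation: `(λ(g) f)(x) = f(g⁻¹ x)`. -/
def leftReg (g : G) : BL2 G := permOp (Equiv.mulLeft g⁻¹)

/-- The von Neumann algebra `λ(S)''` on `ℓ²(G)` generated by the left translations by the
elements of a subgroup `S` of `G`. -/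
def vnOf (S : Subgroup G) : StarSubalgebra ℂ (BL2 G) :=
  StarSubalgebra.centralizer ℂ
    (StarSubalgebra.centralizer ℂ ((fun g : G => leftReg g) '' (S : Set G)) : Set (BL2 G))

variable (G) in
/-- The group von Neumann algebra `L(G)`. -/
def groupVN : StarSubalgebra ℂ (BL2 G) := vnOf (⊤ : Subgroup G)

/-- The coefficient of `g` in `x = ∑ x(g) g ∈ L(G)`, i.e. the value at `g` of the vector `x δ_e`
of `ℓ²(G)` that represents `x`. -/
def coeff (x : BL2 G) (g : G) : ℂ := (x (delta 1) : G → ℂ) g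

/-- The canonical trace `τ(x) = ⟨x δ_e, δ_e⟩` of `L(G)`. -/
def trace (x : BL2 G) : ℂ := coeff x 1

/-- The operator of left convolution by `f`, that is `∑ f(g) λ(g)`. -/
def convOp (f : G → ℂ) : BL2 G := ofMatrix fun g h => f (g * h⁻¹)

/-- The element of `L(G)` whose vector in `ℓ²(G)` is the orthogonal projection onto `ℓ²(A)` of the
vector of `x`. -/
def projOn (A : Set G) (x : BL2 G) : BL2 G := convOp (A.indicator (coeff x))

/-- The trace preserving conditional expectation `L(G) → L(S)`. -/
def condExp (S : Subgroup G) (x : BL2 G) : BL2 G := projOn (S : Set G) x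

/-- Positivity of an `n × n` matrix of bounded operators. -/
def PosMatrix {ι : Type} {n : ℕ} (M : Matrix (Fin n) (Fin n) (BL2 ι)) : Prop :=
  ∀ ξ : Fin n → L2 ι, 0 ≤ ∑ i, ∑ j, inner ℂ (ξ i) (M i j (ξ j))

/-- Complete positivity of a linear map on a `*`-algebra of operators. -/
def IsCP {ι : Type} {A : StarSubalgebra ℂ (BL2 ι)} (φ : A →ₗ[ℂ] A) : Prop :=
  ∀ (n : ℕ) (M : Matrix (Fin n) (Fin n) A),
    PosMatrix (M.map fun a => (a : BL2 ι)) → PosMatrix (M.map fun a => (φ a : BL2 ι))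

/-! ### Cosets and Hecke algebras -/

variable (Γ : Subgroup G)

/-- The set `a Γ b`. -/
def bicoset (a b : G) : Set G := {g | ∃ γ ∈ Γ, g = a * γ * b}

/-- The right coset `Γ a`. -/
abbrev rightCoset (a : G) : Set G := bicoset Γ 1 a

/-- The left coset `a Γ`. -/
abbrev leftCoset (a : G) : Set G := bicoset Γ a 1

/-- The double coset `Γ a Γ`. -/
def dblCoset (a : G) : Set G := {g | ∃ γ₁ ∈ Γ, ∃ γ₂ ∈ Γ, g = γ₁ * a * γ₂}

/-- The space `Γ \ G` of cosets `Γ g`. -/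
abbrev CosetSpace : Type := Quotient (QuotientGroup.rightRel Γ)

/-- The class `Γ g` in `Γ \ G`. -/
def cosetMk (g : G) : CosetSpace Γ := Quotient.mk (QuotientGroup.rightRel Γ) g

open Classical in
/-- The action of the double coset `[Γ σ Γ]` on `ℓ²(Γ \ G)`: the basis vector of `Γ y` is mapped
to the sum of the basis vectors of the cosets `Γ x` contained in `Γ σ Γ y`. -/
def heckeOp (σ : G) : BL2 (CosetSpace Γ) := ofMatrix fun q r =>
  if ∃ x y, cosetMk Γ x = q ∧ cosetMk Γ y = r ∧ x * y⁻¹ ∈ dblCoset Γ σ then 1 else 0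

/-- If every double coset is a finite union of cosets, the Hecke operators have the stated matrix. -/
theorem heckeOp_spec (hfin : ∀ σ : G, (cosetMk Γ '' dblCoset Γ σ).Finite) (σ : G) :
    HasMatrix (heckeOp Γ σ) fun q r => open Classical in
      if ∃ x y, cosetMk Γ x = q ∧ cosetMk Γ y = r ∧ x * y⁻¹ ∈ dblCoset Γ σ then 1 else 0 := by
  classical
  refine ofMatrix_spec ?_
  have hmk : ∀ x y : G, cosetMk Γ x = cosetMk Γ y ↔ y * x⁻¹ ∈ Γ := fun x y => by
    rw [cosetMk, cosetMk, Quotient.eq]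
    exact QuotientGroup.rightRel_apply
  let R : CosetSpace Γ → G → CosetSpace Γ := fun q g =>
    Quotient.map' (s₁ := QuotientGroup.rightRel Γ) (s₂ := QuotientGroup.rightRel Γ)
      (fun x => x * g) (fun x y h => by
        rw [QuotientGroup.rightRel_apply] at h ⊢
        simpa [mul_assoc] using h) q
  let F : G → Finset (CosetSpace Γ) := fun τ => (hfin τ).toFinset
  have inv_mem : ∀ τ g : G, g ∈ dblCoset Γ τ → g⁻¹ ∈ dblCoset Γ τ⁻¹ := by
    rintro τ g ⟨a, ha, b, hb, rfl⟩
    exact ⟨b⁻¹, Γ.inv_mem hb, a⁻¹, Γ.inv_mem ha, by group⟩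
  have hrow : ∀ (τ : G) (q r : CosetSpace Γ),
      (∃ x y, cosetMk Γ x = q ∧ cosetMk Γ y = r ∧ y * x⁻¹ ∈ dblCoset Γ τ) →
      r ∈ (F τ).image fun s => R s q.out := by
    rintro τ q r ⟨x, y, rfl, rfl, h⟩
    have h0 : cosetMk Γ (cosetMk Γ x).out = cosetMk Γ x := Quotient.out_eq _
    set z := (cosetMk Γ x).out with hz
    refine Finset.mem_image.2 ⟨cosetMk Γ (y * z⁻¹), ?_, ?_⟩
    · rw [Set.Finite.mem_toFinset]
      refine ⟨_, ?_, rfl⟩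
      obtain ⟨a, ha, b, hb, hab⟩ := h
      refine ⟨a, ha, b * (x * z⁻¹), Γ.mul_mem hb ((hmk _ _).1 h0), ?_⟩
      rw [← mul_assoc, ← hab]
      group
    · change cosetMk Γ (y * z⁻¹ * z) = cosetMk Γ y
      rw [inv_mul_cancel_right]
  obtain ⟨S, hS⟩ := exists_incidence
    (fun q => ((F σ⁻¹).image fun s => R s q.out).filter fun r =>
      ∃ x y, cosetMk Γ x = q ∧ cosetMk Γ y = r ∧ x * y⁻¹ ∈ dblCoset Γ σ)
    (fun q => (F σ).image fun s => R s q.out)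
    (F σ⁻¹).card (F σ).card
    (fun q => (Finset.card_filter_le _ _).trans Finset.card_image_le)
    (fun q => Finset.card_image_le)
    (fun q r h => by
      obtain ⟨x, y, hx, hy, hxy⟩ := (Finset.mem_filter.1 h).2
      exact hrow σ r q ⟨y, x, hy, hx, hxy⟩)
  refine ⟨S, fun q r => ?_⟩
  rw [hS]
  beta_reduce
  have hiff : r ∈ (((F σ⁻¹).image fun s => R s q.out).filter fun r =>
      ∃ x y, cosetMk Γ x = q ∧ cosetMk Γ y = r ∧ x * y⁻¹ ∈ dblCoset Γ σ) ↔
      ∃ x y, cosetMk Γ x = q ∧ cosetMk Γ y = r ∧ x * y⁻¹ ∈ dblCoset Γ σ := by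
    rw [Finset.mem_filter]
    refine ⟨fun h => h.2, fun h => ⟨?_, h⟩⟩
    obtain ⟨x, y, hx, hy, hxy⟩ := h
    refine hrow σ⁻¹ q r ⟨x, y, hx, hy, ?_⟩
    have := inv_mem _ _ hxy
    rwa [mul_inv_rev, inv_inv] at this
  by_cases h : ∃ x y, cosetMk Γ x = q ∧ cosetMk Γ y = r ∧ x * y⁻¹ ∈ dblCoset Γ σ
  · rw [if_pos h, if_pos (hiff.2 h)]
  · rw [if_neg h, if_neg (fun h' => h (hiff.1 h'))]

/-- An element `x` of `L(G)` has the matrix `x(g h⁻¹)`. -/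
theorem groupVN_matrix {x : BL2 G} (hx : x ∈ groupVN G) :
    HasMatrix x fun g h => coeff x (g * h⁻¹) := by
  intro g h
  have hρ : permOp (Equiv.mulRight h⁻¹) ∈ StarSubalgebra.centralizer ℂ
      ((fun g : G => leftReg g) '' ((⊤ : Subgroup G) : Set G)) := by
    rw [StarSubalgebra.mem_centralizer_iff]
    rintro _ ⟨k, -, rfl⟩
    have hcomm : ∀ k : G, leftReg k * permOp (Equiv.mulRight h⁻¹) =
        permOp (Equiv.mulRight h⁻¹) * leftReg k := by
      intro k
      ext v l
      change (v : G → ℂ) (k⁻¹ * l * h⁻¹) = (v : G → ℂ) (k⁻¹ * (l * h⁻¹))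
      rw [mul_assoc]
    have hstar : star (leftReg k) = leftReg k⁻¹ := by
      rw [ContinuousLinearMap.star_eq_adjoint, eq_comm, ContinuousLinearMap.eq_adjoint_iff]
      intro v w
      rw [lp.inner_eq_tsum, lp.inner_eq_tsum]
      rw [← (Equiv.mulLeft k⁻¹).tsum_eq]
      refine tsum_congr fun l => ?_
      change inner ℂ ((v : G → ℂ) (k⁻¹⁻¹ * (k⁻¹ * l))) ((w : G → ℂ) (k⁻¹ * l)) =
        inner ℂ ((v : G → ℂ) l) ((w : G → ℂ) (k⁻¹ * l))
      rw [inv_inv, mul_inv_cancel_left]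
    exact ⟨hcomm k, by rw [hstar]; exact hcomm k⁻¹⟩
  have hc := ((StarSubalgebra.mem_centralizer_iff ℂ).1 hx _ hρ).1
  have hd : permOp (Equiv.mulRight h⁻¹) (delta (1 : G)) = delta h := by
    refine lp.ext (funext fun l => ?_)
    change (delta (1 : G) : G → ℂ) (l * h⁻¹) = (delta h : G → ℂ) l
    by_cases hl : l = h <;> simp [delta, lp.single_apply, mul_inv_eq_one, hl]
  rw [← hd]
  have := congrArg (fun T : BL2 G => (T (delta 1) : G → ℂ) g) hc
  exact this.symm

/-- The orthogonal projection of an element of `L(G)` onto `ℓ²(A)` is bounded when `A` is a set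
`a Γ b`. -/
theorem projOn_bicoset_spec {x : BL2 G} (hx : x ∈ groupVN G) (a b : G) :
    HasMatrix (projOn (bicoset Γ a b) x)
      fun g h => (bicoset Γ a b).indicator (coeff x) (g * h⁻¹) := by
  classical
  refine ofMatrix_spec ?_
  obtain ⟨S, hS⟩ := exists_block x (fun g => cosetMk Γ (a⁻¹ * g)) (fun h => cosetMk Γ (b * h))
  refine ⟨S, fun g h => ?_⟩
  rw [hS]
  beta_reduce
  rw [show (x (delta h) : G → ℂ) g = coeff x (g * h⁻¹) from groupVN_matrix hx g h,
    Set.indicator_apply]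
  have hiff : cosetMk Γ (a⁻¹ * g) = cosetMk Γ (b * h) ↔ g * h⁻¹ ∈ bicoset Γ a b := by
    rw [eq_comm, cosetMk, cosetMk, Quotient.eq]
    refine QuotientGroup.rightRel_apply.trans ⟨fun hm => ⟨_, hm, ?_⟩, ?_⟩
    · group
    · rintro ⟨γ, hγ, hg⟩
      have : a⁻¹ * g * (b * h)⁻¹ = γ := by
        rw [mul_inv_rev, ← mul_assoc, mul_assoc a⁻¹, hg]
        group
      rwa [this]
  by_cases hm : g * h⁻¹ ∈ bicoset Γ a b
  · rw [if_pos hm, if_pos (hiff.2 hm)]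
  · rw [if_neg hm, if_neg (fun h' => hm (hiff.1 h'))]

/-- The orthogonal projection of an element of `L(G)` onto `ℓ²(Γ σ Γ)` is bounded when `Γ σ Γ` is
a finite union of cosets. -/
theorem projOn_dblCoset_spec {x : BL2 G} (hx : x ∈ groupVN G) (σ : G)
    (hfin : (cosetMk Γ '' dblCoset Γ σ).Finite) :
    HasMatrix (projOn (dblCoset Γ σ) x)
      fun g h => (dblCoset Γ σ).indicator (coeff x) (g * h⁻¹) := by
  classical
  refine ofMatrix_spec ⟨∑ q ∈ hfin.toFinset, projOn (rightCoset Γ q.out) x, fun g h => ?_⟩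
  have hmk : ∀ x y : G, cosetMk Γ x = cosetMk Γ y ↔ y * x⁻¹ ∈ Γ := fun x y => by
    rw [cosetMk, cosetMk, Quotient.eq]
    exact QuotientGroup.rightRel_apply
  have hmem : ∀ (k : G) (q : CosetSpace Γ), k ∈ rightCoset Γ q.out ↔ cosetMk Γ k = q := by
    intro k q
    have h0 : cosetMk Γ q.out = q := Quotient.out_eq q
    constructor
    · rintro ⟨γ, hγ, rfl⟩
      rw [eq_comm, ← h0, hmk, h0]
      simpa using hγ
    · intro hq
      rw [← hq] at h0 ⊢
      exact ⟨_, (hmk _ _).1 h0, by group⟩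
  have hdbl : cosetMk Γ (g * h⁻¹) ∈ hfin.toFinset ↔ g * h⁻¹ ∈ dblCoset Γ σ := by
    rw [Set.Finite.mem_toFinset]
    refine ⟨?_, fun hg => ⟨_, hg, rfl⟩⟩
    rintro ⟨k, ⟨γ₁, h₁, γ₂, h₂, rfl⟩, hk⟩
    have h3 := (hmk _ _).1 hk
    refine ⟨_, Γ.mul_mem h3 h₁, γ₂, h₂, by group⟩
  have h1 : ((∑ q ∈ hfin.toFinset, projOn (rightCoset Γ q.out) x) (delta h) : G → ℂ) g =
      ∑ q ∈ hfin.toFinset, (projOn (rightCoset Γ q.out) x (delta h) : G → ℂ) g := by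
    rw [sum_apply, lp.coeFn_sum, Finset.sum_apply]
  rw [h1]
  have h2 : ∀ q : CosetSpace Γ, (projOn (rightCoset Γ q.out) x (delta h) : G → ℂ) g =
      if cosetMk Γ (g * h⁻¹) = q then coeff x (g * h⁻¹) else 0 := by
    intro q
    rw [projOn_bicoset_spec Γ hx]
    beta_reduce
    rw [Set.indicator_apply]
    simp only [hmem]
  simp only [h2, Finset.sum_ite_eq, hdbl, Set.indicator_apply]

/-- The algebraic Hecke algebra `ℂ(Γ \ G / Γ)`, realised on `ℓ²(Γ \ G)`. -/
def heckeAlg : StarSubalgebra ℂ (BL2 (CosetSpace Γ)) :=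
  StarAlgebra.adjoin ℂ (Set.range (heckeOp Γ))

/-- The reduced von Neumann Hecke algebra: the von Neumann algebra on `ℓ²(Γ \ G)` generated by the
double cosets. -/
def heckeVN : StarSubalgebra ℂ (BL2 (CosetSpace Γ)) :=
  StarSubalgebra.centralizer ℂ
    (StarSubalgebra.centralizer ℂ (Set.range (heckeOp Γ)) : Set (BL2 (CosetSpace Γ)))

/-- The double coset `[Γ σ Γ]` as an element of the Hecke algebra. -/
def heckeAlgMk (σ : G) : heckeAlg Γ := ⟨heckeOp Γ σ, StarAlgebra.subset_adjoin ℂ _ ⟨σ, rfl⟩⟩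

/-- The double coset `[Γ σ Γ]` as an element of the reduced von Neumann Hecke algebra. -/
def heckeVNMk (σ : G) : heckeVN Γ := ⟨heckeOp Γ σ, by
  rw [heckeVN, StarSubalgebra.mem_centralizer_iff]
  intro T hT
  rw [SetLike.mem_coe, StarSubalgebra.mem_centralizer_iff] at hT
  obtain ⟨h1, h2⟩ := hT _ ⟨σ, rfl⟩
  refine ⟨h1.symm, ?_⟩
  have := congrArg star h2
  rwa [star_mul, star_mul, star_star] at this⟩

/-- The canonical trace `a ↦ ⟨a δ_Γ, δ_Γ⟩` of the Hecke algebra: the coefficient of the identity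
double coset `Γ`. -/
def heckeTrace (a : BL2 (CosetSpace Γ)) : ℂ :=
  (a (delta (cosetMk Γ 1)) : CosetSpace Γ → ℂ) (cosetMk Γ 1)

/-- `x = ∑_{θ ∈ A} ⟨π(θ) η, η⟩ θ` for a unitary representation `π` of `G` on a Hilbert space `H`
whose restriction to `Γ` is unitarily equivalent, by `U`, to the left regular representation of `Γ`
(that is `dim_Γ H = 1`), where `η` is the vector corresponding to `δ_e`. (The inner product of
Mathlib is linear in the second variable.) -/
def ComesFromRep (A : Set G) (x : BL2 G) : Prop :=
  ∃ (H : Type) (_ : NormedAddCommGroup H) (_ : InnerProductSpace ℂ H) (_ : CompleteSpace H)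
    (π : G →* unitary (H →L[ℂ] H)) (U : H ≃ₗᵢ[ℂ] L2 Γ),
    (∀ (γ : Γ) (v : H), U ((π (γ : G) : H →L[ℂ] H) v) = leftReg γ (U v)) ∧
    ∀ g : G, coeff x g = A.indicator
      (fun θ => inner ℂ (U.symm (delta 1)) ((π θ : H →L[ℂ] H) (U.symm (delta 1)))) g

end Group

/-! ### The element `χ₁` of the free group factor -/

/-- The sum of the words of length one in the group algebra of the free group on `N` generators,
acting on `ℓ²` of that group. -/
def chiOne (N : ℕ) : BL2 (FreeGroup (Fin N)) :=
  ∑ i, (leftReg (FreeGroup.of i) + leftReg (FreeGroup.of i)⁻¹)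

/-! ### The groups `PGL₂⁺(ℤ[1/p])` and `PSL₂(ℤ)` -/

/-- The ring `ℤ[1/p]`. -/
abbrev ZInv (p : ℕ) : Type := Subring.closure ({(p : ℚ)⁻¹} : Set ℚ)

/-- The group of the classes in `PGL₂(ℤ[1/p])` of matrices with positive determinant. -/
def pglPos (p : ℕ) : Subgroup PGL(2, ZInv p) :=
  (Matrix.GLPos (Fin 2) (ZInv p)).map Matrix.ProjGenLinGroup.mk

/-- The group `G = PGL₂⁺(ℤ[1/p])`, as a type. -/
abbrev GG (p : ℕ) : Type := pglPos p

/-- The modular group `Γ = PSL₂(ℤ)` in `G`: the classes of the matrices of `SL₂(ℤ)`. -/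
def modGroup (p : ℕ) : Subgroup (GG p) :=
  (MonoidHom.range ((Matrix.SpecialLinearGroup.toPGL (n := Fin 2) (R := ZInv p)).comp
    (Matrix.SpecialLinearGroup.map (Int.castRingHom (ZInv p))))).subgroupOf (pglPos p)

/-- Every double coset of the modular group in `G` is a finite union of cosets. -/
theorem modGroup_finite (p : ℕ) (σ : GG p) :
    (cosetMk (modGroup p) '' dblCoset (modGroup p) σ).Finite := by
  obtain ⟨s, g, hg, rfl⟩ := σ
  let i : ZInv p →+* ℚ := Subring.subtype _
  have hi : Function.Injective i := Subtype.val_injective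
  let toG : SL(2, ℤ) →* GL (Fin 2) (ZInv p) :=
    Matrix.SpecialLinearGroup.toGL.comp (Matrix.SpecialLinearGroup.map (Int.castRingHom (ZInv p)))
  have hpos : ∀ x, toG x ∈ Matrix.GLPos (Fin 2) (ZInv p) := fun x => by
    change (0 : ZInv p) < (Matrix.SpecialLinearGroup.map (Int.castRingHom (ZInv p)) x).1.det
    rw [Matrix.SpecialLinearGroup.det_coe]
    exact zero_lt_one
  let j : SL(2, ℤ) →* GG p :=
    (Matrix.ProjGenLinGroup.mk.comp toG).codRestrict (pglPos p) fun x => ⟨toG x, hpos x, rfl⟩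
  have hj : ∀ γ, γ ∈ modGroup p ↔ ∃ x, j x = γ := fun γ => by
    rw [modGroup, Subgroup.mem_subgroupOf, MonoidHom.mem_range]
    exact exists_congr fun x => (Subtype.ext_iff (a1 := j x) (a2 := γ)).symm
  have hmap : ∀ x, Matrix.GeneralLinearGroup.map i (toG x) =
      Matrix.SpecialLinearGroup.mapGL ℚ x := fun x => by
    ext a b
    simp [toG, i]
  have hmapinj : Function.Injective (Matrix.GeneralLinearGroup.map (n := Fin 2) i) := by
    intro A B hAB
    ext a b
    have := congrArg (fun C : GL (Fin 2) ℚ => C a b) hAB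
    simpa [i] using this
  obtain ⟨N, hN, hconj⟩ := CongruenceSubgroup.exists_Gamma_le_conj
    (Matrix.GeneralLinearGroup.map i g) 1
  have : NeZero N := ⟨hN⟩
  set σ : GG p := ⟨Matrix.ProjGenLinGroup.mk g, g, hg, rfl⟩ with hσ
  have hc : ∀ x ∈ CongruenceSubgroup.Gamma N, σ * j x * σ⁻¹ ∈ modGroup p := by
    intro x hx
    obtain ⟨y, -, hy⟩ := hconj x hx
    rw [hj]
    refine ⟨y, Subtype.ext ?_⟩
    have h1 : toG y = g * toG x * g⁻¹ := by
      apply hmapinj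
      rw [map_mul, map_mul, map_inv, hmap, hmap]
      exact hy
    change Matrix.ProjGenLinGroup.mk (toG y) = Matrix.ProjGenLinGroup.mk g *
      Matrix.ProjGenLinGroup.mk (toG x) * (Matrix.ProjGenLinGroup.mk g)⁻¹
    rw [h1, map_mul, map_mul, map_inv]
  have hmk : ∀ x y : GG p, y * x⁻¹ ∈ modGroup p →
      cosetMk (modGroup p) x = cosetMk (modGroup p) y := fun x y h => by
    rw [cosetMk, cosetMk, Quotient.eq]
    exact QuotientGroup.rightRel_apply.2 h
  let f : SL(2, ℤ) ⧸ CongruenceSubgroup.Gamma N → CosetSpace (modGroup p) :=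
    fun q => cosetMk (modGroup p) (σ * j q.out)
  refine (Set.finite_range f).subset ?_
  rintro _ ⟨k, ⟨γ₁, h₁, γ₂, h₂, rfl⟩, rfl⟩
  obtain ⟨x, rfl⟩ := (hj γ₂).1 h₂
  refine ⟨QuotientGroup.mk x, hmk _ _ ?_⟩
  set z := Quotient.out (QuotientGroup.mk x : SL(2, ℤ) ⧸ CongruenceSubgroup.Gamma N) with hz
  have hzx : z⁻¹ * x ∈ CongruenceSubgroup.Gamma N :=
    QuotientGroup.eq.1 (Quotient.out_eq _)
  have hzx' : x * z⁻¹ ∈ CongruenceSubgroup.Gamma N :=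
    (CongruenceSubgroup.Gamma_normal N).mem_comm hzx
  have h3 := (modGroup p).mul_mem h₁ (hc _ hzx')
  have h4 : γ₁ * (σ * j (x * z⁻¹) * σ⁻¹) = γ₁ * σ * j x * (σ * j z)⁻¹ := by
    rw [map_mul, map_inv]
    group
  rwa [h4] at h3

/-- `p` as a unit of `ℤ[1/p]`. -/
def pUnit (p : ℕ) [Fact p.Prime] : (ZInv p)ˣ where
  val := (p : ZInv p)
  inv := ⟨(p : ℚ)⁻¹, Subring.subset_closure rfl⟩
  val_inv := Subtype.ext (by
    have : (p : ℚ) ≠ 0 := Nat.cast_ne_zero.2 (Fact.out : p.Prime).ne_zero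
    simp [this])
  inv_val := Subtype.ext (by
    have : (p : ℚ) ≠ 0 := Nat.cast_ne_zero.2 (Fact.out : p.Prime).ne_zero
    simp [this])

/-- The diagonal matrix with entries `p ^ n` and `1`. -/
def sigmaGL (p : ℕ) [Fact p.Prime] (n : ℕ) : GL (Fin 2) (ZInv p) where
  val := !![((pUnit p ^ n : (ZInv p)ˣ) : ZInv p), 0; 0, 1]
  inv := !![(((pUnit p ^ n)⁻¹ : (ZInv p)ˣ) : ZInv p), 0; 0, 1]
  val_inv := by
    rw [Matrix.mul_fin_two, Matrix.one_fin_two, Units.mul_inv]; simp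
  inv_val := by
    rw [Matrix.mul_fin_two, Matrix.one_fin_two, Units.inv_mul]; simp

/-- The class `σ_{p^n}` in `G` of the diagonal matrix with entries `p ^ n` and `1`. -/
def sigma (p : ℕ) [Fact p.Prime] (n : ℕ) : GG p :=
  ⟨Matrix.ProjGenLinGroup.mk (sigmaGL p n), sigmaGL p n, by
    have hp : (0 : ZInv p) < (p : ZInv p) := Nat.cast_pos.2 (Fact.out : p.Prime).pos
    change (0 : ZInv p) < (sigmaGL p n).1.det
    simp only [sigmaGL, Matrix.det_fin_two_of, Units.val_pow_eq_pow_val, pUnit]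
    simp only [mul_one, mul_zero, sub_zero]
    exact pow_pos hp n, rfl⟩

/-! ### The components of the powers of `X` -/

section Components

variable {p : ℕ} [Fact p.Prime]

/-- The double coset `Γ σ_{p^n} Γ`. -/
def dc (p : ℕ) [Fact p.Prime] (n : ℕ) : Set (GG p) := dblCoset (modGroup p) (sigma p n)

/-- `X_n`, the projection of `X ^ n` onto `ℓ²(Γ σ_{p^n} Γ)`. -/
def powComp (X : BL2 (GG p)) (n : ℕ) : BL2 (GG p) := projOn (dc p n) (X ^ n)

/-- `X_A`, the projection onto `ℓ²(A)` of the formal sum `∑_e X_e`. At each element of `G` a single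
summand is nonzero, as the double cosets `Γ σ_{p^e} Γ` form a partition of `G`. If `A` is contained
in `Γ σ_{p^e} Γ`, this is the projection of `X_e`; in general it is the projection of the sum of
the `X_e` over any set of `e` such that the `Γ σ_{p^e} Γ` cover `A`. -/
def comp (X : BL2 (GG p)) (A : Set (GG p)) : BL2 (GG p) :=
  convOp (A.indicator fun g => ∑ᶠ e : ℕ, coeff (powComp X e) g)

/-- The relations `(X_{Γσ})* = X_{σ⁻¹Γ}` and `X_{σ₁Γ} X_{Γσ₂} = X_{σ₁Γσ₂}`. -/
def CosetRelations (X : BL2 (GG p)) : Prop :=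
  (∀ σ : GG p, star (comp X (rightCoset (modGroup p) σ)) =
    comp X (leftCoset (modGroup p) σ⁻¹)) ∧
  ∀ σ₁ σ₂ : GG p, comp X (leftCoset (modGroup p) σ₁) * comp X (rightCoset (modGroup p) σ₂) =
    comp X (bicoset (modGroup p) σ₁ σ₂)

/-- The relation `X_{Γσ₁Γ} X_{Γσ₂} = ∑_j X_{Γσ₁r_jσ₂}`, whenever `Γσ₁Γ` is the disjoint union of
the cosets `Γσ₁r_j`, with `r_j ∈ Γ`. -/
def WeakCosetRelations (X : BL2 (GG p)) : Prop :=
  ∀ (σ₁ σ₂ : GG p) (r : Finset (modGroup p)),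
    (r : Set (modGroup p)).PairwiseDisjoint
      (fun γ => rightCoset (modGroup p) (σ₁ * (γ : GG p))) →
    (⋃ γ ∈ r, rightCoset (modGroup p) (σ₁ * (γ : GG p))) = dblCoset (modGroup p) σ₁ →
    comp X (dblCoset (modGroup p) σ₁) * comp X (rightCoset (modGroup p) σ₂) =
      ∑ γ ∈ r, comp X (rightCoset (modGroup p) (σ₁ * (γ : GG p) * σ₂))

/-- Left multiplication by `X_n`, `n ≥ 1`, acts on the elements `X_{Γσ}` as `[Γσ_{p^n}Γ]` acts on
the basis vectors of `ℓ²(Γ \ G)`. -/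
def ActsAsHecke (X : BL2 (GG p)) : Prop :=
  ∀ (n : ℕ) (σ : GG p), 1 ≤ n →
    powComp X n * comp X (rightCoset (modGroup p) σ) =
      ∑ᶠ q : CosetSpace (modGroup p),
        (heckeOp (modGroup p) (sigma p n) (delta (cosetMk (modGroup p) σ)) :
          CosetSpace (modGroup p) → ℂ) q • comp X {g | cosetMk (modGroup p) g = q}

end Components

end HeckeRep

end

open scoped Pointwise ComplexOrder MatrixGroups

noncomputable section

namespace HeckeRep

/-! Let t be the function on G with t(g) = X_n(g), where n is the level of g, that is g ∈ Γσ_{p^n}Γ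
(`symbol`). Parts (2) and (3) are governed by one identity, Σ_{γ∈Γ} t(aγ) t(γ⁻¹b) = t(ab) for all a,
b (`SymbolMul`). Comparison of coefficients shows that it is equivalent to (b), the adjoint relation
being automatic from X = X* (`cosetRelations_iff`), and either hypothesis of (3) gives it through
the coefficient at ab. If the identity holds, the vectors v_g = (t(γ⁻¹g))_γ of ℓ²(Γ) satisfy ⟨v_g,
v_h⟩ = t(g⁻¹h), and δ_γ ↦ v_{gγ} defines the representation sought (`IsMatrixCoeff.rep`).
Conversely, Parseval's equation in the orthonormal basis π(γ)η gives the identity for the matrix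
coefficient of η, and an induction on the level identifies that coefficient with t
(`symbol_eq_of_isMatrixCoeff`).

The arithmetic input is that Γ\G is the vertex set of the (p+1)-regular tree, the level being the
distance from the root Γ. An element of G has a primitive integral representative of determinant
p^n, and n is its level. Left multiplication by the inverses of the p+1 representatives of Γσ_pΓ/Γ
raises a positive level by one, except for exactly one representative, which lowers it by one
(`exists_level_nbr_inv_mul`).

For (1), [Γσ_pΓ] and χ₁ are adjacency operators of this tree, so their moments count the same closed
walks. The condition therefore says that X and [Γσ_pΓ] have equal moments. Then a partial isometry
intertwines the two self-adjoint operators, and since δ_e is cyclic for the commutant of X, the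
whole bicommutant of [Γσ_pΓ] can be transported along it (`exists_starAlgHom_of_moments`).

For Ψ, the flip δ_γ ↦ δ_{γ⁻¹} turns a ∈ L(Γ) into an operator T commuting with π(Γ), and E(X_n a
X_n) into Σ π(r)* T π(r) over the cosets Γr in Γσ_{p^n}Γ, the usual Hecke operator on intertwiners
(`compress_condExp`). These maps thus obey the three-term recursion of the double cosets
(`psi_one_mul`). As ℋ₀ is the polynomial algebra in [Γσ_pΓ], the image of this generator determines
Ψ, and the recursion identifies the other images. Complete positivity holds because E cuts an
operator down to its diagonal blocks for ℓ²(G) = ⊕ ℓ²(Γx). -/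

/-! ### Matrices of bounded operators between `ℓ²` spaces -/

section Matrices

variable {ι κ ν : Type}

/-- The `i`-th coordinate of a vector of `ℓ²(ι)`. -/
def coord (v : L2 ι) (i : ι) : ℂ := v i

theorem coord_ext {v w : L2 ι} (h : ∀ i, coord v i = coord w i) : v = w := lp.ext (funext h)

theorem coord_smul (c : ℂ) (v : L2 ι) (i : ι) : coord (c • v) i = c * coord v i := rfl

theorem coord_zero (i : ι) : coord (0 : L2 ι) i = 0 := rfl

theorem coord_permOp (e : ι ≃ ι) (v : L2 ι) (i : ι) : coord (permOp e v) i = coord v (e i) := rfl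

theorem coord_delta (i j : ι) [Decidable (j = i)] :
    coord (delta i) j = if j = i then 1 else 0 := by
  classical
  rw [coord, delta, lp.single_apply, Pi.single_apply]
  congr

theorem hasSum_inner_coord (v w : L2 ι) :
    HasSum (fun i => (starRingEnd ℂ) (coord v i) * coord w i) (inner ℂ v w) := by
  have h := lp.hasSum_inner (𝕜 := ℂ) (G := fun _ : ι => ℂ) v w
  have e : (fun i => (starRingEnd ℂ) (coord v i) * coord w i) =
      fun i => inner ℂ ((v : ∀ _ : ι, ℂ) i) ((w : ∀ _ : ι, ℂ) i) := by
    funext i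
    rw [RCLike.inner_apply, mul_comm]
    rfl
  rw [e]
  exact h

theorem inner_delta_left (i : ι) (v : L2 ι) : inner ℂ (delta i) v = coord v i := by
  classical
  refine (hasSum_inner_coord (delta i) v).unique ?_
  have h := hasSum_ite_eq i (coord v i)
  convert! h using 2 with j
  rw [coord_delta]
  split_ifs with hj
  · rw [hj, map_one, one_mul]
  · rw [map_zero, zero_mul]

theorem inner_delta_right (i : ι) (v : L2 ι) :
    inner ℂ v (delta i) = (starRingEnd ℂ) (coord v i) := by
  rw [← inner_delta_left, inner_conj_symm]

theorem hasSum_delta (v : L2 ι) : HasSum (fun j => coord v j • delta j) v := by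
  classical
  have h := lp.hasSum_single (E := fun _ : ι => ℂ) (p := 2) (by norm_num) v
  convert! h using 2 with j
  refine coord_ext fun i => ?_
  rw [coord_smul, coord_delta]
  change _ = (lp.single 2 j (coord v j) : ∀ _ : ι, ℂ) i
  rw [lp.single_apply, Pi.single_apply]
  split_ifs <;> simp

/-- The value of a coordinate, as a continuous linear functional. -/
def coordCLM (i : ι) : L2 ι →L[ℂ] ℂ := innerSL ℂ (delta i)

theorem coordCLM_apply (i : ι) (v : L2 ι) : coordCLM i v = coord v i := inner_delta_left i v

theorem coord_sum {α : Type*} (s : Finset α) (v : α → L2 ι) (i : ι) :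
    coord (∑ a ∈ s, v a) i = ∑ a ∈ s, coord (v a) i := by
  simp only [← coordCLM_apply, map_sum]

theorem hasSum_apply_clm {E : Type*} [NormedAddCommGroup E] [NormedSpace ℂ E] (T : L2 ι →L[ℂ] E)
    (v : L2 ι) : HasSum (fun j => coord v j • T (delta j)) (T v) := by
  have := T.hasSum (hasSum_delta v)
  simpa using this

theorem clm_ext_delta {E : Type*} [NormedAddCommGroup E] [NormedSpace ℂ E] {S T : L2 ι →L[ℂ] E}
    (h : ∀ j, S (delta j) = T (delta j)) : S = T := by
  ext v
  have h1 := hasSum_apply_clm S v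
  simp only [h] at h1
  exact h1.unique (hasSum_apply_clm T v)

/-- The matrix entry `⟨T δ_j, δ_i⟩`. -/
def entry (T : L2 ι →L[ℂ] L2 κ) (i : κ) (j : ι) : ℂ := coord (T (delta j)) i

theorem coord_apply_delta (T : L2 ι →L[ℂ] L2 κ) (i : κ) (j : ι) :
    coord (T (delta j)) i = entry T i j := rfl

theorem entry_ext {S T : L2 ι →L[ℂ] L2 κ} (h : ∀ i j, entry S i j = entry T i j) : S = T :=
  clm_ext_delta fun j => coord_ext fun i => h i j

/-- `ofMatrix` is a choice with default value zero. Entries determine a bounded operator, so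
exhibiting one with the right entries evaluates it. -/
theorem entry_ofMatrix {T : BL2 ι} {M : ι → ι → ℂ} (hT : ∀ i j, entry T i j = M i j) :
    ofMatrix M = T :=
  entry_ext fun i j => (ofMatrix_spec ⟨T, hT⟩ i j).trans (hT i j).symm

theorem hasSum_coord_apply (T : L2 ι →L[ℂ] L2 κ) (v : L2 ι) (i : κ) :
    HasSum (fun j => entry T i j * coord v j) (coord (T v) i) := by
  have := hasSum_apply_clm ((coordCLM i).comp T) v
  simpa [coordCLM_apply, coord_apply_delta, mul_comm] using this

theorem hasSum_entry_comp (S : L2 κ →L[ℂ] L2 ν) (T : L2 ι →L[ℂ] L2 κ) (i : ν) (j : ι) :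
    HasSum (fun k => entry S i k * entry T k j) (entry (S.comp T) i j) :=
  hasSum_coord_apply S (T (delta j)) i

theorem hasSum_entry_mul (S T : BL2 ι) (i j : ι) :
    HasSum (fun k => entry S i k * entry T k j) (entry (S * T) i j) :=
  hasSum_entry_comp S T i j

theorem entry_adjoint (T : L2 ι →L[ℂ] L2 κ) (j : ι) (i : κ) :
    entry (ContinuousLinearMap.adjoint T) j i = (starRingEnd ℂ) (entry T i j) := by
  rw [entry, ← inner_delta_left, ContinuousLinearMap.adjoint_inner_right, inner_delta_right, entry]

theorem entry_star (T : BL2 ι) (i j : ι) : entry (star T) i j = (starRingEnd ℂ) (entry T j i) :=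
  entry_adjoint T i j

theorem entry_add (S T : L2 ι →L[ℂ] L2 κ) (i : κ) (j : ι) :
    entry (S + T) i j = entry S i j + entry T i j := rfl

theorem entry_smul (c : ℂ) (T : L2 ι →L[ℂ] L2 κ) (i : κ) (j : ι) :
    entry (c • T) i j = c * entry T i j := rfl

theorem entry_one (i j : ι) [Decidable (i = j)] :
    entry (1 : BL2 ι) i j = if i = j then 1 else 0 := coord_delta j i

theorem entry_sum {α : Type*} (s : Finset α) (T : α → L2 ι →L[ℂ] L2 κ) (i : κ) (j : ι) :
    entry (∑ a ∈ s, T a) i j = ∑ a ∈ s, entry (T a) i j := by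
  rw [entry, sum_apply, coord_sum]; rfl

/-- The coordinate projection onto `ℓ²(A)`. -/
def restrictCLM (A : Set ι) : BL2 ι :=
  LinearMap.mkContinuous (restrictVec A) 1 fun v => by
    refine lp.norm_le_of_forall_sum_le (by norm_num) (by positivity) fun s => ?_
    refine (Finset.sum_le_sum fun i _ => ?_).trans (by simpa using l2_sum_le v s)
    change ‖A.indicator v i‖ ^ _ ≤ _
    simp only [ENNReal.toReal_ofNat, Real.rpow_two]
    gcongr
    exact norm_indicator_le_norm_self _ _

theorem coord_restrictCLM (A : Set ι) (v : L2 ι) (i : ι) :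
    coord (restrictCLM A v) i = A.indicator (coord v) i := rfl

end Matrices

/-! ### Convolution operators -/

section Convolution

variable {G : Type} [Group G]

theorem coord_leftReg (g : G) (v : L2 G) (h : G) :
    coord (leftReg g v) h = coord v (g⁻¹ * h) := rfl

theorem leftReg_delta (g h : G) : leftReg g (delta h) = delta (g * h) := by
  classical
  refine coord_ext fun l => ?_
  rw [coord_leftReg, coord_delta, coord_delta]
  exact if_congr inv_mul_eq_iff_eq_mul rfl rfl

theorem star_leftReg (g : G) : star (leftReg g) = leftReg g⁻¹ := by
  classical
  refine entry_ext fun i j => ?_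
  rw [entry_star, entry, entry, leftReg_delta, leftReg_delta, coord_delta, coord_delta,
    apply_ite (starRingEnd ℂ), map_one, map_zero]
  exact if_congr (by rw [eq_inv_mul_iff_mul_eq, eq_comm]) rfl rfl

/-- The adjoints in the definition of the centralizer cost nothing, because λ(g)* = λ(g⁻¹) and S is
closed under inverses. -/
theorem mem_commutant_iff {S : Subgroup G} {z : BL2 G} :
    z ∈ StarSubalgebra.centralizer ℂ ((fun g : G => leftReg g) '' (S : Set G)) ↔
      ∀ g ∈ S, leftReg g * z = z * leftReg g := by
  rw [StarSubalgebra.mem_centralizer_iff]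
  constructor
  · exact fun h g hg => (h _ ⟨g, hg, rfl⟩).1
  · rintro h _ ⟨g, hg, rfl⟩
    exact ⟨h g hg, by simpa only [star_leftReg] using h _ (S.inv_mem hg)⟩

theorem mem_vnOf_iff {S : Subgroup G} {x : BL2 G} :
    x ∈ vnOf S ↔ ∀ z : BL2 G, (∀ g ∈ S, leftReg g * z = z * leftReg g) → z * x = x * z := by
  rw [vnOf, StarSubalgebra.mem_centralizer_iff]
  constructor
  · exact fun h z hz => (h z (mem_commutant_iff.2 hz)).1
  · intro h z hz
    exact ⟨h z (mem_commutant_iff.1 hz), h _ (mem_commutant_iff.1 (star_mem hz))⟩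

theorem vnOf_mono {S T : Subgroup G} (h : S ≤ T) : vnOf S ≤ vnOf T := fun _ hx =>
  mem_vnOf_iff.2 fun z hz => mem_vnOf_iff.1 hx z fun g hg => hz g (h hg)

theorem vnOf_le_groupVN (S : Subgroup G) : vnOf S ≤ groupVN G := vnOf_mono le_top

/-- An operator whose matrix is `f(g h⁻¹)`, with `f` supported on `S`, belongs to `L(S)`. -/
theorem mem_vnOf_of_entry {S : Subgroup G} {x : BL2 G} {f : G → ℂ}
    (hx : ∀ g h, entry x g h = f (g * h⁻¹)) (hf : ∀ g, g ∉ S → f g = 0) : x ∈ vnOf S := by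
  refine mem_vnOf_iff.2 fun z hz => entry_ext fun g h => ?_
  have hinv : ∀ k ∈ S, ∀ g h, entry z (k * g) (k * h) = entry z g h := by
    intro k hk g h
    have h1 : coord (leftReg k (z (delta h))) (k * g) = coord (z (leftReg k (delta h))) (k * g) :=
      congrArg (fun T : BL2 G => coord (T (delta h)) (k * g)) (hz k hk)
    rw [coord_leftReg, leftReg_delta, inv_mul_cancel_left] at h1
    exact h1.symm
  have h1 := hasSum_entry_mul x z g h
  have h2 := hasSum_entry_mul z x g h
  -- The substitution k ↦ g k⁻¹ h turns the sum for (z x)(g, h) into Σ z(g, g k⁻¹ h) f(g k⁻¹). For g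
  -- k⁻¹ ∈ S, invariance of z gives z(g, g k⁻¹ h) = z(k, h), which is the sum for (x z)(g, h).
  let e : G ≃ G := ((Equiv.mulRight g⁻¹).trans (Equiv.inv G)).trans (Equiv.mulRight h)
  have he : ∀ k, e k = (k * g⁻¹)⁻¹ * h := fun k => rfl
  rw [← e.hasSum_iff] at h2
  refine h2.unique ?_
  convert! h1 using 2 with k
  rw [Function.comp_apply, he, hx, hx, mul_inv_cancel_right, mul_inv_rev, inv_inv]
  by_cases hk : g * k⁻¹ ∈ S
  · rw [mul_comm, ← hinv _ hk k h]
    congr 2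
    group
  · rw [hf _ hk, mul_zero, zero_mul]

theorem mem_groupVN_of_entry {x : BL2 G} {f : G → ℂ}
    (hx : ∀ g h, entry x g h = f (g * h⁻¹)) : x ∈ groupVN G :=
  mem_vnOf_of_entry hx fun g hg => absurd (Subgroup.mem_top g) hg

theorem coeff_eq_entry (x : BL2 G) (g : G) : coeff x g = entry x g 1 := rfl

theorem coeff_of_entry {x : BL2 G} {f : G → ℂ}
    (hx : ∀ g h, entry x g h = f (g * h⁻¹)) (g : G) : coeff x g = f g := by
  rw [coeff_eq_entry, hx, inv_one, mul_one]

theorem entry_of_mem_groupVN {x : BL2 G} (hx : x ∈ groupVN G) (g h : G) :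
    entry x g h = coeff x (g * h⁻¹) := groupVN_matrix hx g h

theorem groupVN_ext {x y : BL2 G} (hx : x ∈ groupVN G) (hy : y ∈ groupVN G)
    (h : ∀ g, coeff x g = coeff y g) : x = y :=
  entry_ext fun i j => by rw [entry_of_mem_groupVN hx, entry_of_mem_groupVN hy, h]

/-- Only the left factor has to lie in L(G): the right one enters through its vector y δ_e alone. -/
theorem hasSum_coeff_mul {x : BL2 G} (hx : x ∈ groupVN G) (y : BL2 G) (g : G) :
    HasSum (fun h => coeff x h * coeff y (h⁻¹ * g)) (coeff (x * y) g) := by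
  have := hasSum_entry_mul x y g 1
  let e : G ≃ G := (Equiv.inv G).trans (Equiv.mulRight g)
  have he : ∀ k, e k = k⁻¹ * g := fun k => rfl
  rw [← e.hasSum_iff] at this
  rw [coeff_eq_entry (x * y)]
  convert! this using 2 with k
  rw [Function.comp_apply, he, entry_of_mem_groupVN hx, coeff_eq_entry y, mul_inv_rev, inv_inv,
    mul_inv_cancel_left]

theorem coeff_star {x : BL2 G} (hx : x ∈ groupVN G) (g : G) :
    coeff (star x) g = (starRingEnd ℂ) (coeff x g⁻¹) := by
  rw [coeff_eq_entry, entry_star, entry_of_mem_groupVN hx, one_mul]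

theorem coeff_one (g : G) [Decidable (g = 1)] :
    coeff (1 : BL2 G) g = if g = 1 then 1 else 0 := entry_one g 1

theorem coeff_sum {α : Type*} (s : Finset α) (x : α → BL2 G) (g : G) :
    coeff (∑ a ∈ s, x a) g = ∑ a ∈ s, coeff (x a) g := entry_sum s x g 1

theorem coeff_add (x y : BL2 G) (g : G) : coeff (x + y) g = coeff x g + coeff y g := rfl

theorem coeff_smul (c : ℂ) (x : BL2 G) (g : G) : coeff (c • x) g = c * coeff x g := rfl

theorem convOp_eq {x : BL2 G} (hx : x ∈ groupVN G) {f : G → ℂ} (h : ∀ g, f g = coeff x g) :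
    convOp f = x :=
  entry_ofMatrix fun g k => by rw [entry_of_mem_groupVN hx, h]

/-- The coordinate projection onto ℓ²(S) commutes with λ(S), hence with x, and it fixes δ_e; so x
δ_e lies in ℓ²(S). -/
theorem coeff_eq_zero_of_mem_vnOf {S : Subgroup G} {x : BL2 G} (hx : x ∈ vnOf S) {g : G}
    (hg : g ∉ S) : coeff x g = 0 := by
  classical
  have hcomm := mem_vnOf_iff.1 hx (restrictCLM (S : Set G)) fun k hk => by
    refine ContinuousLinearMap.ext fun v => coord_ext fun i => ?_
    change coord (leftReg k (restrictCLM (S : Set G) v)) i =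
      coord (restrictCLM (S : Set G) (leftReg k v)) i
    rw [coord_leftReg, coord_restrictCLM, coord_restrictCLM, Set.indicator_apply,
      Set.indicator_apply, coord_leftReg]
    simp [Subgroup.mul_mem_cancel_left, hk]
  have h1 : restrictCLM (S : Set G) (delta 1) = delta 1 := by
    refine coord_ext fun i => ?_
    rw [coord_restrictCLM, Set.indicator_apply_eq_self, coord_delta]
    intro hi
    exact if_neg fun h => hi (by rw [h]; exact S.one_mem)
  have h2 : coord (restrictCLM (S : Set G) (x (delta 1))) g =
      coord (x (restrictCLM (S : Set G) (delta 1))) g :=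
    congrArg (fun T : BL2 G => coord (T (delta 1)) g) hcomm
  rw [h1, coord_restrictCLM, Set.indicator_of_notMem (by exact hg)] at h2
  exact h2.symm

end Convolution

/-! ### Integral representatives of the elements of `PGL₂⁺(ℤ[1/p])` -/

section Arithmetic

variable {p : ℕ}

/-- The integral matrix `M` represents the class `g`. -/
def Represents (M : Matrix (Fin 2) (Fin 2) ℤ) (g : GG p) : Prop :=
  ∃ A : GL (Fin 2) (ZInv p), (A : Matrix (Fin 2) (Fin 2) (ZInv p)) = M.map (Int.castRingHom _) ∧
    Matrix.ProjGenLinGroup.mk A = (g : PGL(2, ZInv p))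

/-- The entries of `M` are not all divisible by `p`. -/
def IsPrim (p : ℕ) (M : Matrix (Fin 2) (Fin 2) ℤ) : Prop := ¬ ∀ i j, (p : ℤ) ∣ M i j

theorem Represents.mul {M N : Matrix (Fin 2) (Fin 2) ℤ} {g h : GG p} (hM : Represents M g)
    (hN : Represents N h) : Represents (M * N) (g * h) := by
  obtain ⟨A, hA, hA'⟩ := hM
  obtain ⟨B, hB, hB'⟩ := hN
  refine ⟨A * B, ?_, ?_⟩
  · rw [Matrix.map_mul, ← hA, ← hB]; rfl
  · rw [map_mul, hA', hB']; rfl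

theorem Represents.unique {M : Matrix (Fin 2) (Fin 2) ℤ} {g h : GG p} (hM : Represents M g)
    (hN : Represents M h) : g = h := by
  obtain ⟨A, hA, hA'⟩ := hM
  obtain ⟨B, hB, hB'⟩ := hN
  have : A = B := Units.ext (hA.trans hB.symm)
  exact Subtype.ext (by rw [← hA', ← hB', this])

theorem represents_one : Represents 1 (1 : GG p) :=
  ⟨1, by simp, rfl⟩

theorem zinv_cast_injective : Function.Injective (Int.castRingHom (ZInv p)) :=
  fun a b h => by
    have := congrArg (Subtype.val) h
    simpa using this

theorem zinv_exists_pow_mul (hp : p ≠ 0) (x : ZInv p) :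
    ∃ (k : ℕ) (m : ℤ), x * (p : ZInv p) ^ k = (m : ZInv p) := by
  have hp' : (p : ℚ) ≠ 0 := Nat.cast_ne_zero.2 hp
  have key : ∀ x ∈ Subring.closure ({(p : ℚ)⁻¹} : Set ℚ), ∃ (k : ℕ) (m : ℤ),
      x * (p : ℚ) ^ k = m := by
    intro x hx
    induction hx using Subring.closure_induction with
    | mem x hx =>
      obtain rfl : x = _ := hx
      exact ⟨1, 1, by simp [hp']⟩
    | zero => exact ⟨0, 0, by simp⟩
    | one => exact ⟨0, 1, by simp⟩
    | add x y _ _ hx hy =>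
      obtain ⟨k, m, h⟩ := hx
      obtain ⟨l, n, h'⟩ := hy
      refine ⟨k + l, m * p ^ l + n * p ^ k, ?_⟩
      push_cast
      rw [← h, ← h']
      ring
    | neg x _ hx =>
      obtain ⟨k, m, h⟩ := hx
      exact ⟨k, -m, by push_cast; rw [← h]; ring⟩
    | mul x y _ _ hx hy =>
      obtain ⟨k, m, h⟩ := hx
      obtain ⟨l, n, h'⟩ := hy
      refine ⟨k + l, m * n, ?_⟩
      push_cast
      rw [← h, ← h']
      ring
  obtain ⟨k, m, h⟩ := key x x.2
  exact ⟨k, m, Subtype.ext (by simpa using h)⟩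

theorem coe_mul_scalar (A : GL (Fin 2) (ZInv p)) (u : (ZInv p)ˣ) (i j : Fin 2) :
    ((A * Matrix.GeneralLinearGroup.scalar (Fin 2) u : GL (Fin 2) (ZInv p)) :
      Matrix (Fin 2) (Fin 2) (ZInv p)) i j = (A : Matrix (Fin 2) (Fin 2) (ZInv p)) i j * u := by
  rw [Units.val_mul]
  change ((A : Matrix (Fin 2) (Fin 2) (ZInv p)) * Matrix.scalar (Fin 2) (u : ZInv p)) i j = _
  simp

theorem IsPrim.of_mul {M N P : Matrix (Fin 2) (Fin 2) ℤ} (h : IsPrim p (M * N * P)) :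
    IsPrim p N := fun hN => h fun i j => by
  simp only [Matrix.mul_apply, Finset.sum_mul]
  exact Finset.dvd_sum fun k _ => Finset.dvd_sum fun l _ =>
    ((hN l k).mul_left _).mul_right _

variable [Fact p.Prime]

theorem prime_cast : Prime (p : ℤ) := Nat.prime_iff_prime_int.1 Fact.out

theorem prime_cast_ne_zero : (p : ℤ) ≠ 0 := prime_cast.ne_zero

/-- The scalar matrix `p ^ k`. -/
def scalarPow (p : ℕ) [Fact p.Prime] (k : ℤ) : GL (Fin 2) (ZInv p) :=
  Matrix.GeneralLinearGroup.scalar (Fin 2) (pUnit p ^ k)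

theorem mk_mul_scalarPow (A : GL (Fin 2) (ZInv p)) (k : ℤ) :
    Matrix.ProjGenLinGroup.mk (A * scalarPow p k) = Matrix.ProjGenLinGroup.mk A := by
  rw [map_mul, scalarPow, Matrix.ProjGenLinGroup.mk_scalar, mul_one]

theorem Represents.of_smul {M : Matrix (Fin 2) (Fin 2) ℤ} {g : GG p}
    (h : Represents ((p : ℤ) • M) g) : Represents M g := by
  obtain ⟨A, hA, hA'⟩ := h
  refine ⟨A * scalarPow p (-1), ?_, by rw [mk_mul_scalarPow, hA']⟩
  ext1 i j
  rw [scalarPow, coe_mul_scalar, hA, zpow_neg_one, Units.mul_inv_eq_iff_eq_mul]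
  simp only [Matrix.map_apply, Matrix.smul_apply, smul_eq_mul, map_mul]
  rw [mul_comm]
  simp [pUnit]

theorem Represents.of_smul_pow {M : Matrix (Fin 2) (Fin 2) ℤ} {g : GG p} (n : ℕ)
    (h : Represents ((p : ℤ) ^ n • M) g) : Represents M g := by
  induction n with
  | zero => simpa using h
  | succ n ih => rw [pow_succ', mul_smul] at h; exact ih h.of_smul

theorem exists_represents {M : Matrix (Fin 2) (Fin 2) ℤ} {n : ℕ} (hM : M.det = (p : ℤ) ^ n) :
    ∃ g : GG p, Represents M g := by
  have hdet : (M.map (Int.castRingHom (ZInv p))).det = ((pUnit p ^ n : (ZInv p)ˣ) : ZInv p) := by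
    rw [← RingHom.mapMatrix_apply, ← RingHom.map_det, hM]
    simp [pUnit]
  have hu : IsUnit (M.map (Int.castRingHom (ZInv p))).det := by rw [hdet]; exact Units.isUnit _
  let A : GL (Fin 2) (ZInv p) := Matrix.GeneralLinearGroup.mk'' _ hu
  have hpos : (0 : ZInv p) < (p : ZInv p) := Nat.cast_pos.2 (Fact.out : p.Prime).pos
  refine ⟨⟨Matrix.ProjGenLinGroup.mk A, A, ?_, rfl⟩, A, rfl, rfl⟩
  change (0 : ZInv p) < (M.map (Int.castRingHom (ZInv p))).det
  rw [hdet, Units.val_pow_eq_pow_val]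
  exact pow_pos hpos n

/-- The inverse of a has a power of p as denominator, so a divides a power of p in ℤ. -/
theorem zinv_isUnit_int {a : ℤ} (ha : IsUnit (a : ZInv p)) : ∃ n : ℕ, a = p ^ n ∨ a = -p ^ n := by
  obtain ⟨b, hb⟩ := ha.exists_right_inv
  obtain ⟨k, m, hm⟩ := zinv_exists_pow_mul (Fact.out : p.Prime).ne_zero b
  have h1 : a * m = (p : ℤ) ^ k := by
    apply zinv_cast_injective (p := p)
    simp only [eq_intCast, Int.cast_mul, Int.cast_pow, Int.cast_natCast]
    rw [← hm, ← mul_assoc, hb, one_mul]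
  have h2 : a.natAbs ∣ p ^ k := by
    have := Int.natAbs_dvd_natAbs.2 (Dvd.intro _ h1)
    simpa [Int.natAbs_pow] using this
  obtain ⟨n, -, hn⟩ := (Nat.dvd_prime_pow Fact.out).1 h2
  refine ⟨n, ?_⟩
  rcases Int.natAbs_eq a with h | h <;> rw [hn] at h <;> push_cast at h
  · exact Or.inl h
  · exact Or.inr h

theorem exists_det_represents (g : GG p) :
    ∃ (n : ℕ) (M : Matrix (Fin 2) (Fin 2) ℤ), M.det = (p : ℤ) ^ n ∧ Represents M g := by
  obtain ⟨A, hA, hAg⟩ := g.2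
  choose k m hkm using zinv_exists_pow_mul (p := p) (Fact.out : p.Prime).ne_zero
  -- A crude common denominator: p^K clears all four entries. Scaling by p^K multiplies the
  -- determinant by a square and so keeps it positive.
  let K : ℕ := ∑ i, ∑ j, k (A i j)
  have hK : ∀ i j, k (A i j) ≤ K := fun i j =>
    (Finset.single_le_sum (f := fun j => k (A i j)) (fun _ _ => Nat.zero_le _)
      (Finset.mem_univ j)).trans (Finset.single_le_sum (f := fun i => ∑ j, k (A i j))
        (fun _ _ => Nat.zero_le _) (Finset.mem_univ i))
  let M : Matrix (Fin 2) (Fin 2) ℤ := fun i j => m (A i j) * p ^ (K - k (A i j))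
  have hM : ((A * scalarPow p K : GL (Fin 2) (ZInv p)) : Matrix (Fin 2) (Fin 2) (ZInv p)) =
      M.map (Int.castRingHom _) := by
    ext1 i j
    rw [scalarPow, coe_mul_scalar, Matrix.map_apply]
    simp only [M, map_mul, map_pow, eq_intCast, Int.cast_natCast, zpow_natCast,
      Units.val_pow_eq_pow_val]
    rw [← hkm, mul_assoc, ← pow_add, Nat.add_sub_cancel' (hK i j)]
    rfl
  have hdet : ((M.det : ℤ) : ZInv p) = (A * scalarPow p K : GL (Fin 2) (ZInv p)).1.det := by
    rw [hM, ← RingHom.mapMatrix_apply, ← RingHom.map_det]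
    rfl
  obtain ⟨n, hn⟩ := zinv_isUnit_int (p := p) (a := M.det) (by
    rw [hdet]; exact (Matrix.isUnit_iff_isUnit_det _).1 (Units.isUnit _))
  have hpos : 0 < M.det := by
    have h1 : (0 : ZInv p) < A.1.det := hA
    have h2 : (A * scalarPow p K : GL (Fin 2) (ZInv p)).1.det =
        A.1.det * ((pUnit p ^ (K : ℤ) : (ZInv p)ˣ) : ZInv p) ^ 2 := by
      simp only [Matrix.det_fin_two, scalarPow, coe_mul_scalar]
      ring
    have h3 : (0 : ZInv p) < ((M.det : ℤ) : ZInv p) := by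
      rw [hdet, h2]
      refine mul_pos h1 (pow_pos ?_ 2)
      rw [zpow_natCast, Units.val_pow_eq_pow_val]
      exact pow_pos (Nat.cast_pos.2 (Fact.out : p.Prime).pos) K
    exact_mod_cast h3
  have hpp : (0 : ℤ) < (p : ℤ) ^ n := pow_pos (Nat.cast_pos.2 (Fact.out : p.Prime).pos) n
  refine ⟨n, M, ?_, A * scalarPow p K, hM, by rw [mk_mul_scalarPow, hAg]⟩
  rcases hn with h | h
  · exact h
  · omega

/-- Dividing a non-primitive representative by p keeps its class and lowers the exponent of the
determinant by two, so the descent stops. -/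
theorem exists_prim_represents (g : GG p) :
    ∃ (n : ℕ) (M : Matrix (Fin 2) (Fin 2) ℤ), M.det = (p : ℤ) ^ n ∧ IsPrim p M ∧
      Represents M g := by
  obtain ⟨n, M, hM, hg⟩ := exists_det_represents g
  induction n using Nat.strong_induction_on generalizing M with
  | _ n ih =>
    by_cases hprim : IsPrim p M
    · exact ⟨n, M, hM, hprim, hg⟩
    · rw [IsPrim, not_not] at hprim
      choose N hN using hprim
      have hMN : M = (p : ℤ) • Matrix.of N := by
        ext i j
        simp [hN]
      have hdet : (p : ℤ) ^ 2 * (Matrix.of N).det = p ^ n := by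
        rw [← hM, hMN, Matrix.det_smul, Fintype.card_fin]
      have hn : 2 ≤ n := by
        have h1 : (p : ℤ) ^ 2 ∣ p ^ n := Dvd.intro _ hdet
        exact (pow_dvd_pow_iff prime_cast_ne_zero prime_cast.not_isUnit).1 h1
      refine ih (n - 2) (by omega) (Matrix.of N) ?_ (by rw [hMN] at hg; exact hg.of_smul)
      apply mul_left_cancel₀ (pow_ne_zero 2 (prime_cast_ne_zero (p := p)))
      rw [hdet, ← pow_add]
      congr 1
      omega

/-- Representatives of one class differ by a unit of ℤ[1/p], so p^k N = ± p^i M for some k and i. If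
k ≠ i, one of the two matrices would be divisible by p; hence N = ± M. -/
theorem represents_det_unique {M N : Matrix (Fin 2) (Fin 2) ℤ} {g : GG p} {m n : ℕ}
    (hM : Represents M g) (hN : Represents N g) (hM' : IsPrim p M) (hN' : IsPrim p N)
    (hm : M.det = (p : ℤ) ^ m) (hn : N.det = (p : ℤ) ^ n) : m = n := by
  obtain ⟨A, hA, hA'⟩ := hM
  obtain ⟨B, hB, hB'⟩ := hN
  obtain ⟨u, hu⟩ := Matrix.ProjGenLinGroup.mk_eq_mk_iff.1 (hA'.trans hB'.symm)
  obtain ⟨k, a, ha⟩ := zinv_exists_pow_mul (Fact.out : p.Prime).ne_zero (u : ZInv p)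
  obtain ⟨i, hi⟩ := zinv_isUnit_int (p := p) (a := a) (by
    rw [← ha]
    exact u.isUnit.mul ((pUnit p).isUnit.pow k))
  have key : ∀ r s, (p : ℤ) ^ k * N r s = a * M r s := by
    intro r s
    apply zinv_cast_injective (p := p)
    have h1 : (B : Matrix (Fin 2) (Fin 2) (ZInv p)) r s = Int.castRingHom _ (N r s) := by
      rw [hB]; rfl
    have h2 : (A : Matrix (Fin 2) (Fin 2) (ZInv p)) r s = Int.castRingHom _ (M r s) := by
      rw [hA]; rfl
    rw [map_mul, map_mul, ← h1, ← h2, ← hu, coe_mul_scalar]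
    simp only [map_pow, eq_intCast, Int.cast_natCast]
    rw [← ha]
    ring
  have hpk : ∀ k, (p : ℤ) ^ k ≠ 0 := fun k => pow_ne_zero k prime_cast_ne_zero
  obtain ⟨ε, hε, hε'⟩ : ∃ ε : ℤ, a = ε * p ^ i ∧ ε * ε = 1 := by
    rcases hi with h | h
    · exact ⟨1, by rw [h, one_mul], by norm_num⟩
    · exact ⟨-1, by rw [h, neg_one_mul], by norm_num⟩
  have hki : k = i := by
    rcases lt_trichotomy k i with h | h | h
    · refine absurd (fun r s => ?_) hN'
      obtain ⟨d, rfl⟩ := Nat.exists_eq_add_of_lt h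
      refine ⟨ε * p ^ d * M r s, mul_left_cancel₀ (hpk k) ?_⟩
      rw [key, hε]
      ring
    · exact h
    · refine absurd (fun r s => ?_) hM'
      obtain ⟨d, rfl⟩ := Nat.exists_eq_add_of_lt h
      refine ⟨ε * p ^ d * N r s, mul_left_cancel₀ (hpk i) ?_⟩
      have := key r s
      rw [hε] at this
      calc (p : ℤ) ^ i * M r s = ε * (ε * p ^ i * M r s) := by
            rw [← mul_assoc, ← mul_assoc, hε', one_mul]
        _ = _ := by rw [← this]; ring
  subst hki
  have hNM : ∀ r s, N r s = ε * M r s := fun r s => mul_left_cancel₀ (hpk k) (by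
    rw [key, hε]; ring)
  have hd : N.det = M.det := by
    rw [Matrix.det_fin_two, Matrix.det_fin_two]
    simp only [hNM]
    linear_combination (M 0 0 * M 1 1 - M 0 1 * M 1 0) * hε'
  rw [hm, hn] at hd
  have h2 : p ^ n = p ^ m := by exact_mod_cast hd
  exact (Nat.pow_right_injective (Fact.out : p.Prime).two_le h2).symm

end Arithmetic

/-! ### The double cosets of the modular group -/

section DoubleCosets

variable {p : ℕ}

theorem mem_modGroup_iff {g : GG p} :
    g ∈ modGroup p ↔ ∃ M : Matrix (Fin 2) (Fin 2) ℤ, M.det = 1 ∧ Represents M g := by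
  rw [modGroup, Subgroup.mem_subgroupOf, MonoidHom.mem_range]
  constructor
  · rintro ⟨x, hx⟩
    exact ⟨x, x.2, _, rfl, hx⟩
  · rintro ⟨M, hM, A, hA, hA'⟩
    refine ⟨⟨M, hM⟩, ?_⟩
    rw [← hA']
    exact congrArg Matrix.ProjGenLinGroup.mk (Units.ext hA.symm)

theorem IsPrim.of_entry {M : Matrix (Fin 2) (Fin 2) ℤ} {i j : Fin 2} (h : ¬ (p : ℤ) ∣ M i j) :
    IsPrim p M := fun h' => h (h' i j)

/-- Matrices representing the left cosets contained in `Γ σ_p Γ`. -/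
def nbrMat (p : ℕ) : Option (Fin p) → Matrix (Fin 2) (Fin 2) ℤ
  | none => !![1, 0; 0, (p : ℤ)]
  | some i => !![(p : ℤ), (i : ℕ); 0, 1]

theorem det_nbrMat (i : Option (Fin p)) : (nbrMat p i).det = (p : ℤ) ^ 1 := by
  cases i <;> simp [nbrMat, Matrix.det_fin_two_of]

/-- All entries of `(nbrMat p i).adjugate * M` are divisible by `p`: the neighbour `i` is the one
in the direction of the root, if `M` is primitive. -/
def NbrDvd (M : Matrix (Fin 2) (Fin 2) ℤ) (i : Option (Fin p)) : Prop :=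
  ¬ IsPrim p ((nbrMat p i).adjugate * M)

theorem nbrDvd_none (M : Matrix (Fin 2) (Fin 2) ℤ) :
    NbrDvd M (none : Option (Fin p)) ↔ (p : ℤ) ∣ M 1 0 ∧ (p : ℤ) ∣ M 1 1 := by
  rw [NbrDvd, IsPrim, not_not]
  simp [nbrMat, Matrix.adjugate_fin_two_of, Fin.forall_fin_two, Matrix.mul_apply,
    Fin.sum_univ_two]

theorem nbrDvd_some (M : Matrix (Fin 2) (Fin 2) ℤ) (i : Fin p) :
    NbrDvd M (some i) ↔ (p : ℤ) ∣ M 0 0 - (i : ℕ) * M 1 0 ∧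
      (p : ℤ) ∣ M 0 1 - (i : ℕ) * M 1 1 := by
  rw [NbrDvd, IsPrim, not_not]
  simp [nbrMat, Matrix.adjugate_fin_two_of, Fin.forall_fin_two, Matrix.mul_apply,
    Fin.sum_univ_two, sub_eq_add_neg]

theorem not_nbrDvd_none_some {M : Matrix (Fin 2) (Fin 2) ℤ} (hM : IsPrim p M) (i : Fin p)
    (h1 : NbrDvd M (none : Option (Fin p))) : ¬ NbrDvd M (some i) := by
  intro h2
  rw [nbrDvd_none] at h1
  rw [nbrDvd_some] at h2
  have h3 : (p : ℤ) ∣ M 0 0 := (dvd_sub_left (h1.1.mul_left _)).1 h2.1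
  have h4 : (p : ℤ) ∣ M 0 1 := (dvd_sub_left (h1.2.mul_left _)).1 h2.2
  exact hM (Fin.forall_fin_two.2 ⟨Fin.forall_fin_two.2 ⟨h3, h4⟩, Fin.forall_fin_two.2 h1⟩)

variable [Fact p.Prime]

theorem represents_sigma (n : ℕ) :
    Represents !![(p : ℤ) ^ n, 0; 0, 1] (sigma p n) := by
  refine ⟨sigmaGL p n, ?_, rfl⟩
  ext1 i j
  fin_cases i <;> fin_cases j <;> simp [sigmaGL, pUnit]

theorem represents_inv {M : Matrix (Fin 2) (Fin 2) ℤ} {g : GG p} {n : ℕ}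
    (hM : Represents M g) (hn : M.det = (p : ℤ) ^ n) : Represents M.adjugate g⁻¹ := by
  have hn' : M.adjugate.det = (p : ℤ) ^ n := by
    rw [Matrix.det_adjugate, hn, Fintype.card_fin]; simp
  obtain ⟨h, hh⟩ := exists_represents hn'
  have h1 := hM.mul hh
  rw [Matrix.mul_adjugate, hn] at h1
  have h2 := h1.of_smul_pow.unique represents_one
  rwa [← eq_inv_of_mul_eq_one_right h2]

theorem prime_not_dvd_one : ¬ (p : ℤ) ∣ 1 := fun h => prime_cast.not_isUnit (isUnit_of_dvd_one h)

theorem isCoprime_of_dvd_pow {a b : ℤ} {n : ℕ} (h : ∀ d, d ∣ a → d ∣ b → d ∣ (p : ℤ) ^ n)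
    (hp : ¬ ((p : ℤ) ∣ a ∧ (p : ℤ) ∣ b)) : IsCoprime a b := by
  rw [Int.isCoprime_iff_gcd_eq_one]
  by_contra hne
  have h1 : Int.gcd a b ∣ p ^ n := by
    have := h (Int.gcd a b) (Int.gcd_dvd_left ..) (Int.gcd_dvd_right ..)
    exact_mod_cast this
  obtain ⟨k, -, hk⟩ := (Nat.dvd_prime_pow Fact.out).1 h1
  have hk0 : k ≠ 0 := by
    rintro rfl
    exact hne hk
  have h2 : (p : ℤ) ∣ (Int.gcd a b : ℤ) := by
    rw [hk]
    exact_mod_cast dvd_pow_self p hk0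
  exact hp ⟨h2.trans (Int.gcd_dvd_left ..), h2.trans (Int.gcd_dvd_right ..)⟩

/-- Smith normal form for primitive matrices whose determinant is a power of `p`. -/
theorem exists_smith {M : Matrix (Fin 2) (Fin 2) ℤ} {n : ℕ} (hn : M.det = (p : ℤ) ^ n)
    (hM : IsPrim p M) : ∃ A B : Matrix (Fin 2) (Fin 2) ℤ, A.det = 1 ∧ B.det = 1 ∧
      M = A * !![(p : ℤ) ^ n, 0; 0, 1] * B := by
  have main : ∀ M : Matrix (Fin 2) (Fin 2) ℤ, M.det = (p : ℤ) ^ n →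
      ¬ ((p : ℤ) ∣ M 0 1 ∧ (p : ℤ) ∣ M 1 1) →
      ∃ A B : Matrix (Fin 2) (Fin 2) ℤ, A.det = 1 ∧ B.det = 1 ∧
        M = A * !![(p : ℤ) ^ n, 0; 0, 1] * B := by
    intro M hn hM
    rw [Matrix.det_fin_two] at hn
    have hc : IsCoprime (M 0 1) (M 1 1) := by
      refine isCoprime_of_dvd_pow (p := p) (n := n) (fun d h1 h2 => ?_) hM
      rw [← hn]
      exact (h2.mul_left _).sub (h1.mul_right _)
    obtain ⟨u, v, huv⟩ := hc
    -- The second column of M is unimodular and is completed to A ∈ SL₂(ℤ) by a Bézout relation; B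
    -- is the lower unipotent matrix that then restores the first column.
    refine ⟨!![v, M 0 1; -u, M 1 1], !![1, 0; u * M 0 0 + v * M 1 0, 1], ?_, ?_, ?_⟩
    · rw [Matrix.det_fin_two_of]; linear_combination huv
    · rw [Matrix.det_fin_two_of]; ring
    · rw [← hn]
      ext i j
      fin_cases i <;> fin_cases j <;> simp [Matrix.mul_apply, Fin.sum_univ_two]
      · linear_combination (-M 0 0) * huv
      · linear_combination (-M 1 0) * huv
  by_cases h : (p : ℤ) ∣ M 0 1 ∧ (p : ℤ) ∣ M 1 1
  -- If p divides the second column, primitivity says that it does not divide the first, and a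
  -- matrix of determinant one exchanges the two columns up to sign.
  · have hw : (!![0, -1; 1, 0] : Matrix (Fin 2) (Fin 2) ℤ) * !![0, 1; -1, 0] = 1 := by
      ext i j
      fin_cases i <;> fin_cases j <;> simp
    obtain ⟨A, B, hA, hB, hAB⟩ := main (M * !![0, -1; 1, 0])
      (by rw [Matrix.det_mul, hn, Matrix.det_fin_two_of]; ring) (by
        intro h'
        simp [Matrix.mul_apply, Fin.sum_univ_two] at h'
        refine hM fun i j => ?_
        fin_cases i <;> fin_cases j
        · exact h'.1
        · exact h.1
        · exact h'.2
        · exact h.2)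
    refine ⟨A, B * !![0, 1; -1, 0], hA, ?_, ?_⟩
    · rw [Matrix.det_mul, hB, Matrix.det_fin_two_of]; ring
    · rw [← mul_assoc, ← hAB, mul_assoc, hw, mul_one]
  · exact main M hn h

/-- One direction is the Smith normal form; for the other, factors in SL₂(ℤ) change neither the
determinant nor primitivity. The level can thus be read off any primitive representative. -/
theorem mem_dc_iff {n : ℕ} {g : GG p} : g ∈ dc p n ↔
    ∃ M : Matrix (Fin 2) (Fin 2) ℤ, M.det = (p : ℤ) ^ n ∧ IsPrim p M ∧ Represents M g := by
  constructor
  · rintro ⟨γ₁, h₁, γ₂, h₂, rfl⟩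
    obtain ⟨A, hA, hA'⟩ := mem_modGroup_iff.1 h₁
    obtain ⟨B, hB, hB'⟩ := mem_modGroup_iff.1 h₂
    refine ⟨A * !![(p : ℤ) ^ n, 0; 0, 1] * B, ?_, ?_, (hA'.mul (represents_sigma n)).mul hB'⟩
    · rw [Matrix.det_mul, Matrix.det_mul, hA, hB, Matrix.det_fin_two_of]; ring
    · refine IsPrim.of_mul (M := A.adjugate) (P := B.adjugate) ?_
      have : A.adjugate * (A * !![(p : ℤ) ^ n, 0; 0, 1] * B) * B.adjugate =
          !![(p : ℤ) ^ n, 0; 0, 1] := by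
        rw [mul_assoc, mul_assoc, Matrix.mul_adjugate, hB, one_smul, mul_one, ← mul_assoc,
          Matrix.adjugate_mul, hA, one_smul, one_mul]
      rw [this]
      exact IsPrim.of_entry (i := 1) (j := 1) (by simpa using prime_not_dvd_one)
  · rintro ⟨M, hn, hM, hg⟩
    obtain ⟨A, B, hA, hB, hAB⟩ := exists_smith hn hM
    obtain ⟨a, ha⟩ := exists_represents (p := p) (n := 0) (M := A) (by rw [hA, pow_zero])
    obtain ⟨b, hb⟩ := exists_represents (p := p) (n := 0) (M := B) (by rw [hB, pow_zero])
    refine ⟨a, mem_modGroup_iff.2 ⟨A, hA, ha⟩, b, mem_modGroup_iff.2 ⟨B, hB, hb⟩, ?_⟩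
    have := (ha.mul (represents_sigma n)).mul hb
    rw [← hAB] at this
    exact hg.unique this

theorem exists_mem_dc (g : GG p) : ∃ n, g ∈ dc p n := by
  obtain ⟨n, M, h⟩ := exists_prim_represents g
  exact ⟨n, mem_dc_iff.2 ⟨M, h⟩⟩

theorem dc_unique {g : GG p} {m n : ℕ} (hm : g ∈ dc p m) (hn : g ∈ dc p n) : m = n := by
  obtain ⟨M, h1, h2, h3⟩ := mem_dc_iff.1 hm
  obtain ⟨N, h1', h2', h3'⟩ := mem_dc_iff.1 hn
  exact represents_det_unique h3 h3' h2 h2' h1 h1'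

theorem inv_mem_dc {g : GG p} {n : ℕ} (h : g ∈ dc p n) : g⁻¹ ∈ dc p n := by
  obtain ⟨M, hn, hM, hg⟩ := mem_dc_iff.1 h
  refine mem_dc_iff.2 ⟨_, ?_, fun h => hM fun i j => ?_, represents_inv hg hn⟩
  · rw [Matrix.det_adjugate, hn, Fintype.card_fin]; simp
  · rw [Matrix.adjugate_fin_two] at h
    fin_cases i <;> fin_cases j
    · simpa using h 1 1
    · simpa using h 0 1
    · simpa using h 1 0
    · simpa using h 0 0

theorem inv_mem_dc_iff {g : GG p} {n : ℕ} : g⁻¹ ∈ dc p n ↔ g ∈ dc p n :=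
  ⟨fun h => by simpa using inv_mem_dc h, inv_mem_dc⟩

theorem mem_dc_zero_iff {g : GG p} : g ∈ dc p 0 ↔ g ∈ modGroup p := by
  rw [mem_modGroup_iff, mem_dc_iff]
  constructor
  · rintro ⟨M, h1, -, h2⟩
    exact ⟨M, by simpa using h1, h2⟩
  · rintro ⟨M, h1, h2⟩
    refine ⟨M, by simpa using h1, fun h => ?_, h2⟩
    rw [Matrix.det_fin_two] at h1
    refine prime_not_dvd_one (p := p) ?_
    rw [← h1]
    exact ((h 0 0).mul_right _).sub ((h 0 1).mul_right _)

theorem dc_mul_left {γ g : GG p} {n : ℕ} (hγ : γ ∈ modGroup p) (h : g ∈ dc p n) :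
    γ * g ∈ dc p n := by
  obtain ⟨a, ha, b, hb, rfl⟩ := h
  exact ⟨γ * a, (modGroup p).mul_mem hγ ha, b, hb, by simp only [mul_assoc]⟩

theorem dc_mul_right {γ g : GG p} {n : ℕ} (hγ : γ ∈ modGroup p) (h : g ∈ dc p n) :
    g * γ ∈ dc p n := by
  obtain ⟨a, ha, b, hb, rfl⟩ := h
  exact ⟨a, ha, b * γ, (modGroup p).mul_mem hb hγ, by simp only [mul_assoc]⟩

theorem dc_mul_left_iff {γ g : GG p} {n : ℕ} (hγ : γ ∈ modGroup p) :
    γ * g ∈ dc p n ↔ g ∈ dc p n :=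
  ⟨fun h => by simpa using dc_mul_left ((modGroup p).inv_mem hγ) h, dc_mul_left hγ⟩

theorem dc_mul_right_iff {γ g : GG p} {n : ℕ} (hγ : γ ∈ modGroup p) :
    g * γ ∈ dc p n ↔ g ∈ dc p n :=
  ⟨fun h => by simpa using dc_mul_right ((modGroup p).inv_mem hγ) h, dc_mul_right hγ⟩

theorem sigma_mem_dc (n : ℕ) : sigma p n ∈ dc p n :=
  ⟨1, (modGroup p).one_mem, 1, (modGroup p).one_mem, by simp⟩

theorem dblCoset_eq_dc {g : GG p} {n : ℕ} (h : g ∈ dc p n) :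
    dblCoset (modGroup p) g = dc p n := by
  ext k
  constructor
  · rintro ⟨a, ha, b, hb, rfl⟩
    exact dc_mul_right hb (dc_mul_left ha h)
  · rintro ⟨c, hc, d, hd, rfl⟩
    obtain ⟨a, ha, b, hb, rfl⟩ := h
    exact ⟨c * a⁻¹, (modGroup p).mul_mem hc ((modGroup p).inv_mem ha), b⁻¹ * d,
      (modGroup p).mul_mem ((modGroup p).inv_mem hb) hd, by group⟩

/-- The number `n` with `g ∈ Γ σ_{p^n} Γ`. -/
def level (g : GG p) : ℕ := (exists_mem_dc g).choose

theorem mem_dc_level (g : GG p) : g ∈ dc p (level g) := (exists_mem_dc g).choose_spec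

theorem mem_dc_iff_level {g : GG p} {n : ℕ} : g ∈ dc p n ↔ level g = n :=
  ⟨fun h => dc_unique (mem_dc_level g) h, fun h => h ▸ mem_dc_level g⟩

theorem level_inv (g : GG p) : level g⁻¹ = level g := mem_dc_iff_level.1 (inv_mem_dc (mem_dc_level g))

theorem level_mul_left {γ : GG p} (hγ : γ ∈ modGroup p) (g : GG p) : level (γ * g) = level g :=
  mem_dc_iff_level.1 (dc_mul_left hγ (mem_dc_level g))

theorem level_mul_right {γ : GG p} (hγ : γ ∈ modGroup p) (g : GG p) : level (g * γ) = level g :=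
  mem_dc_iff_level.1 (dc_mul_right hγ (mem_dc_level g))

theorem level_eq_zero_iff {g : GG p} : level g = 0 ↔ g ∈ modGroup p := by
  rw [← mem_dc_iff_level, mem_dc_zero_iff]

theorem level_sigma (n : ℕ) : level (sigma p n) = n := mem_dc_iff_level.1 (sigma_mem_dc n)

/-! ### The neighbours in the tree -/

/-- Representatives of the left cosets contained in `Γ σ_p Γ`. -/
def nbr (i : Option (Fin p)) : GG p := (exists_represents (det_nbrMat i)).choose

theorem represents_nbr (i : Option (Fin p)) : Represents (nbrMat p i) (nbr i) :=
  (exists_represents (det_nbrMat i)).choose_spec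

/-- The product with the adjugate is already primitive and its determinant has one more factor p. -/
theorem level_nbr_inv_mul_of_not_dvd {M : Matrix (Fin 2) (Fin 2) ℤ} {g : GG p} {m : ℕ}
    (hg : Represents M g) (hm : M.det = (p : ℤ) ^ m) {i : Option (Fin p)} (hi : ¬ NbrDvd M i) :
    level ((nbr i)⁻¹ * g) = m + 1 := by
  refine mem_dc_iff_level.1 (mem_dc_iff.2 ⟨(nbrMat p i).adjugate * M, ?_, not_not.1 hi,
    (represents_inv (represents_nbr i) (det_nbrMat i)).mul hg⟩)
  rw [Matrix.det_mul, Matrix.det_adjugate, det_nbrMat, hm, Fintype.card_fin]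
  ring

/-- The product with the adjugate has determinant p^(m+1), and removing one scalar factor p leaves
p^(m-1). No second factor can be removed: the quotient N satisfies M = `nbrMat p i` * N, so it is
primitive because M is. -/
theorem level_nbr_inv_mul_of_dvd {M : Matrix (Fin 2) (Fin 2) ℤ} {g : GG p} {m : ℕ}
    (hM : IsPrim p M)
    (hg : Represents M g) (hm : M.det = (p : ℤ) ^ m) {i : Option (Fin p)} (hi : NbrDvd M i) :
    level ((nbr i)⁻¹ * g) + 1 = m := by
  have hi' := hi
  rw [NbrDvd, IsPrim, not_not] at hi
  choose N hN using hi
  have hN' : (nbrMat p i).adjugate * M = (p : ℤ) • Matrix.of N := by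
    ext a b
    simp [hN]
  have hp0 := prime_cast_ne_zero (p := p)
  have hMN : M = nbrMat p i * Matrix.of N := by
    have h1 : (p : ℤ) • M = (p : ℤ) • (nbrMat p i * Matrix.of N) := by
      rw [← Matrix.mul_smul, ← hN', ← mul_assoc, Matrix.mul_adjugate, det_nbrMat, pow_one,
        Matrix.smul_mul, one_mul]
    exact smul_right_injective _ hp0 h1
  have hprim : IsPrim p (Matrix.of N) :=
    IsPrim.of_mul (M := nbrMat p i) (P := 1) (by rwa [mul_one, ← hMN])
  have hdet : (p : ℤ) * (Matrix.of N).det = p ^ m := by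
    rw [← hm, hMN, Matrix.det_mul, det_nbrMat, pow_one]
  have hrep : Represents (Matrix.of N) ((nbr i)⁻¹ * g) := by
    have := (represents_inv (represents_nbr i) (det_nbrMat i)).mul hg
    rw [hN'] at this
    exact this.of_smul
  cases m with
  | zero =>
    rw [pow_zero] at hdet
    exact absurd (Dvd.intro _ hdet) prime_not_dvd_one
  | succ m =>
    rw [pow_succ'] at hdet
    rw [mem_dc_iff_level.1 (mem_dc_iff.2 ⟨_, mul_left_cancel₀ hp0 hdet, hprim, hrep⟩)]

theorem dvd_of_dvd_sub_mul {i j : Fin p} (hij : i ≠ j) {a c : ℤ}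
    (h1 : (p : ℤ) ∣ a - (i : ℕ) * c) (h2 : (p : ℤ) ∣ a - (j : ℕ) * c) :
    (p : ℤ) ∣ a ∧ (p : ℤ) ∣ c := by
  have hnd : ¬ (p : ℤ) ∣ (j : ℕ) - (i : ℕ) := fun h =>
    hij (Fin.ext (Nat.ModEq.eq_of_lt_of_lt (Nat.modEq_iff_dvd.2 h) i.2 j.2))
  have h3 : (p : ℤ) ∣ ((j : ℕ) - (i : ℕ)) * c := by
    have h := h1.sub h2
    rwa [sub_sub_sub_cancel_left, ← sub_mul] at h
  have h4 := (prime_cast.dvd_or_dvd h3).resolve_left hnd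
  exact ⟨(dvd_sub_left (h4.mul_left _)).1 h1, h4⟩

theorem nbrDvd_unique {M : Matrix (Fin 2) (Fin 2) ℤ} (hM : IsPrim p M) {i j : Option (Fin p)}
    (hi : NbrDvd M i) (hj : NbrDvd M j) : i = j := by
  rcases i with _ | i <;> rcases j with _ | j
  · rfl
  · exact (not_nbrDvd_none_some hM j hi hj).elim
  · exact (not_nbrDvd_none_some hM i hj hi).elim
  · by_contra hij
    have hij' : i ≠ j := fun h => hij (congrArg some h)
    rw [nbrDvd_some] at hi hj
    have h0 := dvd_of_dvd_sub_mul hij' hi.1 hj.1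
    have h1 := dvd_of_dvd_sub_mul hij' hi.2 hj.2
    exact hM (Fin.forall_fin_two.2 ⟨Fin.forall_fin_two.2 ⟨h0.1, h1.1⟩,
      Fin.forall_fin_two.2 ⟨h0.2, h1.2⟩⟩)

/-- Modulo p the rows of M are linearly dependent, and the index records the relation: `none` if the
second row vanishes, `some i` if the first row is i times the second. -/
theorem exists_nbrDvd {M : Matrix (Fin 2) (Fin 2) ℤ} (hM : (p : ℤ) ∣ M.det) :
    ∃ i : Option (Fin p), NbrDvd M i := by
  rw [Matrix.det_fin_two] at hM
  have key : ∀ a b c d : ℤ, (p : ℤ) ∣ a * d - b * c → ¬ (p : ℤ) ∣ c →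
      ∃ i : Fin p, (p : ℤ) ∣ a - (i : ℕ) * c ∧ (p : ℤ) ∣ b - (i : ℕ) * d := by
    intro a b c d hdet hc
    -- Here v inverts c modulo p, so the required index is the residue of a v. The second
    -- divisibility follows from the first after multiplication by c, by means of the determinant.
    obtain ⟨u, v, huv⟩ := (prime_cast.coprime_iff_not_dvd (p := (p : ℤ))).2 hc
    have hpos : (0 : ℤ) < p := Nat.cast_pos.2 (Fact.out : p.Prime).pos
    have h0 := Int.emod_nonneg (a * v) hpos.ne'
    have h1 := Int.emod_lt_of_pos (a * v) hpos
    have hlt : (a * v % p).toNat < p := by omega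
    have hi : (((a * v % p).toNat : ℕ) : ℤ) = a * v % p := Int.toNat_of_nonneg h0
    have hd : (p : ℤ) ∣ a * v - a * v % p := Int.dvd_self_sub_emod
    refine ⟨⟨_, hlt⟩, ?_⟩
    simp only [hi]
    have h2 : (p : ℤ) ∣ a - (a * v % p) * c := by
      have : a - (a * v % p) * c = (a * v - a * v % p) * c + p * (a * u) := by
        linear_combination (-a) * huv
      rw [this]
      exact (hd.mul_right c).add (dvd_mul_right _ _)
    refine ⟨h2, ?_⟩
    have h3 : (p : ℤ) ∣ c * (b - (a * v % p) * d) := by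
      have : c * (b - (a * v % p) * d) = d * (a - (a * v % p) * c) - (a * d - b * c) := by ring
      rw [this]
      exact (h2.mul_left d).sub hdet
    exact (prime_cast.dvd_or_dvd h3).resolve_left hc
  by_cases h0 : (p : ℤ) ∣ M 1 0
  · by_cases h1 : (p : ℤ) ∣ M 1 1
    · exact ⟨none, (nbrDvd_none M).2 ⟨h0, h1⟩⟩
    -- The columns are exchanged, which only changes the sign of the determinant.
    · obtain ⟨i, hi, hi'⟩ := key (M 0 1) (M 0 0) (M 1 1) (M 1 0) (by
        rw [← dvd_neg]; convert! hM using 1; ring) h1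
      exact ⟨some i, (nbrDvd_some M i).2 ⟨hi', hi⟩⟩
  · obtain ⟨i, hi⟩ := key (M 0 0) (M 0 1) (M 1 0) (M 1 1) hM h0
    exact ⟨some i, (nbrDvd_some M i).2 hi⟩

theorem level_nbr_inv_mul_of_mem {g : GG p} (hg : level g = 0) (i : Option (Fin p)) :
    level ((nbr i)⁻¹ * g) = 1 := by
  obtain ⟨M, hm, hM, hg⟩ := mem_dc_iff.1 (mem_dc_iff_level.2 hg)
  by_cases hi : NbrDvd M i
  · have := level_nbr_inv_mul_of_dvd hM hg hm hi
    omega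
  · exact level_nbr_inv_mul_of_not_dvd hg hm hi

/-- Exactly one neighbour of a vertex other than the root is closer to the root. -/
theorem exists_level_nbr_inv_mul {g : GG p} {m : ℕ} (hg : level g = m + 1) :
    ∃ i : Option (Fin p), level ((nbr i)⁻¹ * g) = m ∧
      ∀ j, j ≠ i → level ((nbr j)⁻¹ * g) = m + 2 := by
  obtain ⟨M, hm, hM, hg⟩ := mem_dc_iff.1 (mem_dc_iff_level.2 hg)
  obtain ⟨i, hi⟩ := exists_nbrDvd (p := p) (M := M) (by rw [hm, pow_succ]; exact dvd_mul_left _ _)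
  refine ⟨i, ?_, fun j hj => ?_⟩
  · have := level_nbr_inv_mul_of_dvd hM hg hm hi
    omega
  · exact level_nbr_inv_mul_of_not_dvd hg hm fun h => hj (nbrDvd_unique hM h hi)

theorem level_nbr (i : Option (Fin p)) : level (nbr i) = 1 := by
  have := level_nbr_inv_mul_of_mem (p := p) (g := 1) (level_eq_zero_iff.2 (modGroup p).one_mem) i
  rwa [mul_one, level_inv] at this

theorem exists_eq_nbr_mul {g : GG p} (hg : g ∈ dc p 1) :
    ∃ i : Option (Fin p), ∃ γ ∈ modGroup p, g = nbr i * γ := by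
  obtain ⟨i, hi, -⟩ := exists_level_nbr_inv_mul (m := 0) (mem_dc_iff_level.1 hg)
  exact ⟨i, _, level_eq_zero_iff.1 hi, by group⟩

theorem nbr_injective_mod {i j : Option (Fin p)} (h : (nbr i)⁻¹ * nbr j ∈ modGroup p) : i = j := by
  obtain ⟨k, -, hk⟩ := exists_level_nbr_inv_mul (m := 0) (level_nbr j)
  have h1 : ∀ i, (nbr i)⁻¹ * nbr j ∈ modGroup p → i = k := fun i hi => by
    by_contra hne
    have := hk i hne
    rw [level_eq_zero_iff.2 hi] at this
    omega
  rw [h1 i h, h1 j (by simp [(modGroup p).one_mem])]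

open Classical in
/-- The number of the neighbours of a vertex at a given distance from the root. -/
theorem card_level_nbr_inv_mul (g : GG p) (n : ℕ) :
    (Finset.univ.filter fun i : Option (Fin p) => level ((nbr i)⁻¹ * g) = n).card =
      if level g = 0 then (if n = 1 then p + 1 else 0)
      else (if level g = n + 1 then 1 else 0) + (if n = level g + 1 then p else 0) := by
  have hcard : (Finset.univ : Finset (Option (Fin p))).card = p + 1 := by simp
  rcases Nat.eq_zero_or_pos (level g) with h | h
  · rw [if_pos h]
    simp only [level_nbr_inv_mul_of_mem h]
    by_cases hn : n = 1
    · rw [if_pos hn, Finset.filter_true_of_mem (fun _ _ => hn.symm), hcard]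
    · rw [if_neg hn, Finset.filter_false_of_mem (fun _ _ => Ne.symm hn), Finset.card_empty]
  · obtain ⟨m, hm⟩ := Nat.exists_eq_add_of_lt h
    rw [zero_add] at hm
    obtain ⟨i, hi, hj⟩ := exists_level_nbr_inv_mul hm
    rw [if_neg h.ne', hm]
    by_cases h1 : n = m
    · subst h1
      rw [if_pos rfl, if_neg (by omega), add_zero, Finset.card_eq_one]
      refine ⟨i, Finset.ext fun j => ?_⟩
      rw [Finset.mem_filter, Finset.mem_singleton]
      refine ⟨fun h => ?_, fun h => ⟨Finset.mem_univ _, h ▸ hi⟩⟩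
      by_contra hne
      have := hj j hne
      omega
    · rw [if_neg (by omega), zero_add]
      by_cases h2 : n = m + 1 + 1
      · subst h2
        rw [if_pos rfl]
        have : (Finset.univ.filter fun i : Option (Fin p) =>
            level ((nbr i)⁻¹ * g) = m + 1 + 1) = Finset.univ.erase i := by
          ext j
          rw [Finset.mem_filter, Finset.mem_erase]
          refine ⟨fun h => ⟨fun hne => ?_, Finset.mem_univ _⟩,
            fun h => ⟨Finset.mem_univ _, hj j h.1⟩⟩
          have h3 := h.2
          rw [hne, hi] at h3
          omega
        rw [this, Finset.card_erase_of_mem (Finset.mem_univ _), hcard, Nat.add_sub_cancel]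
      · rw [if_neg h2, Finset.filter_false_of_mem, Finset.card_empty]
        intro j _ hjn
        by_cases hne : j = i
        · rw [hne, hi] at hjn; omega
        · rw [hj j hne] at hjn; omega

end DoubleCosets

/-! ### Transporting a von Neumann algebra along equality of moments -/

section Moments

open ContinuousLinearMap

open Polynomial hiding comp_assoc

variable {E F : Type*} [NormedAddCommGroup E] [InnerProductSpace ℂ E] [CompleteSpace E]
  [NormedAddCommGroup F] [InnerProductSpace ℂ F] [CompleteSpace F]

/-- Two families of vectors with the same inner products are related by a partial isometry. -/
theorem exists_partialIsometry {M : Type*} [AddCommGroup M] [Module ℂ M] (f : M →ₗ[ℂ] E)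
    (g : M →ₗ[ℂ] F) (h : ∀ m n, inner ℂ (f m) (f n) = inner ℂ (g m) (g n)) :
    ∃ V : E →L[ℂ] F, (∀ m, V (f m) = g m) ∧ (∀ m, adjoint V (g m) = f m) ∧
      ∀ v, (∀ m, inner ℂ (f m) v = 0) → V v = 0 := by
  let K : Submodule ℂ E := (LinearMap.range f).topologicalClosure
  have hmem : ∀ m, f m ∈ K := fun m => Submodule.le_topologicalClosure _ ⟨m, rfl⟩
  let f' : M →ₗ[ℂ] K := f.codRestrict K hmem
  have hcK : IsClosed (K : Set E) := Submodule.isClosed_topologicalClosure _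
  have : CompleteSpace K := hcK.completeSpace_coe
  have hd : DenseRange f' := by
    intro x
    have hx : (x : E) ∈ closure (Set.range f) := x.2
    rw [closure_subtype, ← Set.range_comp]
    exact hx
  have hnorm : ∀ m, ‖g m‖ ≤ 1 * ‖f' m‖ := fun m => by
    rw [one_mul]
    change _ ≤ ‖f m‖
    rw [@norm_eq_sqrt_re_inner ℂ, @norm_eq_sqrt_re_inner ℂ, h]
  let V₀ : K →L[ℂ] F := g.extendOfNorm f'
  have hV₀ : ∀ m, V₀ (f' m) = g m := LinearMap.extendOfNorm_eq hd ⟨1, hnorm⟩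
  let V : E →L[ℂ] F := V₀.comp K.orthogonalProjectionOnto
  have hV : ∀ m, V (f m) = g m := fun m => by
    rw [← hV₀]
    exact congrArg V₀ (Submodule.orthogonalProjectionOnto_mem_subspace_eq_self (f' m))
  refine ⟨V, hV, fun m => ?_, fun v hv => ?_⟩
  · refine ext_inner_right ℂ fun v => ?_
    rw [adjoint_inner_left]
    have key : ∀ k : K, inner ℂ (g m) (V₀ k) = inner ℂ (f m) (k : E) := by
      intro k
      refine hd.induction_on (p := fun k : K => inner ℂ (g m) (V₀ k) = inner ℂ (f m) (k : E)) k
        (isClosed_eq (by fun_prop) (by fun_prop)) fun n => ?_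
      rw [hV₀, ← h]
      rfl
    change inner ℂ (g m) (V₀ (K.orthogonalProjectionOnto v)) = _
    rw [key]
    exact K.inner_orthogonalProjectionOnto_eq_of_mem_left (f' m) v
  · have hv' : v ∈ Kᗮ := by
      rw [Submodule.mem_orthogonal]
      intro u hu
      have hu' : u ∈ closure (Set.range f) := hu
      refine closure_minimal (s := Set.range f) (t := {u | inner ℂ u v = 0}) ?_
        (isClosed_eq (by fun_prop) (by fun_prop)) hu'
      rintro _ ⟨m, rfl⟩
      exact hv m
    change V₀ (K.orthogonalProjectionOnto v) = 0
    rw [Submodule.orthogonalProjectionOnto_eq_zero_iff.2 hv', map_zero]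

theorem adjoint_eq_self {T : E →L[ℂ] E} (hT : IsSelfAdjoint T) : adjoint T = T := hT

/-- Self-adjoint operators with the same moments are intertwined by a partial isometry. -/
theorem exists_intertwiner {T : E →L[ℂ] E} {X : F →L[ℂ] F} (hT : IsSelfAdjoint T)
    (hX : IsSelfAdjoint X) {δ : E} {ε : F}
    (hmom : ∀ n : ℕ, inner ℂ δ ((T ^ n) δ) = inner ℂ ε ((X ^ n) ε)) :
    ∃ V : E →L[ℂ] F, V δ = ε ∧ adjoint V ε = δ ∧ V.comp T = X.comp V := by
  let f : ℂ[X] →ₗ[ℂ] E := (ContinuousLinearMap.apply ℂ E δ).toLinearMap ∘ₗ (aeval T).toLinearMap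
  let g : ℂ[X] →ₗ[ℂ] F := (ContinuousLinearMap.apply ℂ F ε).toLinearMap ∘ₗ (aeval X).toLinearMap
  have hf : ∀ q, f q = aeval T q δ := fun _ => rfl
  have hg : ∀ q, g q = aeval X q ε := fun _ => rfl
  -- On monomials, self-adjointness reduces ⟨T^m δ, T^n δ⟩ to the moment of order m + n.
  have hinner : ∀ q r, inner ℂ (f q) (f r) = inner ℂ (g q) (g r) := by
    intro q r
    induction q using Polynomial.induction_on' with
    | add q q' h h' => simp only [map_add, inner_add_left, h, h']
    | monomial m a =>
      induction r using Polynomial.induction_on' with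
      | add r r' h h' => simp only [map_add, inner_add_right, h, h']
      | monomial n b =>
        have h1 : ∀ (c : ℂ) (k : ℕ), f (monomial k c) = c • (T ^ k) δ := fun c k => by
          rw [hf, aeval_monomial, ← Algebra.smul_def]; rfl
        have h2 : ∀ (c : ℂ) (k : ℕ), g (monomial k c) = c • (X ^ k) ε := fun c k => by
          rw [hg, aeval_monomial, ← Algebra.smul_def]; rfl
        rw [h1, h1, h2, h2, inner_smul_left, inner_smul_left, inner_smul_right, inner_smul_right]
        congr 2
        rw [← adjoint_inner_right, ← adjoint_inner_right, adjoint_eq_self (hT.pow m),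
          adjoint_eq_self (hX.pow m)]
        have := hmom (m + n)
        rw [pow_add, pow_add] at this
        exact this
  obtain ⟨V, h1, h2, h3⟩ := exists_partialIsometry f g hinner
  have hf1 : f 1 = δ := by rw [hf, map_one]; rfl
  have hg1 : g 1 = ε := by rw [hg, map_one]; rfl
  have hTf : ∀ q, T (f q) = f (Polynomial.X * q) := fun q => by
    rw [hf, hf, map_mul, aeval_X]; rfl
  have hXg : ∀ q, X (g q) = g (Polynomial.X * q) := fun q => by
    rw [hg, hg, map_mul, aeval_X]; rfl
  refine ⟨V, by rw [← hf1, h1, hg1], by rw [← hg1, h2, hf1], ?_⟩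
  have hVT : ∀ q, V (T (f q)) = X (V (f q)) := fun q => by rw [hTf, h1, h1, hXg]
  -- The relation V T = X V holds on the range of f, and also on its orthogonal complement, which T
  -- preserves and V annihilates. The closed subspace L contains both, so it is everything.
  let L : Submodule ℂ E := LinearMap.ker (V.comp T - X.comp V).toLinearMap
  have hL : ∀ v, v ∈ L ↔ V (T v) - X (V v) = 0 := fun v => Iff.rfl
  have hLc : IsClosed (L : Set E) := (V.comp T - X.comp V).isClosed_ker
  have h4 : LinearMap.range f ≤ L := by
    rintro _ ⟨q, rfl⟩
    rw [hL, hVT, sub_self]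
  have h5 : (LinearMap.range f)ᗮ ≤ L := by
    intro v hv
    have hv' : ∀ q, inner ℂ (f q) v = 0 := fun q =>
      (Submodule.mem_orthogonal _ _).1 hv _ ⟨q, rfl⟩
    rw [hL, h3 v hv', h3 (T v) fun q => ?_, map_zero, sub_self]
    rw [← adjoint_inner_left, adjoint_eq_self hT, hTf, hv']
  have h6 : L = ⊤ := by
    rw [← hLc.submodule_topologicalClosure_eq, Submodule.topologicalClosure_eq_top_iff,
      eq_bot_iff]
    exact (le_inf (Submodule.orthogonal_le h4) (Submodule.orthogonal_le h5)).trans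
      (Submodule.inf_orthogonal_eq_bot _).le
  ext v
  have h7 : v ∈ L := h6 ▸ Submodule.mem_top
  exact sub_eq_zero.1 ((hL v).1 h7)

/-- The basic estimate: elements of the bicommutant of `T` are transported to bounded vectors. -/
theorem norm_intertwiner_apply_le {T : E →L[ℂ] E} {X : F →L[ℂ] F} (hT : IsSelfAdjoint T)
    (hX : IsSelfAdjoint X) {δ : E} {V : E →L[ℂ] F} (hV : V.comp T = X.comp V)
    {a : E →L[ℂ] E} (ha : ∀ S, S * T = T * S → a * S = S * a) {S : F →L[ℂ] F}
    (hS : S * X = X * S) : ‖S (V (a δ))‖ ≤ ‖a‖ * ‖S (V δ)‖ := by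
  have hVX : (adjoint V).comp X = T.comp (adjoint V) := by
    have h := congrArg adjoint hV
    rw [adjoint_comp, adjoint_comp, adjoint_eq_self hT, adjoint_eq_self hX] at h
    exact h.symm
  have hS' : (adjoint S).comp X = X.comp (adjoint S) := by
    have h : adjoint (S.comp X) = adjoint (X.comp S) := congrArg adjoint hS
    rw [adjoint_comp, adjoint_comp, adjoint_eq_self hX] at h
    exact h.symm
  have hSX : S.comp X = X.comp S := hS
  set W : E →L[ℂ] F := S.comp V with hW
  set b : E →L[ℂ] E := (adjoint W).comp W with hb
  have hWT : W.comp T = X.comp W := by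
    rw [hW, comp_assoc, hV, ← comp_assoc, hSX, comp_assoc]
  have hWX : (adjoint W).comp X = T.comp (adjoint W) := by
    rw [hW, adjoint_comp, comp_assoc, hS', ← comp_assoc, hVX, comp_assoc]
  have hbT : Commute b T := by
    change (b.comp T) = T.comp b
    rw [hb, comp_assoc, hWT, ← comp_assoc, hWX, comp_assoc]
  have hb0 : 0 ≤ b := (nonneg_iff_isPositive b).2 (isPositive_adjoint_comp_self W)
  -- c is the absolute value of W = S V. It commutes with T, hence with a, which gives ‖W a δ‖ = ‖c
  -- a δ‖ = ‖a c δ‖.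
  set c : E →L[ℂ] E := CFC.sqrt b with hc
  have hcc : c * c = b := CFC.sqrt_mul_sqrt_self b hb0
  have hcs : IsSelfAdjoint c := IsSelfAdjoint.of_nonneg (CFC.sqrt_nonneg b)
  have hcT : c * T = T * c := hbT.cfcₙ_nnreal NNReal.sqrt
  have hac := ha c hcT
  have hnorm : ∀ v, ‖c v‖ = ‖W v‖ := fun v => by
    rw [@norm_eq_sqrt_re_inner ℂ, @norm_eq_sqrt_re_inner ℂ, ← adjoint_inner_right,
      adjoint_eq_self hcs, ← adjoint_inner_right W]
    change √(RCLike.re (inner ℂ v ((c * c) v))) = _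
    rw [hcc]
    rfl
  calc ‖W (a δ)‖ = ‖(c * a) δ‖ := (hnorm _).symm
    _ = ‖a (c δ)‖ := by rw [← hac]; rfl
    _ ≤ ‖a‖ * ‖c δ‖ := a.le_opNorm _
    _ = ‖a‖ * ‖W δ‖ := by rw [hnorm]

/-- If `T` and `X` have the same moments at `δ` and `ε`, and `ε` is cyclic for the commutant of
`X`, the bicommutant of `T` is mapped to that of `X` by a `*`-homomorphism that preserves the
vector states. -/
theorem exists_starAlgHom_of_moments {T : E →L[ℂ] E} {X : F →L[ℂ] F} (hT : IsSelfAdjoint T)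
    (hX : IsSelfAdjoint X) {δ : E} {ε : F}
    (hmom : ∀ n : ℕ, inner ℂ δ ((T ^ n) δ) = inner ℂ ε ((X ^ n) ε))
    (hcyc : Dense {v | ∃ S : F →L[ℂ] F, S * X = X * S ∧ S ε = v})
    (A : StarSubalgebra ℂ (E →L[ℂ] E))
    (hA : ∀ a ∈ A, ∀ S, S * T = T * S → a * S = S * a)
    (B : StarSubalgebra ℂ (F →L[ℂ] F))
    (hB : ∀ Y, (∀ S, S * X = X * S → Y * S = S * Y) → Y ∈ B) :
    ∃ Φ : A →⋆ₐ[ℂ] B, (∀ a, inner ℂ ε ((Φ a : F →L[ℂ] F) ε) = inner ℂ δ ((a : E →L[ℂ] E) δ)) ∧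
      ∀ a : A, (a : E →L[ℂ] E) = T → (Φ a : F →L[ℂ] F) = X := by
  obtain ⟨V, hVδ, hVε, hV⟩ := exists_intertwiner hT hX hmom
  let C : Subalgebra ℂ (F →L[ℂ] F) := Subalgebra.centralizer ℂ {X}
  have hC : ∀ S, S ∈ C ↔ S * X = X * S := fun S => by
    rw [Subalgebra.mem_centralizer_iff]
    exact ⟨fun h => (h X rfl).symm, fun h y hy => by rw [Set.mem_singleton_iff.1 hy, h]⟩
  let e : C →ₗ[ℂ] F := (ContinuousLinearMap.apply ℂ F ε).toLinearMap ∘ₗ C.val.toLinearMap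
  let ev : F → C →ₗ[ℂ] F := fun v =>
    (ContinuousLinearMap.apply ℂ F v).toLinearMap ∘ₗ C.val.toLinearMap
  have hd : DenseRange e := by
    refine hcyc.mono ?_
    rintro _ ⟨S, hS, rfl⟩
    exact ⟨⟨S, (hC S).2 hS⟩, rfl⟩
  -- The image of a is the map S ε ↦ S V a δ, for S in the commutant of X. For a ∈ A it is bounded
  -- by `norm_intertwiner_apply_le`, and cyclicity of ε makes it densely defined.
  let φ : (E →L[ℂ] E) → F →L[ℂ] F := fun a => (ev (V (a δ))).extendOfNorm e
  have hφ : ∀ a ∈ A, ∀ S, S * X = X * S → φ a (S ε) = S (V (a δ)) := by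
    intro a ha S hS
    refine LinearMap.extendOfNorm_eq (f := ev (V (a δ))) (e := e) hd ⟨‖a‖, fun S => ?_⟩
      ⟨S, (hC S).2 hS⟩
    have := norm_intertwiner_apply_le (δ := δ) hT hX hV (hA a ha) ((hC S).1 S.2)
    rw [hVδ] at this
    exact this
  have hext : ∀ Y Z : F →L[ℂ] F, (∀ S, S * X = X * S → Y (S ε) = Z (S ε)) → Y = Z := by
    intro Y Z h
    ext v
    refine hcyc.induction (P := fun v => Y v = Z v) ?_ (isClosed_eq (by fun_prop) (by fun_prop)) v
    rintro _ ⟨S, hS, rfl⟩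
    exact h S hS
  have hcomm : ∀ a ∈ A, ∀ S, S * X = X * S → φ a * S = S * φ a := by
    intro a ha S hS
    refine hext _ _ fun S' hS' => ?_
    change φ a ((S * S') ε) = S (φ a (S' ε))
    rw [hφ a ha _ (by rw [mul_assoc, hS', ← mul_assoc, hS, mul_assoc]), hφ a ha _ hS']
    rfl
  have h1 : ∀ a ∈ A, φ a ε = V (a δ) := fun a ha => hφ a ha 1 (by rw [one_mul, mul_one])
  -- An operator commuting with the commutant of X is determined by its value at ε. All the
  -- algebraic properties of φ are reduced to this.
  have huniq : ∀ a ∈ A, ∀ Y : F →L[ℂ] F, (∀ S, S * X = X * S → Y * S = S * Y) →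
      Y ε = V (a δ) → φ a = Y := by
    intro a ha Y hY hYε
    refine hext _ _ fun S hS => ?_
    rw [hφ a ha S hS, ← hYε]
    exact (congrArg (fun Z : F →L[ℂ] F => Z ε) (hY S hS)).symm
  have hvec : ∀ w w' : F, (∀ S, S * X = X * S → inner ℂ w (S ε) = inner ℂ w' (S ε)) → w = w' := by
    intro w w' h
    refine ext_inner_right ℂ fun v => ?_
    refine hcyc.induction (P := fun v => inner ℂ w v = inner ℂ w' v) ?_
      (isClosed_eq (by fun_prop) (by fun_prop)) v
    rintro _ ⟨S, hS, rfl⟩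
    exact h S hS
  -- V* S V commutes with T, hence with a, so that a can be moved across S to the other side of the
  -- inner product.
  have hswap : ∀ a ∈ A, ∀ S, S * X = X * S → ∀ u v,
      inner ℂ (V u) (S (V (a v))) = inner ℂ (V ((star a) u)) (S (V v)) := by
    intro a ha S hS u v
    set c : E →L[ℂ] E := (adjoint V).comp (S.comp V) with hc
    have hVX : (adjoint V).comp X = T.comp (adjoint V) := by
      have h := congrArg adjoint hV
      rw [adjoint_comp, adjoint_comp, adjoint_eq_self hT, adjoint_eq_self hX] at h
      exact h.symm
    have hSX : S.comp X = X.comp S := hS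
    have hcT : c * T = T * c := by
      change c.comp T = T.comp c
      rw [hc, comp_assoc, comp_assoc, hV, ← comp_assoc S, hSX, comp_assoc X, ← comp_assoc, hVX,
        comp_assoc]
    have hca : c (a v) = a (c v) :=
      (congrArg (fun Z : E →L[ℂ] E => Z v) (hA a ha c hcT)).symm
    have h2 : ∀ u v, inner ℂ (V u) (S (V v)) = inner ℂ u (c v) := fun u v =>
      (adjoint_inner_right V u (S (V v))).symm
    rw [h2, h2, hca, star_eq_adjoint, adjoint_inner_left]
  have hstarcomm : ∀ S, S * X = X * S → star S * X = X * star S := by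
    intro S hS
    have := congrArg star hS
    rw [star_mul, star_mul, hX.star_eq] at this
    exact this.symm
  have hstar : ∀ a ∈ A, φ (star a) = star (φ a) := by
    intro a ha
    refine huniq _ (star_mem ha) _ (fun S hS => ?_) (hvec _ _ fun S hS => ?_)
    · have := congrArg star (hcomm a ha _ (hstarcomm S hS))
      rw [star_mul, star_mul, star_star] at this
      exact this.symm
    · rw [star_eq_adjoint, adjoint_inner_left, hφ a ha S hS, ← hVδ, hswap a ha S hS]
  have hmul : ∀ a ∈ A, ∀ b ∈ A, φ (a * b) = φ a * φ b := by
    intro a ha b hb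
    refine huniq _ (mul_mem ha hb) _ (fun S hS => ?_) (hvec _ _ fun S hS => ?_)
    · rw [mul_assoc, hcomm b hb S hS, ← mul_assoc, hcomm a ha S hS, mul_assoc]
    · change inner ℂ (φ a (φ b ε)) _ = inner ℂ (V (a (b δ))) _
      rw [h1 b hb, ← adjoint_inner_right, ← star_eq_adjoint, ← hstar a ha,
        hφ _ (star_mem ha) S hS, hswap _ (star_mem ha) S hS, star_star, hVδ]
  have hone : φ 1 = 1 :=
    huniq 1 A.one_mem 1 (fun S _ => by rw [one_mul, mul_one]) hVδ.symm
  refine ⟨{ toFun := fun a => ⟨φ a, hB _ fun S hS => hcomm a a.2 S hS⟩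
            map_one' := Subtype.ext hone
            map_mul' := fun a b => Subtype.ext (hmul a a.2 b b.2)
            map_zero' := Subtype.ext (huniq 0 A.zero_mem 0
              (fun S _ => by rw [zero_mul, mul_zero]) (map_zero V).symm)
            map_add' := fun a b => Subtype.ext (huniq _ (A.add_mem a.2 b.2) (φ a + φ b)
              (fun S hS => by rw [add_mul, mul_add, hcomm a a.2 S hS, hcomm b b.2 S hS])
              (by
                change φ a ε + φ b ε = V ((a : E →L[ℂ] E) δ + (b : E →L[ℂ] E) δ)
                rw [h1 a a.2, h1 b b.2, map_add]))
            commutes' := fun z => Subtype.ext (huniq _ (A.algebraMap_mem z) (algebraMap ℂ _ z)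
              (fun S _ => Algebra.commutes z S) (by
                change z • ε = V (z • δ)
                rw [map_smul, hVδ]))
            map_star' := fun a => Subtype.ext (hstar a a.2) }, fun a => ?_, fun a ha => ?_⟩
  · change inner ℂ ε (φ a ε) = _
    rw [h1 a a.2, ← adjoint_inner_left, hVε]
  · refine huniq a a.2 X (fun S hS => hS.symm) ?_
    rw [ha, ← hVδ]
    exact (congrArg (fun Z : E →L[ℂ] F => Z δ) hV).symm

end Moments

/-! ### Counting walks in a regular tree -/

section Walks

/-- The number of walks of length `n` in the `(d + 1)`-regular tree from a given vertex to the
root, for a vertex at distance `k` from the root. -/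
def walkCount (d : ℕ) : ℕ → ℕ → ℂ
  | 0, k => if k = 0 then 1 else 0
  | n + 1, 0 => (d + 1) * walkCount d n 1
  | n + 1, k + 1 => walkCount d n k + d * walkCount d n (k + 2)

/-- One step of a walk, with the tree reduced to the distances of the neighbours from the root. In
this form it serves both the free group and Γ\G. -/
theorem sum_walkCount {ι : Type*} [Fintype ι] {d : ℕ} (hd : Fintype.card ι = d + 1) (n k : ℕ)
    (l : ι → ℕ) (h0 : k = 0 → ∀ i, l i = 1)
    (h1 : ∀ m, k = m + 1 → ∃ i, l i = m ∧ ∀ j, j ≠ i → l j = m + 2) :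
    ∑ i, walkCount d n (l i) = walkCount d (n + 1) k := by
  classical
  cases k with
  | zero =>
    simp only [h0 rfl, Finset.sum_const, Finset.card_univ, hd, walkCount]
    simp
  | succ m =>
    obtain ⟨i, hi, hj⟩ := h1 m rfl
    rw [← Finset.add_sum_erase _ _ (Finset.mem_univ i), hi, walkCount]
    congr 1
    rw [Finset.sum_congr rfl fun j hj' => by rw [hj j (Finset.ne_of_mem_erase hj')],
      Finset.sum_const, Finset.card_erase_of_mem (Finset.mem_univ _), Finset.card_univ, hd]
    simp

theorem walkCount_of_lt (d : ℕ) {n k : ℕ} (h : n < k) : walkCount d n k = 0 := by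
  induction n generalizing k with
  | zero => exact if_neg (by omega)
  | succ n ih =>
    obtain ⟨k, rfl⟩ : ∃ j, k = j + 1 := ⟨k - 1, by omega⟩
    rw [walkCount, ih (by omega), ih (by omega), mul_zero, add_zero]

/-- The geodesic is the only walk of minimal length. Together with `walkCount_of_lt` this gives the
triangularity behind `aeval_heckeT_one_injective`. -/
theorem walkCount_self (d n : ℕ) : walkCount d n n = 1 := by
  induction n with
  | zero => exact if_pos rfl
  | succ n ih => rw [walkCount, ih, walkCount_of_lt d (by omega), mul_zero, add_zero]

/-! ### The element `χ₁` of the free group algebra -/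

/-- A letter multiplied from the left either cancels the first letter of the reduced word or
lengthens the word by one. -/
theorem freeGroup_norm_mk_mul {α : Type*} [DecidableEq α] (x : α × Bool) (w : FreeGroup α) :
    (FreeGroup.mk [x] * w).norm = match w.toWord with
      | [] => 1
      | y :: L => if x.1 = y.1 ∧ x.2 = !y.2 then L.length else L.length + 2 := by
  have h : (FreeGroup.mk [x] * w).toWord = FreeGroup.reduce (x :: w.toWord) := by
    conv_lhs => rw [← FreeGroup.mk_toWord (x := w), FreeGroup.mul_mk, FreeGroup.toWord_mk]
    rfl
  rw [FreeGroup.norm, h, FreeGroup.reduce.cons, FreeGroup.reduce_toWord]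
  rcases w.toWord with _ | ⟨y, L⟩
  · rfl
  · simp only
    split_ifs <;> rfl

theorem coord_chiOne (N : ℕ) (v : L2 (FreeGroup (Fin N))) (w : FreeGroup (Fin N)) :
    coord (chiOne N v) w = ∑ x : Fin N × Bool, coord v (FreeGroup.mk [x] * w) := by
  rw [chiOne, sum_apply, coord_sum, Fintype.sum_prod_type]
  refine Finset.sum_congr rfl fun i _ => ?_
  rw [Fintype.sum_bool]
  change coord (leftReg (FreeGroup.of i) v) w + coord (leftReg (FreeGroup.of i)⁻¹ v) w = _
  rw [coord_leftReg, coord_leftReg, inv_inv, add_comm]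
  rfl

/-- χ₁ is the adjacency operator of the Cayley graph, a tree of valency 2N, so the coefficient at w
counts walks and depends only on the length of w. -/
theorem coord_chiOne_pow {N d : ℕ} (hd : 2 * N = d + 1) (n : ℕ) (w : FreeGroup (Fin N)) :
    coord ((chiOne N ^ n) (delta 1)) w = walkCount d n w.norm := by
  classical
  induction n generalizing w with
  | zero =>
    rw [pow_zero]
    change coord (delta 1) w = _
    rw [coord_delta, walkCount]
    exact if_congr FreeGroup.norm_eq_zero.symm rfl rfl
  | succ n ih =>
    rw [pow_succ']
    change coord (chiOne N ((chiOne N ^ n) (delta 1))) w = _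
    rw [coord_chiOne]
    simp only [ih]
    refine sum_walkCount (by simp [← hd, mul_comm]) n _ _ (fun h x => ?_) fun m h => ?_
    · rw [freeGroup_norm_mk_mul, FreeGroup.toWord_eq_nil_iff.2 (FreeGroup.norm_eq_zero.1 h)]
    · rw [FreeGroup.norm] at h
      obtain ⟨y, L, hw⟩ := List.exists_cons_of_length_eq_add_one h
      rw [hw, List.length_cons] at h
      have hL : L.length = m := by omega
      refine ⟨(y.1, !y.2), ?_, fun x hx => ?_⟩
      · rw [freeGroup_norm_mk_mul, hw]
        simp [hL]
      · rw [freeGroup_norm_mk_mul, hw]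
        simp only
        rw [if_neg, hL]
        rintro ⟨h1, h2⟩
        exact hx (Prod.ext h1 h2)

theorem trace_chiOne_pow {N d : ℕ} (hd : 2 * N = d + 1) (n : ℕ) :
    trace (chiOne N ^ n) = walkCount d n 0 := by
  have := coord_chiOne_pow hd n 1
  rwa [FreeGroup.norm_one] at this

end Walks

/-! ### Hecke operators -/

section Hecke

/-- The coefficients of the recursion `T₁ T_{n+1} = T_{n+2} + c_n T_n`. -/
def recCoeff (p n : ℕ) : ℂ := if n = 0 then p + 1 else p

/-- The polynomials `q_n` with `T_n = q_n(T₁)`. -/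
def heckePoly (p : ℕ) : ℕ → Polynomial ℂ
  | 0 => 1
  | 1 => Polynomial.X
  | n + 2 => Polynomial.X * heckePoly p (n + 1) - Polynomial.C (recCoeff p n) * heckePoly p n

/-- The recursion and the value at zero determine the whole sequence from t 1. It is applied to the
Hecke operators, to the double cosets in `heckeAlg` and to the maps `psi`. -/
theorem eq_aeval_heckePoly {p : ℕ} {A : Type*} [Ring A] [Algebra ℂ A] (t : ℕ → A) (h0 : t 0 = 1)
    (h : ∀ n, t 1 * t (n + 1) = t (n + 2) + recCoeff p n • t n) (n : ℕ) :
    t n = Polynomial.aeval (t 1) (heckePoly p n) := by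
  induction n using Nat.twoStepInduction with
  | zero => rw [heckePoly, map_one, h0]
  | one => rw [heckePoly, Polynomial.aeval_X]
  | more n h1 h2 =>
    rw [heckePoly, map_sub, map_mul, map_mul, Polynomial.aeval_X, Polynomial.aeval_C, ← h1, ← h2,
      h, Algebra.smul_def, add_sub_cancel_right]

variable {p : ℕ} [Fact p.Prime]

theorem cosetMk_eq_iff {G : Type} [Group G] {Γ : Subgroup G} {x y : G} :
    cosetMk Γ x = cosetMk Γ y ↔ y * x⁻¹ ∈ Γ := by
  rw [cosetMk, cosetMk, Quotient.eq]
  exact QuotientGroup.rightRel_apply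

theorem cosetMk_out {G : Type} [Group G] {Γ : Subgroup G} (q : CosetSpace Γ) :
    cosetMk Γ q.out = q := Quotient.out_eq q

theorem cosetMk_surjective {G : Type} [Group G] {Γ : Subgroup G} :
    Function.Surjective (cosetMk Γ) := fun q => ⟨_, cosetMk_out q⟩

theorem cosetMk_mul_left {G : Type} [Group G] {Γ : Subgroup G} {γ : G} (hγ : γ ∈ Γ) (x : G) :
    cosetMk Γ (γ * x) = cosetMk Γ x := by
  rw [eq_comm, cosetMk_eq_iff, mul_inv_cancel_right]
  exact hγ

open Classical in
theorem entry_heckeOp (σ x y : GG p) :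
    entry (heckeOp (modGroup p) σ) (cosetMk _ x) (cosetMk _ y) =
      if level (x * y⁻¹) = level σ then 1 else 0 := by
  refine (heckeOp_spec _ (modGroup_finite p) σ _ _).trans (if_congr ?_ rfl rfl)
  rw [dblCoset_eq_dc (mem_dc_level σ)]
  simp only [mem_dc_iff_level]
  refine ⟨?_, fun h => ⟨x, y, rfl, rfl, h⟩⟩
  rintro ⟨x', y', hx, hy, h⟩
  rw [cosetMk_eq_iff] at hx hy
  rw [← h, show x * y⁻¹ = (x * x'⁻¹) * ((x' * y'⁻¹) * (y * y'⁻¹)⁻¹) by group, level_mul_left hx,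
    level_mul_right ((modGroup p).inv_mem hy)]

variable (p) in
/-- The Hecke operator of `Γ σ_{p^n} Γ`. -/
def heckeT (n : ℕ) : BL2 (CosetSpace (modGroup p)) := heckeOp (modGroup p) (sigma p n)

open Classical in
theorem entry_heckeT (n : ℕ) (x y : GG p) :
    entry (heckeT p n) (cosetMk _ x) (cosetMk _ y) = if level (x * y⁻¹) = n then 1 else 0 := by
  rw [heckeT, entry_heckeOp, level_sigma]

theorem entry_ext_cosetMk {G : Type} [Group G] {Γ : Subgroup G} {S T : BL2 (CosetSpace Γ)}
    (h : ∀ x y, entry S (cosetMk Γ x) (cosetMk Γ y) = entry T (cosetMk Γ x) (cosetMk Γ y)) :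
    S = T :=
  entry_ext fun q r => by
    obtain ⟨x, rfl⟩ := cosetMk_surjective q
    obtain ⟨y, rfl⟩ := cosetMk_surjective r
    exact h x y

theorem heckeOp_eq_heckeT (σ : GG p) : heckeOp (modGroup p) σ = heckeT p (level σ) := by
  classical
  exact entry_ext_cosetMk fun x y => by rw [entry_heckeOp, entry_heckeT]

theorem star_heckeT (n : ℕ) : star (heckeT p n) = heckeT p n := by
  classical
  refine entry_ext_cosetMk fun x y => ?_
  rw [entry_star, entry_heckeT, entry_heckeT, ← level_inv, mul_inv_rev, inv_inv,
    apply_ite (starRingEnd ℂ), map_one, map_zero]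

theorem heckeT_zero : heckeT p 0 = 1 := by
  classical
  refine entry_ext_cosetMk fun x y => ?_
  rw [entry_heckeT, entry_one]
  refine if_congr ?_ rfl rfl
  rw [level_eq_zero_iff, eq_comm (a := cosetMk _ x), cosetMk_eq_iff (x := y)]

/-- If x y⁻¹ has level one, then x y⁻¹ = `nbr i` γ for some i and γ ∈ Γ, so Γy = Γ (`nbr i`)⁻¹ x.
Hence [Γσ_pΓ] is the adjacency operator of the tree. -/
theorem coord_heckeT_one (v : L2 (CosetSpace (modGroup p))) (x : GG p) :
    coord (heckeT p 1 v) (cosetMk _ x) =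
      ∑ i : Option (Fin p), coord v (cosetMk _ ((nbr i)⁻¹ * x)) := by
  classical
  have hinj : Function.Injective fun i : Option (Fin p) =>
      cosetMk (modGroup p) ((nbr i)⁻¹ * x) := by
    intro i j hij
    rw [cosetMk_eq_iff] at hij
    refine (nbr_injective_mod ?_).symm
    simpa [mul_assoc] using hij
  have h0 : ∀ r ∉ Finset.univ.image fun i : Option (Fin p) => cosetMk (modGroup p) ((nbr i)⁻¹ * x),
      entry (heckeT p 1) (cosetMk _ x) r * coord v r = 0 := by
    intro r hr
    obtain ⟨y, rfl⟩ := cosetMk_surjective r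
    rw [entry_heckeT, if_neg, zero_mul]
    intro hl
    obtain ⟨i, γ, hγ, h⟩ := exists_eq_nbr_mul (mem_dc_iff_level.2 hl)
    refine hr (Finset.mem_image.2 ⟨i, Finset.mem_univ _, ?_⟩)
    rw [cosetMk_eq_iff]
    have h' : y * ((nbr i)⁻¹ * x)⁻¹ = ((nbr i)⁻¹ * (x * y⁻¹))⁻¹ := by group
    rw [h', h, inv_mul_cancel_left]
    exact (modGroup p).inv_mem hγ
  have h1 := (hasSum_coord_apply (heckeT p 1) v (cosetMk _ x)).unique
    (hasSum_sum_of_ne_finset_zero h0)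
  rw [Finset.sum_image fun i _ j _ h => hinj h] at h1
  refine h1.trans ?_
  refine Finset.sum_congr rfl fun i _ => ?_
  rw [entry_heckeT, if_pos, one_mul]
  rw [mul_inv_rev, inv_inv, mul_inv_cancel_left, level_nbr]

theorem coord_heckeT_one_pow (n : ℕ) (x : GG p) :
    coord ((heckeT p 1 ^ n) (delta (cosetMk _ 1))) (cosetMk _ x) = walkCount p n (level x) := by
  classical
  induction n generalizing x with
  | zero =>
    rw [pow_zero]
    change coord (delta _) _ = _
    rw [coord_delta, walkCount]
    refine if_congr ?_ rfl rfl
    rw [level_eq_zero_iff, eq_comm, cosetMk_eq_iff, inv_one, mul_one]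
  | succ n ih =>
    rw [pow_succ']
    change coord (heckeT p 1 ((heckeT p 1 ^ n) (delta _))) _ = _
    rw [coord_heckeT_one]
    simp only [ih]
    exact sum_walkCount (by simp) n _ _ (fun h i => level_nbr_inv_mul_of_mem h i)
      fun m h => exists_level_nbr_inv_mul h

theorem heckeTrace_heckeT_one_pow (n : ℕ) :
    heckeTrace (modGroup p) (heckeT p 1 ^ n) = walkCount p n 0 := by
  have := coord_heckeT_one_pow (p := p) n 1
  rwa [level_eq_zero_iff.2 (modGroup p).one_mem] at this

open Classical in
theorem card_filter_level_eq (g : GG p) (n : ℕ) :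
    ((Finset.univ.filter fun i : Option (Fin p) => level ((nbr i)⁻¹ * g) = n + 1).card : ℂ) =
      (if level g = n + 2 then 1 else 0) + recCoeff p n * if level g = n then 1 else 0 := by
  rw [card_level_nbr_inv_mul, recCoeff]
  rcases Nat.eq_zero_or_pos (level g) with h | h
  · rw [h]
    by_cases hn : n = 0
    · subst hn; simp
    · simp [hn, Ne.symm hn]
  · rw [if_neg h.ne']
    by_cases h1 : level g = n + 2
    · simp [h1]
    · by_cases h2 : level g = n
      · rw [if_neg (by omega), if_pos (by omega), if_neg h1, if_neg (by omega), if_pos h2]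
        simp
      · simp [h1, h2, Ne.symm h2]

/-- The entry of the product counts the neighbours of Γx at distance n + 1 from Γy, and
`card_filter_level_eq` evaluates this number. -/
theorem heckeT_one_mul (n : ℕ) :
    heckeT p 1 * heckeT p (n + 1) = heckeT p (n + 2) + recCoeff p n • heckeT p n := by
  classical
  refine entry_ext_cosetMk fun x y => ?_
  rw [entry_add, entry_smul, entry_heckeT, entry_heckeT, ← card_filter_level_eq]
  change coord (heckeT p 1 (heckeT p (n + 1) (delta _))) _ = _
  rw [coord_heckeT_one]
  simp only [coord_apply_delta, entry_heckeT, mul_assoc, Finset.sum_boole]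

theorem heckeT_eq_aeval (n : ℕ) :
    heckeT p n = Polynomial.aeval (heckeT p 1) (heckePoly p n) :=
  eq_aeval_heckePoly (heckeT p) heckeT_zero heckeT_one_mul n

theorem star_aeval_of_isSelfAdjoint {A : Type*} [Ring A] [StarRing A] [Algebra ℂ A]
    [StarModule ℂ A] {t : A} (ht : IsSelfAdjoint t) (q : Polynomial ℂ) :
    star (Polynomial.aeval t q) = Polynomial.aeval t (q.map (starRingEnd ℂ)) := by
  induction q using Polynomial.induction_on' with
  | add q r hq hr => rw [map_add, star_add, hq, hr, Polynomial.map_add, map_add]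
  | monomial n a =>
    rw [Polynomial.map_monomial, Polynomial.aeval_monomial, Polynomial.aeval_monomial, star_mul,
      (ht.pow n).star_eq, ← algebraMap_star_comm, Algebra.commutes]
    rfl

theorem exists_aeval_of_mem_heckeAlg {h : BL2 (CosetSpace (modGroup p))}
    (hh : h ∈ heckeAlg (modGroup p)) :
    ∃ q : Polynomial ℂ, h = Polynomial.aeval (heckeT p 1) q := by
  induction hh using StarAlgebra.adjoin_induction with
  | mem x hx =>
    obtain ⟨σ, rfl⟩ := hx
    exact ⟨_, by rw [heckeOp_eq_heckeT, heckeT_eq_aeval]⟩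
  | algebraMap z => exact ⟨Polynomial.C z, by rw [Polynomial.aeval_C]⟩
  | add x y _ _ hx hy =>
    obtain ⟨q, rfl⟩ := hx
    obtain ⟨r, rfl⟩ := hy
    exact ⟨q + r, by rw [map_add]⟩
  | mul x y _ _ hx hy =>
    obtain ⟨q, rfl⟩ := hx
    obtain ⟨r, rfl⟩ := hy
    exact ⟨q * r, by rw [map_mul]⟩
  | star x _ hx =>
    obtain ⟨q, rfl⟩ := hx
    exact ⟨_, star_aeval_of_isSelfAdjoint (star_heckeT 1) q⟩

/-- At a vertex whose distance from the root is the degree of q, the vector q(T₁) δ_Γ takes the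
leading coefficient as its value: lower powers do not reach that vertex, and the top power reaches
it by one walk. -/
theorem aeval_heckeT_one_injective :
    Function.Injective (Polynomial.aeval (heckeT p 1) :
      Polynomial ℂ →ₐ[ℂ] BL2 (CosetSpace (modGroup p))) := by
  rw [injective_iff_map_eq_zero]
  intro q hq
  have h2 : ∀ n, coord ((q.coeff n • heckeT p 1 ^ n) (delta (cosetMk (modGroup p) 1)))
      (cosetMk _ (sigma p q.natDegree)) = q.coeff n * walkCount p n q.natDegree := fun n => by
    rw [← level_sigma (p := p) q.natDegree, ← coord_heckeT_one_pow, level_sigma]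
    rfl
  have h1 : coord (Polynomial.aeval (heckeT p 1) q (delta (cosetMk _ 1)))
      (cosetMk _ (sigma p q.natDegree)) = q.leadingCoeff := by
    rw [Polynomial.aeval_eq_sum_range, sum_apply, coord_sum, Finset.sum_range_succ,
      Finset.sum_eq_zero, zero_add, h2, walkCount_self, mul_one, Polynomial.leadingCoeff]
    intro n hn
    rw [h2, walkCount_of_lt _ (Finset.mem_range.1 hn), mul_zero]
  rw [hq] at h1
  exact Polynomial.leadingCoeff_eq_zero.1 h1.symm

theorem heckeAlg_le_heckeVN {G : Type} [Group G] (Γ : Subgroup G) : heckeAlg Γ ≤ heckeVN Γ :=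
  StarAlgebra.adjoin_le_centralizer_centralizer ℂ _

/-- All double cosets are self-adjoint polynomials in T₁, so commuting with T₁ suffices for
membership in their commutant. -/
theorem commute_of_mem_heckeVN {a : BL2 (CosetSpace (modGroup p))}
    (ha : a ∈ heckeVN (modGroup p)) {S : BL2 (CosetSpace (modGroup p))}
    (hS : S * heckeT p 1 = heckeT p 1 * S) : a * S = S * a := by
  rw [heckeVN, StarSubalgebra.mem_centralizer_iff] at ha
  refine (ha S ?_).1.symm
  rw [SetLike.mem_coe, StarSubalgebra.mem_centralizer_iff]
  have key : ∀ n, heckeT p n * S = S * heckeT p n := by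
    intro n
    rw [heckeT_eq_aeval]
    refine Subalgebra.mem_centralizer_iff ℂ |>.1 (?_ : _ ∈ Subalgebra.centralizer ℂ {S}) S rfl
      |>.symm
    refine Algebra.adjoin_le ?_ (Polynomial.aeval_mem_adjoin_singleton ℂ (heckeT p 1))
    rintro _ rfl
    rw [SetLike.mem_coe, Subalgebra.mem_centralizer_iff]
    rintro _ rfl
    exact hS
  rintro _ ⟨σ, rfl⟩
  rw [heckeOp_eq_heckeT, star_heckeT]
  exact ⟨key _, key _⟩

end Hecke

/-! ### Trace preserving homomorphisms of the Hecke algebra -/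

section TraceHom

variable {p : ℕ} [Fact p.Prime]

/-- The right translations commute with L(G) and carry δ_e to all basis vectors. -/
theorem dense_commutant_orbit {G : Type} [Group G] {X : BL2 G} (hX : X ∈ groupVN G) :
    Dense {v : L2 G | ∃ S : BL2 G, S * X = X * S ∧ S (delta 1) = v} := by
  have hρ : ∀ h : G, permOp (Equiv.mulRight h⁻¹) (delta (1 : G)) = delta h := fun h => by
    classical
    refine coord_ext fun l => ?_
    rw [coord_permOp, coord_delta, coord_delta]
    exact if_congr mul_inv_eq_one rfl rfl
  have hc : ∀ h : G, permOp (Equiv.mulRight h⁻¹) * X = X * permOp (Equiv.mulRight h⁻¹) := by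
    intro h
    refine mem_vnOf_iff.1 hX _ fun k _ => ?_
    refine ContinuousLinearMap.ext fun v => coord_ext fun l => ?_
    change coord v (k⁻¹ * l * h⁻¹) = coord v (k⁻¹ * (l * h⁻¹))
    rw [mul_assoc]
  intro v
  refine mem_closure_of_tendsto (hasSum_delta v) (Filter.Eventually.of_forall fun s => ?_)
  refine ⟨∑ h ∈ s, coord v h • permOp (Equiv.mulRight h⁻¹), ?_, ?_⟩
  · simp only [Finset.sum_mul, Finset.mul_sum, smul_mul_assoc, mul_smul_comm, hc]
  · rw [sum_apply]
    refine Finset.sum_congr rfl fun h _ => ?_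
    change coord v h • permOp (Equiv.mulRight h⁻¹) (delta 1) = _
    rw [hρ]

/-- The algebra A is left open between the one generated by T₁ and the von Neumann algebra, so that
both assertions of (1) are instances. The parity of p makes the free group on (p+1)/2 generators
have a (p+1)-regular Cayley tree. -/
theorem exists_heckeHom_iff {X : BL2 (GG p)} (hX : X ∈ groupVN (GG p)) (hsa : IsSelfAdjoint X)
    (A : StarSubalgebra ℂ (BL2 (CosetSpace (modGroup p)))) (hA : A ≤ heckeVN (modGroup p))
    (t : A) (ht : (t : BL2 (CosetSpace (modGroup p))) = heckeT p 1) (hp : Odd p) :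
    (∃ Φ : A →⋆ₐ[ℂ] groupVN (GG p),
        (∀ a, trace (Φ a : BL2 (GG p)) = heckeTrace (modGroup p) a) ∧
        ∀ n : ℕ, (Φ (t ^ n) : BL2 (GG p)) = X ^ n) ↔
      ∀ n : ℕ, trace (X ^ n) = trace (chiOne ((p + 1) / 2) ^ n) := by
  have h2 : 2 * ((p + 1) / 2) = p + 1 := by
    obtain ⟨k, rfl⟩ := hp
    omega
  have htr : ∀ n, trace (chiOne ((p + 1) / 2) ^ n) =
      heckeTrace (modGroup p) (heckeT p 1 ^ n) := fun n => by
    rw [trace_chiOne_pow h2, heckeTrace_heckeT_one_pow]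
  constructor
  · rintro ⟨Φ, h1, h3⟩ n
    rw [← h3, h1, htr, ← ht]
    rfl
  · intro h
    obtain ⟨Φ, h1, h3⟩ := exists_starAlgHom_of_moments (T := heckeT p 1) (X := X)
      (star_heckeT 1) hsa (δ := delta (cosetMk _ 1)) (ε := delta 1) (fun n => by
        rw [inner_delta_left, inner_delta_left]
        exact ((h n).trans (htr n)).symm) (dense_commutant_orbit hX) A
      (fun a ha S hS => commute_of_mem_heckeVN (hA ha) hS) (groupVN (GG p)) (fun Y hY =>
        mem_vnOf_iff.2 fun z hz => (hY z (mem_vnOf_iff.1 hX z hz)).symm)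
    refine ⟨Φ, fun a => ?_, fun n => ?_⟩
    · have := h1 a
      rw [inner_delta_left, inner_delta_left] at this
      exact this
    · rw [map_pow]
      exact congrArg (· ^ n) (h3 t ht)

end TraceHom

/-! ### Positive definite functions that come from representations of dimension one over `Γ` -/

section Representation

variable {G : Type} [Group G]

/-- The isometry of `ℓ²(ι)` that maps the basis vectors to the vectors of an orthonormal family. -/
def orthoMap {ι κ : Type} {f : ι → L2 κ} (hf : Orthonormal ℂ f) : L2 ι →L[ℂ] L2 κ :=
  hf.orthogonalFamily.linearIsometry.toContinuousLinearMap

theorem orthoMap_delta {ι κ : Type} {f : ι → L2 κ} (hf : Orthonormal ℂ f) (i : ι) :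
    orthoMap hf (delta i) = f i := by
  classical
  have h := hf.orthogonalFamily.linearIsometry_apply_single (i := i) (1 : ℂ)
  refine Eq.trans ?_ (h.trans ?_)
  · change hf.orthogonalFamily.linearIsometry (delta i) = _
    congr 1
  · simp [LinearIsometry.toSpanSingleton_apply]

/-- The properties of the matrix coefficient `g ↦ ⟨π(g) η, η⟩`, if `η` is cyclic and trace for
`Γ`. -/
structure IsMatrixCoeff (Γ : Subgroup G) (t : G → ℂ) : Prop where
  one : t 1 = 1
  of_mem : ∀ γ ∈ Γ, γ ≠ 1 → t γ = 0
  inv : ∀ g, t g⁻¹ = (starRingEnd ℂ) (t g)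
  hasSum : ∀ a b, HasSum (fun γ : Γ => t (a * γ) * t ((γ : G)⁻¹ * b)) (t (a * b))

namespace IsMatrixCoeff

variable {Γ : Subgroup G} {t : G → ℂ} (ht : IsMatrixCoeff Γ t)

include ht in
-- The convolution identity at (g⁻¹, h), rewritten by t(k⁻¹) = conj t(k): it is the inner product of
-- the prospective vectors π(g)η and π(h)η.
theorem hasSum_conj_mul (g h : G) :
    HasSum (fun γ : Γ => (starRingEnd ℂ) (t ((γ : G)⁻¹ * g)) * t ((γ : G)⁻¹ * h))
      (t (g⁻¹ * h)) := by
  convert! ht.hasSum g⁻¹ h using 3 with γ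
  rw [← ht.inv, mul_inv_rev, inv_inv]

/-- The vector `π(g) η`. -/
def vec (g : G) : L2 Γ := ⟨fun γ => t ((γ : G)⁻¹ * g), mem_l2 (C := 1) fun s => by
  have h := ht.hasSum_conj_mul g g
  -- The squared norm is t(g⁻¹g) = t(1) = 1, which also proves square summability.
  have h' : HasSum (fun γ : Γ => ‖t ((γ : G)⁻¹ * g)‖ ^ 2) 1 := by
    rw [inv_mul_cancel, ht.one] at h
    have h2 := Complex.hasSum_re h
    convert! h2 using 2 with γ
    rw [mul_comm, Complex.mul_conj, Complex.ofReal_re, Complex.normSq_eq_norm_sq]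
  exact sum_le_hasSum s (fun _ _ => sq_nonneg _) h'⟩

theorem coord_vec (g : G) (γ : Γ) : coord (ht.vec g) γ = t ((γ : G)⁻¹ * g) := rfl

theorem inner_vec (g h : G) : inner ℂ (ht.vec g) (ht.vec h) = t (g⁻¹ * h) :=
  (hasSum_inner_coord _ _).unique (ht.hasSum_conj_mul g h)

theorem vec_coe (γ : Γ) : ht.vec (γ : G) = delta γ := by
  classical
  refine coord_ext fun γ' => ?_
  rw [coord_vec, coord_delta]
  split_ifs with h
  · rw [h, inv_mul_cancel, ht.one]
  · refine ht.of_mem _ (Γ.mul_mem (Γ.inv_mem γ'.2) γ.2) fun h' => h ?_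
    exact Subtype.ext (inv_mul_eq_one.1 h')

theorem orthonormal_vec (g : G) : Orthonormal ℂ fun γ : Γ => ht.vec (g * γ) := by
  classical
  rw [orthonormal_iff_ite]
  intro γ γ'
  rw [inner_vec, show (g * (γ : G))⁻¹ * (g * γ') = (γ : G)⁻¹ * γ' by group, ← ht.coord_vec,
    vec_coe, coord_delta]

/-- The operator `π(g)`. -/
def op (g : G) : BL2 Γ := orthoMap (ht.orthonormal_vec g)

theorem op_delta (g : G) (γ : Γ) : ht.op g (delta γ) = ht.vec (g * γ) := orthoMap_delta _ γ

theorem entry_op (g : G) (γ γ' : Γ) : entry (ht.op g) γ γ' = t ((γ : G)⁻¹ * g * γ') := by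
  rw [entry, op_delta, coord_vec, mul_assoc]

/-- The convolution identity once more, now read as the matrix product of π(g) with the vector of h;
multiplicativity of π follows. -/
theorem op_vec (g h : G) : ht.op g (ht.vec h) = ht.vec (g * h) := by
  refine coord_ext fun γ => (hasSum_coord_apply _ _ _).unique ?_
  simp only [entry_op, coord_vec]
  rw [← mul_assoc]
  exact ht.hasSum _ h

theorem op_mul (g h : G) : ht.op (g * h) = ht.op g * ht.op h :=
  clm_ext_delta fun γ => by
    change _ = ht.op g (ht.op h (delta γ))
    rw [op_delta, op_delta, op_vec, mul_assoc]

theorem op_one : ht.op 1 = 1 :=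
  clm_ext_delta fun γ => by
    rw [op_delta, one_mul, vec_coe]
    rfl

theorem star_op (g : G) : star (ht.op g) = ht.op g⁻¹ :=
  entry_ext fun γ γ' => by
    rw [entry_star, entry_op, entry_op, ← ht.inv]
    congr 1
    group

theorem op_coe (γ : Γ) : ht.op (γ : G) = leftReg γ :=
  clm_ext_delta fun γ' => by
    rw [op_delta, leftReg_delta, ← Subgroup.coe_mul, vec_coe]

/-- The unitary representation `π`. -/
def rep : G →* unitary (BL2 Γ) where
  toFun g := ⟨ht.op g, by
    rw [Unitary.mem_iff, star_op, ← op_mul, ← op_mul, inv_mul_cancel, mul_inv_cancel, op_one]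
    exact ⟨rfl, rfl⟩⟩
  map_one' := Subtype.ext ht.op_one
  map_mul' g h := Subtype.ext (ht.op_mul g h)

include ht in
theorem comesFromRep {A : Set G} {x : BL2 G} (hx : ∀ g, coeff x g = A.indicator t g) :
    ComesFromRep Γ A x := by
  refine ⟨L2 Γ, inferInstance, inferInstance, inferInstance, ht.rep, LinearIsometryEquiv.refl ℂ _,
    fun γ v => ?_, fun g => ?_⟩
  · change ht.op (γ : G) v = leftReg γ v
    rw [op_coe]
  · rw [hx]
    congr 1
    funext θ
    change _ = inner ℂ (delta 1) (ht.op θ (delta 1))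
    rw [inner_delta_left, coord_apply_delta, entry_op]
    simp

end IsMatrixCoeff

/-- The matrix coefficients of a representation whose restriction to `Γ` is the regular one. -/
theorem isMatrixCoeff_of_rep {Γ : Subgroup G} {H : Type} [NormedAddCommGroup H]
    [InnerProductSpace ℂ H] [CompleteSpace H] (π : G →* unitary (H →L[ℂ] H)) (U : H ≃ₗᵢ[ℂ] L2 Γ)
    (hU : ∀ (γ : Γ) (v : H), U ((π (γ : G) : H →L[ℂ] H) v) = leftReg γ (U v)) :
    IsMatrixCoeff Γ fun θ =>
      inner ℂ (U.symm (delta 1)) ((π θ : H →L[ℂ] H) (U.symm (delta 1))) := by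
  classical
  set ζ : H := U.symm (delta 1) with hζ
  have hinner : ∀ g h : G, inner ℂ ((π g : H →L[ℂ] H) ζ) ((π h : H →L[ℂ] H) ζ) =
      inner ℂ ζ ((π (g⁻¹ * h) : H →L[ℂ] H) ζ) := by
    intro g h
    rw [map_mul, map_inv]
    rw [← Unitary.star_eq_inv]
    change _ = inner ℂ ζ ((star (π g : H →L[ℂ] H)) ((π h : H →L[ℂ] H) ζ))
    rw [ContinuousLinearMap.star_eq_adjoint, ContinuousLinearMap.adjoint_inner_right]
  have hγ : ∀ γ : Γ, U ((π (γ : G) : H →L[ℂ] H) ζ) = delta γ := fun γ => by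
    rw [hU, hζ, LinearIsometryEquiv.apply_symm_apply, leftReg_delta, mul_one]
  have hcoord : ∀ (g : G) (γ : Γ), coord (U ((π g : H →L[ℂ] H) ζ)) γ =
      inner ℂ ζ ((π ((γ : G)⁻¹ * g) : H →L[ℂ] H) ζ) := fun g γ => by
    rw [← inner_delta_left, ← hγ, U.inner_map_map, hinner]
  have hone : (π 1 : H →L[ℂ] H) ζ = ζ := by rw [map_one]; rfl
  have hmem : ∀ γ : Γ, inner ℂ ζ ((π (γ : G) : H →L[ℂ] H) ζ) = if (1 : Γ) = γ then 1 else 0 := by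
    intro γ
    rw [← U.inner_map_map, hγ, hζ, LinearIsometryEquiv.apply_symm_apply, inner_delta_left,
      coord_delta]
  have hinv : ∀ g, inner ℂ ζ ((π g⁻¹ : H →L[ℂ] H) ζ) =
      (starRingEnd ℂ) (inner ℂ ζ ((π g : H →L[ℂ] H) ζ)) := fun g => by
    rw [inner_conj_symm]
    have := hinner g 1
    rw [hone, mul_one] at this
    exact this.symm
  refine ⟨?_, fun γ hγ' hne => ?_, hinv, fun a b => ?_⟩
  · have := hmem 1
    rwa [if_pos rfl] at this
  · have := hmem ⟨γ, hγ'⟩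
    rwa [if_neg fun h => hne (congrArg Subtype.val h).symm] at this
  -- Parseval's equation for ⟨π(a⁻¹)η, π(b)η⟩ in the orthonormal basis π(γ)η.
  · have h := hasSum_inner_coord (U ((π a⁻¹ : H →L[ℂ] H) ζ)) (U ((π b : H →L[ℂ] H) ζ))
    rw [U.inner_map_map, hinner, inv_inv] at h
    convert! h using 2 with γ
    rw [hcoord, hcoord, ← hinv, mul_inv_rev, inv_inv, inv_inv]

end Representation

/-! ### Cosets -/

section Cosets

variable {G : Type} [Group G] {Γ : Subgroup G}

theorem mem_rightCoset_iff {a g : G} :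
    g ∈ rightCoset Γ a ↔ g * a⁻¹ ∈ Γ := by
  constructor
  · rintro ⟨γ, hγ, rfl⟩
    simpa using hγ
  · exact fun h => ⟨_, h, by group⟩

theorem mem_leftCoset_iff {a g : G} :
    g ∈ leftCoset Γ a ↔ a⁻¹ * g ∈ Γ := by
  constructor
  · rintro ⟨γ, hγ, rfl⟩
    simpa using hγ
  · exact fun h => ⟨_, h, by group⟩

theorem mem_bicoset_iff {a b g : G} :
    g ∈ bicoset Γ a b ↔ g * b⁻¹ ∈ leftCoset Γ a := by
  rw [mem_leftCoset_iff]
  constructor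
  · rintro ⟨γ, hγ, rfl⟩
    simpa [mul_assoc] using hγ
  · exact fun h => ⟨_, h, by group⟩

theorem rightCoset_eq_setOf (q : CosetSpace Γ) :
    {g | cosetMk Γ g = q} = rightCoset Γ q.out := by
  ext g
  rw [mem_rightCoset_iff, ← cosetMk_eq_iff, cosetMk_out, eq_comm]
  rfl

theorem leftCoset_mul_mem {a : G} (g γ : G) (hγ : γ ∈ Γ)
    (hg : g ∈ leftCoset Γ a) : g * γ ∈ leftCoset Γ a := by
  rw [mem_leftCoset_iff] at hg ⊢
  rw [← mul_assoc]
  exact Γ.mul_mem hg hγ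

theorem dblCoset_mul_mem {a : G} (g γ : G) (hγ : γ ∈ Γ)
    (hg : g ∈ dblCoset Γ a) : g * γ ∈ dblCoset Γ a := by
  obtain ⟨c, hc, d, hd, rfl⟩ := hg
  exact ⟨c, hc, d * γ, Γ.mul_mem hd hγ, by group⟩

theorem self_mem_dblCoset (a : G) : a ∈ dblCoset Γ a :=
  ⟨1, Γ.one_mem, 1, Γ.one_mem, by group⟩

/-- One representative is chosen for each of the finitely many cosets Γx in the double coset;
distinct representatives then belong to distinct cosets. -/
theorem exists_disjoint_cover {σ : G} (hfin : (cosetMk Γ '' dblCoset Γ σ).Finite) : ∃ r : Finset Γ,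
    (r : Set Γ).PairwiseDisjoint
      (fun γ => rightCoset Γ (σ * (γ : G))) ∧
    (⋃ γ ∈ r, rightCoset Γ (σ * (γ : G))) = dblCoset Γ σ := by
  classical
  have hex : ∀ q : CosetSpace Γ, ∃ γ : Γ,
      q ∈ cosetMk Γ '' dblCoset Γ σ →
        q = cosetMk Γ (σ * (γ : G)) := by
    intro q
    by_cases hq : q ∈ cosetMk Γ '' dblCoset Γ σ
    · obtain ⟨_, ⟨a, ha, b, hb, rfl⟩, rfl⟩ := hq
      exact ⟨⟨b, hb⟩, fun _ => by rw [mul_assoc, cosetMk_mul_left ha]⟩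
    · exact ⟨1, fun h => absurd h hq⟩
  choose f hf using hex
  have hf' : ∀ q ∈ hfin.toFinset, q = cosetMk Γ (σ * (f q : G)) :=
    fun q hq => hf q (hfin.mem_toFinset.1 hq)
  have hmem : ∀ (g : G) (q : CosetSpace Γ), q ∈ hfin.toFinset →
      (g ∈ rightCoset Γ (σ * (f q : G)) ↔ cosetMk Γ g = q) := by
    intro g q hq
    rw [mem_rightCoset_iff, ← cosetMk_eq_iff, ← hf' q hq, eq_comm]
  refine ⟨hfin.toFinset.image f, ?_, ?_⟩
  · intro γ hγ γ' hγ' hne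
    obtain ⟨q, hq, rfl⟩ := Finset.mem_image.1 (Finset.mem_coe.1 hγ)
    obtain ⟨q', hq', rfl⟩ := Finset.mem_image.1 (Finset.mem_coe.1 hγ')
    refine Set.disjoint_left.2 fun g hg hg' => hne ?_
    rw [← (hmem g q hq).1 hg, ← (hmem g q' hq').1 hg']
  · ext g
    simp only [Set.mem_iUnion]
    constructor
    · rintro ⟨γ, hγ, hg⟩
      obtain ⟨δ, hδ, rfl⟩ := hg
      exact ⟨δ, hδ, γ, γ.2, by group⟩
    · intro hg
      have hq : cosetMk Γ g ∈ hfin.toFinset := hfin.mem_toFinset.2 ⟨g, hg, rfl⟩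
      exact ⟨_, Finset.mem_image_of_mem f hq, (hmem g _ hq).2 rfl⟩

end Cosets

/-! ### The components of the powers of `X` -/

section Symbol

variable {p : ℕ} [Fact p.Prime] {X : BL2 (GG p)}

/-- The coefficients of the formal sum of the `X_e`. -/
def symbol (X : BL2 (GG p)) (g : GG p) : ℂ := ∑ᶠ e : ℕ, coeff (powComp X e) g

variable (hX : X ∈ groupVN (GG p))

include hX in
theorem entry_powComp (n : ℕ) (g h : GG p) :
    entry (powComp X n) g h = (dc p n).indicator (coeff (X ^ n)) (g * h⁻¹) :=
  projOn_dblCoset_spec (modGroup p) (pow_mem hX n) (sigma p n) (modGroup_finite p _) g h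

include hX in
theorem powComp_mem (n : ℕ) : powComp X n ∈ groupVN (GG p) :=
  mem_groupVN_of_entry (entry_powComp hX n)

include hX in
theorem symbol_eq (g : GG p) : symbol X g = coeff (X ^ level g) g := by
  rw [symbol, finsum_eq_single _ (level g), coeff_of_entry (entry_powComp hX _),
    Set.indicator_of_mem (mem_dc_level g)]
  intro e he
  rw [coeff_of_entry (entry_powComp hX _), Set.indicator_of_notMem]
  exact fun h => he (mem_dc_iff_level.1 h).symm

include hX in
theorem coeff_powComp (n : ℕ) (g : GG p) :
    coeff (powComp X n) g = (dc p n).indicator (symbol X) g := by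
  rw [coeff_of_entry (entry_powComp hX _)]
  by_cases h : g ∈ dc p n
  · rw [Set.indicator_of_mem h, Set.indicator_of_mem h, symbol_eq hX, mem_dc_iff_level.1 h]
  · rw [Set.indicator_of_notMem h, Set.indicator_of_notMem h]

include hX in
theorem symbol_one : symbol X 1 = 1 := by
  classical
  rw [symbol_eq hX, level_eq_zero_iff.2 (modGroup p).one_mem, pow_zero, coeff_one, if_pos rfl]

include hX in
theorem symbol_of_mem {γ : GG p} (hγ : γ ∈ modGroup p) (hne : γ ≠ 1) : symbol X γ = 0 := by
  classical
  rw [symbol_eq hX, level_eq_zero_iff.2 hγ, pow_zero, coeff_one, if_neg hne]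

include hX in
theorem symbol_inv (hsa : IsSelfAdjoint X) (g : GG p) :
    symbol X g⁻¹ = (starRingEnd ℂ) (symbol X g) := by
  rw [symbol_eq hX, symbol_eq hX, level_inv]
  conv_lhs => rw [← (hsa.pow (level g)).star_eq, coeff_star (pow_mem hX _), inv_inv]

/-- `X_A` is bounded and has the expected coefficients. -/
def HasComp (X : BL2 (GG p)) (A : Set (GG p)) : Prop :=
  comp X A ∈ groupVN (GG p) ∧ ∀ g, coeff (comp X A) g = A.indicator (symbol X) g

/-- `comp` is meaningful only once its coefficients are known to define a bounded operator; any
element of L(G) having them settles this. -/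
theorem comp_eq {A : Set (GG p)} {x : BL2 (GG p)} (hx : x ∈ groupVN (GG p))
    (h : ∀ g, coeff x g = A.indicator (symbol X) g) : comp X A = x :=
  convOp_eq hx fun g => (h g).symm

theorem hasComp_of_coeff {A : Set (GG p)} {x : BL2 (GG p)} (hx : x ∈ groupVN (GG p))
    (h : ∀ g, coeff x g = A.indicator (symbol X) g) : HasComp X A := by
  rw [HasComp, comp_eq hx h]
  exact ⟨hx, h⟩

include hX in
theorem hasComp_dc (n : ℕ) : HasComp X (dc p n) :=
  hasComp_of_coeff (powComp_mem hX n) (coeff_powComp hX n)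

include hX in
theorem comp_dc (n : ℕ) : comp X (dc p n) = powComp X n :=
  comp_eq (powComp_mem hX n) (coeff_powComp hX n)

include hX in
theorem hasComp_dblCoset (σ : GG p) : HasComp X (dblCoset (modGroup p) σ) := by
  rw [dblCoset_eq_dc (mem_dc_level σ)]
  exact hasComp_dc hX _

/-- The set aΓ meets only finitely many cosets Γx, and the level of xb depends only on Γx. So aΓb
meets only finitely many double cosets. -/
theorem exists_level_lt (a b : GG p) : ∃ N, ∀ g ∈ bicoset (modGroup p) a b, level g < N := by
  obtain ⟨N, hN⟩ := ((modGroup_finite p a).image fun q => level (q.out * b)).bddAbove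
  refine ⟨N + 1, ?_⟩
  rintro _ ⟨γ, hγ, rfl⟩
  refine Nat.lt_succ_of_le (hN ⟨_, ⟨a * γ, ⟨1, (modGroup p).one_mem, γ, hγ, by rw [one_mul]⟩,
    rfl⟩, ?_⟩)
  have h := cosetMk_eq_iff.1 (cosetMk_out (cosetMk (modGroup p) (a * γ)))
  beta_reduce
  rw [← level_mul_left h]
  congr 1
  group

include hX in
-- By `exists_level_lt` a finite sum of the X_e is enough, and the restriction of an element of L(G)
-- to aΓb is bounded.
theorem hasComp_bicoset (a b : GG p) : HasComp X (bicoset (modGroup p) a b) := by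
  obtain ⟨N, hN⟩ := exists_level_lt a b
  have hmem : ∑ e ∈ Finset.range N, powComp X e ∈ groupVN (GG p) :=
    sum_mem fun e _ => powComp_mem hX e
  have hspec := projOn_bicoset_spec (modGroup p) hmem a b
  refine hasComp_of_coeff (mem_groupVN_of_entry hspec) fun g => ?_
  rw [coeff_of_entry hspec]
  by_cases hg : g ∈ bicoset (modGroup p) a b
  · rw [Set.indicator_of_mem hg, Set.indicator_of_mem hg, coeff_sum,
      Finset.sum_eq_single (level g), coeff_powComp hX, Set.indicator_of_mem (mem_dc_level g)]
    · intro e _ he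
      rw [coeff_powComp hX, Set.indicator_of_notMem fun h => he (mem_dc_iff_level.1 h).symm]
    · exact fun h => absurd (Finset.mem_range.2 (hN g hg)) h
  · rw [Set.indicator_of_notMem hg, Set.indicator_of_notMem hg]

include hX in
theorem hasComp_fiber (q : CosetSpace (modGroup p)) :
    HasComp X {g | cosetMk (modGroup p) g = q} := by
  rw [rightCoset_eq_setOf]
  exact hasComp_bicoset hX _ _

/-- The coefficients of the product `X_A X_{Γσ}`. -/
theorem hasSum_coeff_comp_mul {A : Set (GG p)} {σ : GG p} (hA : HasComp X A)
    (hσ : HasComp X (rightCoset (modGroup p) σ)) (g : GG p) :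
    HasSum (fun γ : modGroup p => A.indicator (symbol X) (g * σ⁻¹ * γ) *
      symbol X ((γ : GG p)⁻¹ * σ)) (coeff (comp X A * comp X (rightCoset (modGroup p) σ)) g) := by
  have h := hasSum_coeff_mul hA.1 (comp X (rightCoset (modGroup p) σ)) g
  simp only [hA.2, hσ.2] at h
  -- The factor supported on Γσ leaves only the terms k with k⁻¹g ∈ Γσ, that is k = gσ⁻¹γ.
  have hinj : Function.Injective fun γ : modGroup p => g * σ⁻¹ * (γ : GG p) :=
    fun γ γ' h => Subtype.ext (mul_left_cancel h)
  rw [← hinj.hasSum_iff] at h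
  · convert! h using 2 with γ
    rw [Function.comp_apply, show (g * σ⁻¹ * (γ : GG p))⁻¹ * g = (γ : GG p)⁻¹ * σ by group,
      Set.indicator_of_mem (s := rightCoset (modGroup p) σ)]
    rw [mem_rightCoset_iff, mul_inv_cancel_right]
    exact (modGroup p).inv_mem γ.2
  · intro k hk
    rw [Set.indicator_of_notMem (s := rightCoset (modGroup p) σ), mul_zero]
    intro hk'
    rw [mem_rightCoset_iff] at hk'
    exact hk ⟨⟨_, (modGroup p).inv_mem hk'⟩, by simp only; group⟩

/-- The coefficients of the product `X_A X_{Γσ}`, for a set `A` that is a union of left cosets. -/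
theorem hasSum_coeff_comp_mul_of_mem {A : Set (GG p)} {σ : GG p} (hA : HasComp X A)
    (hσ : HasComp X (rightCoset (modGroup p) σ))
    (hinv : ∀ g, ∀ γ ∈ modGroup p, g ∈ A → g * γ ∈ A) {g : GG p} (hg : g * σ⁻¹ ∈ A) :
    HasSum (fun γ : modGroup p => symbol X (g * σ⁻¹ * γ) * symbol X ((γ : GG p)⁻¹ * σ))
      (coeff (comp X A * comp X (rightCoset (modGroup p) σ)) g) := by
  convert! hasSum_coeff_comp_mul hA hσ g using 3 with γ
  rw [Set.indicator_of_mem (hinv _ _ γ.2 hg)]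

theorem coeff_comp_mul_of_notMem {A : Set (GG p)} {σ : GG p} (hA : HasComp X A)
    (hσ : HasComp X (rightCoset (modGroup p) σ))
    (hinv : ∀ g, ∀ γ ∈ modGroup p, g ∈ A → g * γ ∈ A) {g : GG p} (hg : g * σ⁻¹ ∉ A) :
    coeff (comp X A * comp X (rightCoset (modGroup p) σ)) g = 0 := by
  refine (hasSum_coeff_comp_mul hA hσ g).unique ?_
  convert! hasSum_zero with γ
  rw [Set.indicator_of_notMem, zero_mul]
  intro h
  have := hinv _ _ ((modGroup p).inv_mem γ.2) h
  rw [mul_inv_cancel_right] at this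
  exact hg this

/-- The convolution identity for the coefficients of the formal sum of the `X_e`. -/
def SymbolMul (X : BL2 (GG p)) : Prop := ∀ a b, HasSum (fun γ : modGroup p =>
  symbol X (a * γ) * symbol X ((γ : GG p)⁻¹ * b)) (symbol X (a * b))

include hX in
theorem isMatrixCoeff_symbol (hsa : IsSelfAdjoint X) (h : SymbolMul X) :
    IsMatrixCoeff (modGroup p) (symbol X) :=
  ⟨symbol_one hX, fun _ hγ hne => symbol_of_mem hX hγ hne, symbol_inv hX hsa, h⟩

include hX in
-- For g with gσ₂⁻¹ ∈ σ₁Γ, the coefficient at g of X_{σ₁Γ} X_{Γσ₂} is the convolution sum for the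
-- pair (gσ₂⁻¹, σ₂). The adjoint relation needs only t(g⁻¹) = conj t(g).
theorem cosetRelations_iff (hsa : IsSelfAdjoint X) : CosetRelations X ↔ SymbolMul X := by
  constructor
  · rintro ⟨-, h⟩ a b
    have h1 := hasSum_coeff_comp_mul_of_mem (σ := b) (hasComp_bicoset hX a 1)
      (hasComp_bicoset hX 1 b) (fun g γ hγ hg => leftCoset_mul_mem g γ hγ hg) (g := a * b) (by
        rw [mul_inv_cancel_right]
        exact mem_leftCoset_iff.2 (by rw [inv_mul_cancel]; exact one_mem _))
    rw [h, (hasComp_bicoset hX a b).2, mul_inv_cancel_right, Set.indicator_of_mem] at h1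
    · exact h1
    · exact ⟨1, one_mem _, by rw [mul_one]⟩
  · intro h
    refine ⟨fun σ => ?_, fun σ₁ σ₂ => ?_⟩
    · have h1 := hasComp_bicoset hX 1 σ
      have h2 := hasComp_bicoset hX σ⁻¹ 1
      refine groupVN_ext (star_mem h1.1) h2.1 fun g => ?_
      rw [coeff_star h1.1, h1.2, h2.2]
      have hiff : g⁻¹ ∈ rightCoset (modGroup p) σ ↔ g ∈ leftCoset (modGroup p) σ⁻¹ := by
        rw [mem_rightCoset_iff, mem_leftCoset_iff, ← (modGroup p).inv_mem_iff, mul_inv_rev, inv_inv]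
        simp
      by_cases hg : g ∈ leftCoset (modGroup p) σ⁻¹
      · rw [Set.indicator_of_mem hg, Set.indicator_of_mem (hiff.2 hg), symbol_inv hX hsa,
          Complex.conj_conj]
      · rw [Set.indicator_of_notMem hg, Set.indicator_of_notMem fun h => hg (hiff.1 h), map_zero]
    · have h1 := hasComp_bicoset hX σ₁ 1
      have h2 := hasComp_bicoset hX 1 σ₂
      have h3 := hasComp_bicoset hX σ₁ σ₂
      refine groupVN_ext (mul_mem h1.1 h2.1) h3.1 fun g => ?_
      rw [h3.2]
      by_cases hg : g ∈ bicoset (modGroup p) σ₁ σ₂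
      · rw [Set.indicator_of_mem hg]
        have h4 := hasSum_coeff_comp_mul_of_mem h1 h2
          (fun g γ hγ hg => leftCoset_mul_mem g γ hγ hg) (mem_bicoset_iff.1 hg)
        have h5 := h (g * σ₂⁻¹) σ₂
        rw [inv_mul_cancel_right] at h5
        exact h4.unique h5
      · rw [Set.indicator_of_notMem hg]
        exact coeff_comp_mul_of_notMem h1 h2 (fun g γ hγ hg => leftCoset_mul_mem g γ hγ hg)
          fun h => hg (mem_bicoset_iff.2 h)

include hX in
-- At ab, the left side of the relation for (a, b) is the convolution sum, and on the right
-- disjointness leaves the one coset that contains ab.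
theorem symbolMul_of_weakCosetRelations (h : WeakCosetRelations X) : SymbolMul X := by
  intro a b
  obtain ⟨r, hr, hr'⟩ := exists_disjoint_cover (modGroup_finite p a)
  have h1 := hasSum_coeff_comp_mul_of_mem (σ := b) (hasComp_dblCoset hX a)
    (hasComp_bicoset hX 1 b) (fun g γ hγ hg => dblCoset_mul_mem g γ hγ hg) (g := a * b) (by
      rw [mul_inv_cancel_right]; exact self_mem_dblCoset a)
  have ha : a ∈ ⋃ γ ∈ r, rightCoset (modGroup p) (a * (γ : GG p)) := hr' ▸ self_mem_dblCoset a
  simp only [Set.mem_iUnion] at ha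
  obtain ⟨γ, hγ, hg⟩ := ha
  have hiff : ∀ γ : modGroup p, a * b ∈ rightCoset (modGroup p) (a * (γ : GG p) * b) ↔
      a ∈ rightCoset (modGroup p) (a * (γ : GG p)) := by
    intro γ
    rw [mem_rightCoset_iff, mem_rightCoset_iff]
    exact iff_of_eq (congrArg (· ∈ modGroup p) (by group))
  rw [h a b r hr hr', mul_inv_cancel_right, coeff_sum, Finset.sum_eq_single γ,
    (hasComp_bicoset hX _ _).2, Set.indicator_of_mem ((hiff γ).2 hg)] at h1
  · exact h1
  · intro γ' hγ' hne
    rw [(hasComp_bicoset hX _ _).2, Set.indicator_of_notMem]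
    intro hg'
    exact Set.disjoint_left.1 (hr hγ' hγ hne) ((hiff γ').1 hg') hg
  · exact fun h => absurd hγ h

include hX in
-- As for the weak relations, the coefficient at ab is compared, now with n the level of a; on the
-- right only the coset Γab contributes.
theorem symbolMul_of_actsAsHecke (h : ActsAsHecke X) : SymbolMul X := by
  classical
  intro a b
  rcases Nat.eq_zero_or_pos (level a) with ha | ha
  -- The hypothesis says nothing for n = 0. Then a ∈ Γ and the only nonzero term is γ = a⁻¹.
  · have ha' := level_eq_zero_iff.1 ha
    have h1 := hasSum_single (f := fun γ : modGroup p =>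
      symbol X (a * γ) * symbol X ((γ : GG p)⁻¹ * b)) ⟨a⁻¹, (modGroup p).inv_mem ha'⟩ (by
      intro γ hγ
      rw [symbol_of_mem hX ((modGroup p).mul_mem ha' γ.2), zero_mul]
      exact fun h => hγ (Subtype.ext (eq_inv_of_mul_eq_one_right h)))
    simp only [mul_inv_cancel, symbol_one hX, one_mul, inv_inv] at h1
    exact h1
  · have h1 := hasSum_coeff_comp_mul_of_mem (σ := b) (hasComp_dc hX (level a))
      (hasComp_bicoset hX 1 b) (fun g γ hγ hg => dc_mul_right hγ hg) (g := a * b) (by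
        rw [mul_inv_cancel_right]; exact mem_dc_level a)
    have hcoord : ∀ x, (heckeOp (modGroup p) (sigma p (level a)) (delta (cosetMk (modGroup p) b)) :
        CosetSpace (modGroup p) → ℂ) (cosetMk _ x) =
          if level (x * b⁻¹) = level a then 1 else 0 := fun x => entry_heckeT (level a) x b
    have hfin := (modGroup_finite p a).image fun q => cosetMk (modGroup p) (q.out * b)
    -- A `finsum` over an infinite support would be zero. Here the support lies among the finitely
    -- many cosets Γxb with x ∈ ΓaΓ.
    have hsub : Function.support (fun q : CosetSpace (modGroup p) =>
        (heckeOp (modGroup p) (sigma p (level a)) (delta (cosetMk (modGroup p) b)) :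
          CosetSpace (modGroup p) → ℂ) q • comp X {g | cosetMk (modGroup p) g = q}) ⊆
        hfin.toFinset := by
      intro q hq
      obtain ⟨x, rfl⟩ := cosetMk_surjective q
      rw [Function.mem_support] at hq
      rw [Finset.mem_coe, Set.Finite.mem_toFinset]
      have hl : level (x * b⁻¹) = level a := by
        by_contra hne
        exact hq (by rw [hcoord, if_neg hne, zero_smul])
      refine ⟨cosetMk _ (x * b⁻¹), ⟨x * b⁻¹, ?_, rfl⟩, ?_⟩
      · rw [dblCoset_eq_dc (mem_dc_level a)]
        exact mem_dc_iff_level.2 hl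
      · have h2 := cosetMk_eq_iff.1 (cosetMk_out (cosetMk (modGroup p) (x * b⁻¹))).symm
        beta_reduce
        rw [eq_comm, cosetMk_eq_iff]
        convert! h2 using 1
        group
    rw [comp_dc hX, h _ _ ha, finsum_eq_sum_of_support_subset _ hsub, mul_inv_cancel_right,
      coeff_sum, Finset.sum_eq_single (cosetMk _ (a * b)), coeff_smul, hcoord,
      mul_inv_cancel_right, if_pos rfl, one_mul, (hasComp_fiber hX _).2,
      Set.indicator_of_mem (by rfl)] at h1
    · exact h1
    · intro q _ hq
      rw [coeff_smul, (hasComp_fiber hX _).2, Set.indicator_of_notMem (fun h => hq h.symm), mul_zero]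
    · intro hn
      by_contra hne
      refine hn (Finset.mem_coe.1 (hsub ?_))
      rw [Function.mem_support]
      intro h0
      rw [h0] at hne
      exact hne rfl

include hX in
-- By induction X^n equals t at level n and vanishes at higher levels. The step expands X · X^n over
-- the neighbours.
theorem symbol_eq_of_isMatrixCoeff {t : GG p → ℂ} (ht : IsMatrixCoeff (modGroup p) t)
    (hXt : ∀ g, coeff X g = (dc p 1).indicator t g) (g : GG p) : symbol X g = t g := by
  classical
  have key : ∀ (n : ℕ) (g : GG p), (level g = n → coeff (X ^ n) g = t g) ∧
      (n < level g → coeff (X ^ n) g = 0) := by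
    intro n
    induction n with
    | zero =>
      intro g
      rw [pow_zero, coeff_one]
      refine ⟨fun h => ?_, fun h => if_neg ?_⟩
      · split_ifs with h1
        · rw [h1, ht.one]
        · rw [ht.of_mem g (level_eq_zero_iff.1 h) h1]
      · rintro rfl
        rw [level_eq_zero_iff.2 (modGroup p).one_mem] at h
        omega
    | succ n ih =>
      intro g
      have hsum := hasSum_coeff_mul hX (X ^ n) g
      rw [← pow_succ'] at hsum
      constructor
      · intro hg
        -- Only the neighbour i towards the root contributes, since the others leave elements of
        -- level n + 2, where X^n vanishes. The remaining sum is the convolution identity for `nbr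
        -- i` and (`nbr i`)⁻¹ g.
        obtain ⟨i, hi, hj⟩ := exists_level_nbr_inv_mul hg
        refine hsum.unique ?_
        have hinj : Function.Injective fun γ : modGroup p => nbr i * (γ : GG p) :=
          fun γ γ' h => Subtype.ext (mul_left_cancel h)
        rw [← hinj.hasSum_iff]
        · have h1 := ht.hasSum (nbr i) ((nbr i)⁻¹ * g)
          rw [mul_inv_cancel_left] at h1
          convert! h1 using 2 with γ
          rw [Function.comp_apply, hXt, Set.indicator_of_mem, mul_inv_rev, mul_assoc,
            (ih _).1]
          · rw [level_mul_left ((modGroup p).inv_mem γ.2), hi]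
          · exact dc_mul_right γ.2 (mem_dc_iff_level.2 (level_nbr i))
        · intro h hh
          rw [hXt]
          by_cases hd : h ∈ dc p 1
          · obtain ⟨j, γ, hγ, rfl⟩ := exists_eq_nbr_mul hd
            rw [(ih _).2, mul_zero]
            rw [mul_inv_rev, mul_assoc, level_mul_left ((modGroup p).inv_mem hγ), hj]
            · omega
            · rintro rfl
              exact hh ⟨⟨γ, hγ⟩, rfl⟩
          · rw [Set.indicator_of_notMem hd, zero_mul]
      · intro hg
        refine hsum.unique ?_
        convert! hasSum_zero with h
        rw [hXt]
        by_cases hd : h ∈ dc p 1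
        · obtain ⟨j, γ, hγ, rfl⟩ := exists_eq_nbr_mul hd
          rw [(ih _).2, mul_zero]
          rw [mul_inv_rev, mul_assoc, level_mul_left ((modGroup p).inv_mem hγ)]
          obtain ⟨m, hm⟩ : ∃ m, level g = m + 1 := ⟨level g - 1, by omega⟩
          obtain ⟨i, hi, hj⟩ := exists_level_nbr_inv_mul hm
          by_cases hij : j = i
          · rw [hij, hi]; omega
          · rw [hj j hij]; omega
        · rw [Set.indicator_of_notMem hd, zero_mul]
  rw [symbol_eq hX]
  exact (key _ g).1 rfl

include hX in
theorem comesFromRep_iff (hsa : IsSelfAdjoint X) (hsupp : ∀ g, g ∉ dc p 1 → coeff X g = 0) :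
    ComesFromRep (modGroup p) (dc p 1) X ↔ SymbolMul X := by
  constructor
  · rintro ⟨H, i1, i2, i3, π, U, hU, hXt⟩
    have ht := isMatrixCoeff_of_rep π U hU
    have h := symbol_eq_of_isMatrixCoeff hX ht hXt
    intro a b
    simp only [h]
    exact ht.hasSum a b
  · intro h
    refine (isMatrixCoeff_symbol hX hsa h).comesFromRep fun g => ?_
    by_cases hg : g ∈ dc p 1
    · rw [Set.indicator_of_mem hg, symbol_eq hX, mem_dc_iff_level.1 hg, pow_one]
    · rw [Set.indicator_of_notMem hg, hsupp g hg]

end Symbol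

/-! ### Conditional expectations -/

section CondExp

variable {G : Type} [Group G] {Γ : Subgroup G}

theorem inner_permOp {ι : Type} (e : ι ≃ ι) (v w : L2 ι) :
    inner ℂ (permOp e v) (permOp e w) = inner ℂ v w := by
  refine (hasSum_inner_coord _ _).unique ?_
  have h := hasSum_inner_coord v w
  rw [← e.hasSum_iff] at h
  exact h

theorem inner_restrictCLM {ι : Type} (A : Set ι) (v w : L2 ι) :
    inner ℂ (restrictCLM A v) w = inner ℂ v (restrictCLM A w) := by
  refine (hasSum_inner_coord _ _).unique ?_
  convert! hasSum_inner_coord v (restrictCLM A w) using 2 with i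
  rw [coord_restrictCLM, coord_restrictCLM]
  by_cases h : i ∈ A
  · rw [Set.indicator_of_mem h, Set.indicator_of_mem h]
  · rw [Set.indicator_of_notMem h, Set.indicator_of_notMem h, map_zero, zero_mul, mul_zero]

theorem restrictCLM_idem {ι : Type} (A : Set ι) (v : L2 ι) :
    restrictCLM A (restrictCLM A v) = restrictCLM A v :=
  coord_ext fun i => by
    rw [coord_restrictCLM, coord_restrictCLM]
    by_cases h : i ∈ A
    · rw [Set.indicator_of_mem h, coord_restrictCLM]
    · rw [Set.indicator_of_notMem h, Set.indicator_of_notMem h]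

/-- The projection onto `ℓ²` of a coset `Γ x`. -/
def cosetProj (q : CosetSpace Γ) : BL2 G := restrictCLM {g | cosetMk Γ g = q}

theorem bicoset_one_one : bicoset Γ 1 1 = (Γ : Set G) := by
  ext g
  simp [bicoset]

theorem entry_condExp {b : BL2 G} (hb : b ∈ groupVN G) (g h : G) :
    entry (condExp Γ b) g h = (Γ : Set G).indicator (coeff b) (g * h⁻¹) := by
  have := projOn_bicoset_spec Γ hb 1 1
  rw [bicoset_one_one] at this
  exact this g h

theorem condExp_mem {b : BL2 G} (hb : b ∈ groupVN G) : condExp Γ b ∈ vnOf Γ :=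
  mem_vnOf_of_entry (entry_condExp hb) fun _ hg => Set.indicator_of_notMem hg _

theorem coeff_condExp {b : BL2 G} (hb : b ∈ groupVN G) (g : G) :
    coeff (condExp Γ b) g = (Γ : Set G).indicator (coeff b) g :=
  coeff_of_entry (entry_condExp hb) g

theorem vnOf_ext {x y : BL2 G} (hx : x ∈ vnOf Γ) (hy : y ∈ vnOf Γ)
    (h : ∀ g ∈ Γ, coeff x g = coeff y g) : x = y := by
  refine groupVN_ext (vnOf_le_groupVN Γ hx) (vnOf_le_groupVN Γ hy) fun g => ?_
  by_cases hg : g ∈ Γ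
  · exact h g hg
  · rw [coeff_eq_zero_of_mem_vnOf hx hg, coeff_eq_zero_of_mem_vnOf hy hg]

theorem condExp_of_mem {b : BL2 G} (hb : b ∈ vnOf Γ) : condExp Γ b = b :=
  vnOf_ext (condExp_mem (vnOf_le_groupVN Γ hb)) hb fun g hg => by
    rw [coeff_condExp (vnOf_le_groupVN Γ hb), Set.indicator_of_mem (by exact hg)]

theorem condExp_add {a b : BL2 G} (ha : a ∈ groupVN G) (hb : b ∈ groupVN G) :
    condExp Γ (a + b) = condExp Γ a + condExp Γ b :=
  vnOf_ext (condExp_mem (add_mem ha hb)) (add_mem (condExp_mem ha) (condExp_mem hb)) fun g hg => by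
    rw [coeff_add, coeff_condExp ha, coeff_condExp hb, coeff_condExp (add_mem ha hb),
      Set.indicator_of_mem (by exact hg), Set.indicator_of_mem (by exact hg),
      Set.indicator_of_mem (by exact hg), coeff_add]

theorem condExp_smul (c : ℂ) {a : BL2 G} (ha : a ∈ groupVN G) :
    condExp Γ (c • a) = c • condExp Γ a :=
  vnOf_ext (condExp_mem (SMulMemClass.smul_mem c ha))
    (SMulMemClass.smul_mem c (condExp_mem ha)) fun g hg => by
    rw [coeff_smul, coeff_condExp ha, coeff_condExp (SMulMemClass.smul_mem c ha),
      Set.indicator_of_mem (by exact hg), Set.indicator_of_mem (by exact hg), coeff_smul]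

/-- The entry at (g, k) survives exactly when gk⁻¹ ∈ Γ, that is Γg = Γk: E(b) is the block diagonal
part of b. -/
theorem coord_condExp {b : BL2 G} (hb : b ∈ groupVN G) (v : L2 G) (g : G) :
    coord (condExp Γ b v) g = coord (b (cosetProj (cosetMk Γ g) v)) g := by
  refine (hasSum_coord_apply _ _ _).unique ?_
  convert! hasSum_coord_apply b (cosetProj (cosetMk Γ g) v) g using 2 with k
  rw [entry_condExp hb, entry_of_mem_groupVN hb, cosetProj, coord_restrictCLM]
  have hiff : g * k⁻¹ ∈ (Γ : Set G) ↔ k ∈ {k | cosetMk Γ k = cosetMk Γ g} := by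
    rw [Set.mem_ofPred_eq, cosetMk_eq_iff]; rfl
  by_cases h : g * k⁻¹ ∈ (Γ : Set G)
  · rw [Set.indicator_of_mem h, Set.indicator_of_mem (hiff.1 h)]
  · rw [Set.indicator_of_notMem h, Set.indicator_of_notMem fun h' => h (hiff.2 h'), zero_mul,
      mul_zero]

theorem hasSum_inner_condExp {b : BL2 G} (hb : b ∈ groupVN G) (v w : L2 G) :
    HasSum (fun q : CosetSpace Γ => inner ℂ (cosetProj q v) (b (cosetProj q w)))
      (inner ℂ v (condExp Γ b w)) := by
  have h := hasSum_inner_coord v (condExp Γ b w)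
  rw [← (Equiv.sigmaFiberEquiv (cosetMk Γ)).hasSum_iff] at h
  refine h.sigma fun q => ?_
  have h1 := hasSum_inner_coord (cosetProj q v) (b (cosetProj q w))
  have h2 : (fun i => (starRingEnd ℂ) (coord (cosetProj q v) i) *
      coord (b (cosetProj q w)) i) = Set.indicator {g | cosetMk Γ g = q}
        (fun i => (starRingEnd ℂ) (coord v i) * coord (b (cosetProj q w)) i) := by
    funext i
    rw [cosetProj, coord_restrictCLM]
    by_cases hi : i ∈ {g | cosetMk Γ g = q}
    · rw [Set.indicator_of_mem hi, Set.indicator_of_mem hi]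
    · rw [Set.indicator_of_notMem hi, Set.indicator_of_notMem hi, map_zero, zero_mul]
  rw [h2, ← hasSum_subtype_iff_indicator] at h1
  convert! h1 using 2
  rename_i i
  obtain ⟨i, rfl⟩ := i
  change _ * coord (condExp Γ b w) i = _
  rw [coord_condExp hb]
  rfl

/-- Left translations by Γ preserve every Γx, so the projection lies in the commutant of λ(Γ). -/
theorem cosetProj_comm {a : BL2 G} (ha : a ∈ vnOf Γ) (q : CosetSpace Γ) :
    cosetProj q * a = a * cosetProj q := by
  refine mem_vnOf_iff.1 ha _ fun γ hγ => ?_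
  refine ContinuousLinearMap.ext fun v => coord_ext fun i => ?_
  change coord (leftReg γ (cosetProj q v)) i = coord (cosetProj q (leftReg γ v)) i
  rw [cosetProj, coord_leftReg, coord_restrictCLM, coord_restrictCLM]
  have hiff : γ⁻¹ * i ∈ {g | cosetMk Γ g = q} ↔ i ∈ {g | cosetMk Γ g = q} := by
    rw [Set.mem_ofPred_eq, Set.mem_ofPred_eq, cosetMk_mul_left (Γ.inv_mem hγ)]
  by_cases h : i ∈ {g | cosetMk Γ g = q}
  · rw [Set.indicator_of_mem h, Set.indicator_of_mem (hiff.2 h), coord_leftReg]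
  · rw [Set.indicator_of_notMem h, Set.indicator_of_notMem fun h' => h (hiff.1 h')]

/-- The right translation by `h`. -/
def rightReg (h : G) : BL2 G := permOp (Equiv.mulRight h⁻¹)

theorem coord_rightReg (h : G) (v : L2 G) (g : G) : coord (rightReg h v) g = coord v (g * h⁻¹) :=
  rfl

theorem rightReg_comm {a : BL2 G} (ha : a ∈ groupVN G) (h : G) :
    rightReg h * a = a * rightReg h := by
  refine mem_vnOf_iff.1 ha _ fun k _ => ?_
  refine ContinuousLinearMap.ext fun v => coord_ext fun l => ?_
  change coord v (k⁻¹ * l * h⁻¹) = coord v (k⁻¹ * (l * h⁻¹))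
  rw [mul_assoc]

theorem inner_rightReg (h : G) (v w : L2 G) :
    inner ℂ (rightReg h v) (rightReg h w) = inner ℂ v w := inner_permOp _ v w

theorem orthonormal_delta_inv (Γ : Subgroup G) :
    Orthonormal ℂ fun γ : Γ => (delta (γ : G)⁻¹ : L2 G) := by
  classical
  rw [orthonormal_iff_ite]
  intro γ γ'
  rw [inner_delta_left, coord_delta]
  simp

/-- The map `δ_γ ↦ δ_{γ⁻¹}` from `ℓ²(Γ)` to `ℓ²(G)`. -/
def flipEmb (Γ : Subgroup G) : L2 Γ →L[ℂ] L2 G := orthoMap (orthonormal_delta_inv Γ)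

theorem flipEmb_delta (γ : Γ) : flipEmb Γ (delta γ) = delta (γ : G)⁻¹ := orthoMap_delta _ γ

theorem adjoint_flipEmb_apply (w : L2 G) (γ : Γ) :
    coord (ContinuousLinearMap.adjoint (flipEmb Γ) w) γ = coord w (γ : G)⁻¹ := by
  rw [← inner_delta_left, ContinuousLinearMap.adjoint_inner_right, flipEmb_delta, inner_delta_left]

theorem coord_flipEmb_inv (v : L2 Γ) (γ : Γ) : coord (flipEmb Γ v) (γ : G)⁻¹ = coord v γ := by
  rw [← adjoint_flipEmb_apply]
  exact congrArg (fun w => coord w γ) (DFunLike.congr_fun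
    ((ContinuousLinearMap.isometry_iff_adjoint_comp_self _).1 (LinearIsometry.isometry _)) v)

theorem coord_flipEmb_of_notMem (v : L2 Γ) {g : G} (hg : g ∉ Γ) : coord (flipEmb Γ v) g = 0 := by
  classical
  rw [← inner_delta_left, ← ContinuousLinearMap.adjoint_inner_left]
  have : ContinuousLinearMap.adjoint (flipEmb Γ) (delta g) = 0 := coord_ext fun γ => by
    rw [adjoint_flipEmb_apply, coord_delta, if_neg, coord_zero]
    intro h
    exact hg (h ▸ Γ.inv_mem γ.2)
  rw [this, inner_zero_left]

/-- The compression of an operator on `ℓ²(G)` to `ℓ²(Γ)`, by means of `δ_γ ↦ δ_{γ⁻¹}`. -/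
def compress (Γ : Subgroup G) : BL2 G →ₗ[ℂ] BL2 Γ where
  toFun a := ContinuousLinearMap.adjoint (flipEmb Γ) ∘L a ∘L flipEmb Γ
  map_add' a b := by
    rw [ContinuousLinearMap.add_comp, ContinuousLinearMap.comp_add]
  map_smul' c a := by
    rw [ContinuousLinearMap.smul_comp, ContinuousLinearMap.comp_smul, RingHom.id_apply]

theorem inner_compress (a : BL2 G) (v w : L2 Γ) :
    inner ℂ v (compress Γ a w) = inner ℂ (flipEmb Γ v) (a (flipEmb Γ w)) := by
  rw [← ContinuousLinearMap.adjoint_inner_right]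
  rfl

theorem entry_compress {a : BL2 G} (ha : a ∈ groupVN G) (γ γ' : Γ) :
    entry (compress Γ a) γ γ' = coeff a ((γ : G)⁻¹ * γ') := by
  rw [← coord_apply_delta, ← inner_delta_left, inner_compress, flipEmb_delta, flipEmb_delta,
    inner_delta_left, coord_apply_delta, entry_of_mem_groupVN ha, inv_inv]

/-- The first row of the compressed matrix lists the coefficients on Γ. Identities in L(Γ) may
therefore be checked after compression. -/
theorem compress_injOn : Set.InjOn (compress Γ) (vnOf Γ : Set (BL2 G)) := fun a ha b hb h =>
  vnOf_ext ha hb fun g hg => by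
    have := congrArg (fun T => entry T 1 ⟨g, hg⟩) h
    simpa [entry_compress (vnOf_le_groupVN Γ ha), entry_compress (vnOf_le_groupVN Γ hb)] using this

end CondExp

/-! ### Conditional expectations as Hecke operators on intertwiners -/

section Compression

variable {G : Type} [Group G] {Γ : Subgroup G} {t : G → ℂ} (ht : IsMatrixCoeff Γ t)

/-- The operator `π(g)* T π(g)`. -/
def conjOp (T : BL2 Γ) (g : G) : BL2 Γ := star (ht.op g) * T * ht.op g

theorem conjOp_mul (T : BL2 Γ) (g h : G) :
    conjOp ht T (g * h) = star (ht.op h) * conjOp ht T g * ht.op h := by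
  rw [conjOp, conjOp, ht.op_mul, star_mul]
  simp only [mul_assoc]

/-- The entries a(γ₁⁻¹γ₂) are invariant under simultaneous left translation, so the compression
commutes with π(γ) = λ(γ). -/
theorem conjOp_compress {a : BL2 G} (ha : a ∈ groupVN G) {γ : G} (hγ : γ ∈ Γ) :
    conjOp ht (compress Γ a) γ = compress Γ a := by
  refine entry_ext fun γ₁ γ₂ => ?_
  obtain ⟨γ, rfl⟩ : ∃ γ' : Γ, (γ' : G) = γ := ⟨⟨γ, hγ⟩, rfl⟩
  rw [← coord_apply_delta, ← inner_delta_left]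
  change inner ℂ (delta γ₁) (star (ht.op γ) (compress Γ a (ht.op γ (delta γ₂)))) = _
  rw [ContinuousLinearMap.star_eq_adjoint, ContinuousLinearMap.adjoint_inner_right, ht.op_coe,
    leftReg_delta, leftReg_delta, inner_delta_left, coord_apply_delta, entry_compress ha,
    entry_compress ha]
  congr 1
  push_cast
  group

theorem conjOp_compress_mul {a : BL2 G} (ha : a ∈ groupVN G) {γ : G} (hγ : γ ∈ Γ) (g : G) :
    conjOp ht (compress Γ a) (γ * g) = conjOp ht (compress Γ a) g := by
  rw [conjOp_mul, conjOp_compress ht ha hγ]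
  rfl

/-- The part in the coset of `r` of the vector `b δ_{γ⁻¹}`. -/
theorem rightReg_flipEmb_vec {b : BL2 G} (hb : b ∈ groupVN G) {C : Set G}
    (hC : ∀ g, coeff b g = C.indicator t g) (hl : ∀ γ ∈ Γ, ∀ g, γ * g ∈ C ↔ g ∈ C)
    (hr : ∀ γ ∈ Γ, ∀ g, g * γ ∈ C ↔ g ∈ C) {r : G} (hrC : r ∈ C) (γ : Γ) :
    rightReg r (flipEmb Γ (ht.vec (r * γ))) =
      cosetProj (cosetMk Γ r) (b (delta (γ : G)⁻¹)) := by
  refine coord_ext fun k => ?_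
  rw [coord_rightReg, cosetProj, coord_restrictCLM]
  have hiff : k ∈ {k | cosetMk Γ k = cosetMk Γ r} ↔ k * r⁻¹ ∈ Γ := by
    rw [Set.mem_ofPred_eq, eq_comm, cosetMk_eq_iff]
  by_cases h : k * r⁻¹ ∈ Γ
  · rw [Set.indicator_of_mem (hiff.2 h), coord_apply_delta, entry_of_mem_groupVN hb, hC, inv_inv,
      Set.indicator_of_mem]
    · have := coord_flipEmb_inv (ht.vec (r * γ)) ⟨(k * r⁻¹)⁻¹, Γ.inv_mem h⟩
      rw [inv_inv, ht.coord_vec] at this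
      rw [this]
      congr 1
      simp only [inv_inv]
      group
    · rw [hr γ γ.2, ← inv_mul_cancel_right k r, hl _ h]
      exact hrC
  · rw [Set.indicator_of_notMem fun h' => h (hiff.1 h'), coord_flipEmb_of_notMem _ h]

theorem sum_cosetProj {C : Set G} (S : Finset (CosetSpace Γ))
    (hS : ∀ g, cosetMk Γ g ∈ S ↔ g ∈ C) {w : L2 G} (hw : ∀ g, g ∉ C → coord w g = 0) :
    ∑ q ∈ S, cosetProj q w = w := by
  classical
  refine coord_ext fun k => ?_
  rw [coord_sum]
  have : ∀ q, coord (cosetProj q w) k = if cosetMk Γ k = q then coord w k else 0 := fun q => by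
    rw [cosetProj, coord_restrictCLM]
    by_cases h : cosetMk Γ k = q
    · rw [if_pos h]
      exact Set.indicator_of_mem (show k ∈ {g | cosetMk Γ g = q} from h) _
    · rw [if_neg h]
      exact Set.indicator_of_notMem (show k ∉ {g | cosetMk Γ g = q} from h) _
  simp only [this]
  rw [Finset.sum_ite_eq]
  split_ifs with h
  · rfl
  · exact (hw k fun hk => h ((hS k).2 hk)).symm

/-- The entry at (γ₁, γ₂) is ⟨b δ_{γ₁⁻¹}, a b δ_{γ₂⁻¹}⟩. It splits along the cosets Γr, each
preserved by a, and right translation by r identifies the flip of π(r)δ_γ with the part of b δ_{γ⁻¹}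
in Γr (`rightReg_flipEmb_vec`). -/
theorem compress_condExp {a b : BL2 G} (ha : a ∈ vnOf Γ) (hb : b ∈ groupVN G)
    (hsb : IsSelfAdjoint b) {C : Set G}
    (hC : ∀ g, coeff b g = C.indicator t g) (hl : ∀ γ ∈ Γ, ∀ g, γ * g ∈ C ↔ g ∈ C)
    (hr : ∀ γ ∈ Γ, ∀ g, g * γ ∈ C ↔ g ∈ C)
    (S : Finset (CosetSpace Γ)) (hS : ∀ g, cosetMk Γ g ∈ S ↔ g ∈ C) :
    compress Γ (condExp Γ (b * a * b)) = ∑ q ∈ S, conjOp ht (compress Γ a) q.out := by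
  have haG := vnOf_le_groupVN Γ ha
  have hbab : b * a * b ∈ groupVN G := mul_mem (mul_mem hb haG) hb
  refine entry_ext fun γ₁ γ₂ => ?_
  rw [entry_compress (vnOf_le_groupVN Γ (condExp_mem hbab)), coeff_condExp hbab,
    Set.indicator_of_mem (show (γ₁ : G)⁻¹ * γ₂ ∈ (Γ : Set G) from (γ₁⁻¹ * γ₂).2), entry_sum]
  have h1 : coeff (b * a * b) ((γ₁ : G)⁻¹ * γ₂) =
      inner ℂ (b (delta (γ₁ : G)⁻¹)) (a (b (delta (γ₂ : G)⁻¹))) := by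
    have := entry_of_mem_groupVN hbab (γ₁ : G)⁻¹ (γ₂ : G)⁻¹
    rw [inv_inv] at this
    rw [← this, ← coord_apply_delta, ← inner_delta_left]
    change inner ℂ (delta (γ₁ : G)⁻¹) (b (a (b (delta (γ₂ : G)⁻¹)))) = _
    conv_lhs => rw [← hsb.star_eq]
    rw [ContinuousLinearMap.star_eq_adjoint, ContinuousLinearMap.adjoint_inner_right,
      ← ContinuousLinearMap.star_eq_adjoint, hsb.star_eq]
  have hw : ∀ γ : Γ, ∀ g, g ∉ C → coord (b (delta (γ : G)⁻¹)) g = 0 := fun γ g hg => by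
    rw [coord_apply_delta, entry_of_mem_groupVN hb, hC, inv_inv,
      Set.indicator_of_notMem fun h => hg ((hr γ γ.2 g).1 h)]
  have h2 : ∀ q ∈ S, entry (conjOp ht (compress Γ a) q.out) γ₁ γ₂ =
      inner ℂ (b (delta (γ₁ : G)⁻¹)) (a (cosetProj q (b (delta (γ₂ : G)⁻¹)))) := by
    intro q hq
    have hqC : q.out ∈ C := by rwa [← hS, cosetMk_out]
    rw [← coord_apply_delta, ← inner_delta_left]
    change inner ℂ (delta γ₁) (star (ht.op q.out) (compress Γ a (ht.op q.out (delta γ₂)))) = _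
    rw [ContinuousLinearMap.star_eq_adjoint, ContinuousLinearMap.adjoint_inner_right, ht.op_delta,
      ht.op_delta, inner_compress, ← inner_rightReg q.out]
    have h3 : ∀ v, rightReg q.out (a v) = a (rightReg q.out v) := fun v =>
      DFunLike.congr_fun (rightReg_comm haG q.out) v
    rw [h3, rightReg_flipEmb_vec ht hb hC hl hr hqC, rightReg_flipEmb_vec ht hb hC hl hr hqC,
      cosetMk_out]
    have h4 : ∀ v, cosetProj q (a v) = a (cosetProj q v) := fun v =>
      DFunLike.congr_fun (cosetProj_comm ha q) v
    rw [← h4, cosetProj, inner_restrictCLM, restrictCLM_idem]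
  rw [Finset.sum_congr rfl h2, h1, ← inner_sum, ← map_sum, sum_cosetProj S hS (hw γ₂)]

/-- The maps `a ↦ E(b a b)` are completely positive. -/
theorem posMatrix_condExp {n : ℕ} {M : Matrix (Fin n) (Fin n) (BL2 G)}
    (hM : ∀ i j, M i j ∈ groupVN G) (h : PosMatrix M) {b : BL2 G} (hb : b ∈ groupVN G)
    (hsb : IsSelfAdjoint b) : PosMatrix (M.map fun a => condExp Γ (b * a * b)) := by
  intro ξ
  -- The quadratic form splits over the cosets q, and each summand is the form of M at the vectors b
  -- P_q ξ_i.
  have h1 : HasSum (fun q : CosetSpace Γ => ∑ i, ∑ j,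
      inner ℂ (cosetProj q (ξ i)) ((b * M i j * b) (cosetProj q (ξ j))))
      (∑ i, ∑ j, inner ℂ (ξ i) (condExp Γ (b * M i j * b) (ξ j))) :=
    hasSum_sum fun i _ => hasSum_sum fun j _ =>
      hasSum_inner_condExp (mul_mem (mul_mem hb (hM i j)) hb) _ _
  refine h1.nonneg fun q => ?_
  convert h fun i => b (cosetProj q (ξ i)) using 1
  refine Finset.sum_congr rfl fun i _ => Finset.sum_congr rfl fun j _ => ?_
  change inner ℂ (cosetProj q (ξ i)) (b (M i j (b (cosetProj q (ξ j))))) = _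
  conv_lhs => rw [← hsb.star_eq]
  rw [ContinuousLinearMap.star_eq_adjoint, ContinuousLinearMap.adjoint_inner_right,
    ← ContinuousLinearMap.star_eq_adjoint, hsb.star_eq]

end Compression

/-! ### Sums over the cosets of a given level -/

section Counting

variable {p : ℕ} [Fact p.Prime]

/-- The cosets contained in `Γ σ_{p^n} Γ`. -/
def levelCosets (p : ℕ) [Fact p.Prime] (n : ℕ) : Finset (CosetSpace (modGroup p)) :=
  (modGroup_finite p (sigma p n)).toFinset

theorem cosetMk_mem_levelCosets {n : ℕ} {g : GG p} :
    cosetMk (modGroup p) g ∈ levelCosets p n ↔ level g = n := by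
  rw [levelCosets, Set.Finite.mem_toFinset, ← mem_dc_iff_level]
  constructor
  · rintro ⟨x, hx, h⟩
    have := dc_mul_left (cosetMk_eq_iff.1 h.symm) (g := g) (n := n)
    have h1 := dc_mul_left (cosetMk_eq_iff.1 h) hx
    rwa [inv_mul_cancel_right] at h1
  · exact fun h => ⟨g, h, rfl⟩

theorem mem_levelCosets {n : ℕ} {q : CosetSpace (modGroup p)} :
    q ∈ levelCosets p n ↔ level q.out = n := by
  rw [← cosetMk_mem_levelCosets, cosetMk_out]

/-- This makes the choice of the representatives `q.out` immaterial. -/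
theorem apply_out {G : Type} [Group G] {Γ : Subgroup G} {M : Type*} {F : G → M}
    (hF : ∀ γ ∈ Γ, ∀ g, F (γ * g) = F g) (g : G) : F (cosetMk Γ g).out = F g := by
  have h := cosetMk_eq_iff.1 (cosetMk_out (cosetMk Γ g)).symm
  rw [← hF _ h g, inv_mul_cancel_right]

theorem cosetMk_out_mul {G : Type} [Group G] {Γ : Subgroup G} (g x : G) :
    cosetMk Γ ((cosetMk Γ g).out * x) = cosetMk Γ (g * x) :=
  apply_out (F := fun g => cosetMk Γ (g * x))
    (fun γ hγ g => by rw [mul_assoc, cosetMk_mul_left hγ]) g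

theorem level_out_mul (g x : GG p) :
    level ((cosetMk (modGroup p) g).out * x) = level (g * x) :=
  apply_out (F := fun g => level (g * x))
    (fun γ hγ g => by rw [mul_assoc, level_mul_left hγ]) g

variable {M : Type*} [AddCommGroup M] {F : GG p → M}

theorem sum_levelCosets_one (hF : ∀ γ ∈ modGroup p, ∀ g, F (γ * g) = F g) :
    ∑ q ∈ levelCosets p 1, F q.out = ∑ i : Option (Fin p), F (nbr i)⁻¹ := by
  symm
  refine Finset.sum_nbij (fun i => cosetMk (modGroup p) (nbr i)⁻¹) (fun i _ => ?_)
    (fun i _ j _ h => ?_) (fun q hq => ?_) fun i _ => (apply_out hF _).symm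
  · rw [cosetMk_mem_levelCosets, level_inv, level_nbr]
  · have := cosetMk_eq_iff.1 h
    rw [inv_inv] at this
    exact (nbr_injective_mod this).symm
  · have hq' := mem_levelCosets.1 hq
    rw [← level_inv] at hq'
    obtain ⟨i, γ, hγ, h⟩ := exists_eq_nbr_mul (mem_dc_iff_level.2 hq')
    refine ⟨i, Finset.mem_coe.2 (Finset.mem_univ i), ?_⟩
    rw [← cosetMk_out q]
    refine cosetMk_eq_iff.2 ?_
    rw [← inv_inv q.out, h, inv_inv, mul_inv_rev, inv_mul_cancel_right]
    exact inv_mem hγ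

/-- Substitution Γg ↦ Γgx⁻¹. The index set S may be any finite set containing the relevant cosets,
so that one S serves several x and sums can be interchanged. -/
theorem sum_levelCosets_mul (hF : ∀ γ ∈ modGroup p, ∀ g, F (γ * g) = F g) (m : ℕ) (x : GG p)
    (S : Finset (CosetSpace (modGroup p)))
    (hS : ∀ g : GG p, level (g * x) = m → cosetMk (modGroup p) g ∈ S) :
    ∑ q ∈ levelCosets p m, F (q.out * x⁻¹) =
      ∑ q ∈ S, if level (q.out * x) = m then F q.out else 0 := by
  rw [← Finset.sum_filter]
  refine Finset.sum_nbij' (fun q => cosetMk (modGroup p) (q.out * x⁻¹))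
    (fun q => cosetMk (modGroup p) (q.out * x)) (fun q hq => ?_) (fun q hq => ?_) (fun q _ => ?_)
    (fun q _ => ?_) fun q _ => (apply_out hF _).symm
  · have hl : level (q.out * x⁻¹ * x) = m := by
      rw [inv_mul_cancel_right]
      exact mem_levelCosets.1 hq
    rw [Finset.mem_filter]
    exact ⟨hS _ hl, by rw [level_out_mul, hl]⟩
  · rw [cosetMk_mem_levelCosets]
    exact (Finset.mem_filter.1 hq).2
  · rw [cosetMk_out_mul, inv_mul_cancel_right, cosetMk_out]
  · rw [cosetMk_out_mul, mul_inv_cancel_right, cosetMk_out]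

/-- After the substitution, each F(g) is counted once for every i with `g * nbr i` of level n + 1.
By inversion this is the neighbour count of `card_filter_level_eq` for g⁻¹. -/
theorem sum_nbr_sum_levelCosets [Module ℂ M] (hF : ∀ γ ∈ modGroup p, ∀ g, F (γ * g) = F g)
    (n : ℕ) :
    ∑ i : Option (Fin p), ∑ q ∈ levelCosets p (n + 1), F (q.out * (nbr i)⁻¹) =
      ∑ q ∈ levelCosets p (n + 2), F q.out + recCoeff p n • ∑ q ∈ levelCosets p n, F q.out := by
  classical
  have hinv : ∀ (g : GG p) (i : Option (Fin p)), level ((nbr i)⁻¹ * g⁻¹) = level (g * nbr i) :=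
    fun g i => by rw [← mul_inv_rev, level_inv]
  have hcard : ∀ g : GG p, (Finset.card {i | level (g * nbr i) = n + 1} : ℂ) =
      (if level g = n + 2 then 1 else 0) + recCoeff p n * if level g = n then 1 else 0 :=
    fun g => by
      have := card_filter_level_eq g⁻¹ n
      simpa only [hinv, level_inv] using this
  -- A neighbour count that vanishes off the levels n + 2 and n shows that no other coset occurs.
  have hS : ∀ (i : Option (Fin p)) (g : GG p), level (g * nbr i) = n + 1 →
      cosetMk (modGroup p) g ∈ levelCosets p (n + 2) ∪ levelCosets p n := by
    intro i g h
    rw [Finset.mem_union, cosetMk_mem_levelCosets, cosetMk_mem_levelCosets]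
    by_contra hne
    rw [not_or] at hne
    have := hcard g
    rw [if_neg hne.1, if_neg hne.2, mul_zero, add_zero, Nat.cast_eq_zero, Finset.card_eq_zero,
      Finset.filter_eq_empty_iff] at this
    exact this (Finset.mem_univ i) h
  have hdisj : Disjoint (levelCosets p (n + 2)) (levelCosets p n) := by
    rw [Finset.disjoint_left]
    intro q h1 h2
    rw [mem_levelCosets] at h1 h2
    omega
  rw [Finset.sum_congr rfl fun i _ => sum_levelCosets_mul hF (n + 1) (nbr i) _ (hS i),
    Finset.sum_comm, Finset.sum_union hdisj, Finset.smul_sum]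
  have key : ∀ q : CosetSpace (modGroup p),
      (∑ i : Option (Fin p), if level (q.out * nbr i) = n + 1 then F q.out else 0) =
        ((if level q.out = n + 2 then 1 else 0) +
          recCoeff p n * if level q.out = n then 1 else 0 : ℂ) • F q.out := fun q => by
    rw [← hcard, ← Finset.sum_filter, Finset.sum_const, Nat.cast_smul_eq_nsmul]
  congr 1
  · refine Finset.sum_congr rfl fun q hq => ?_
    rw [mem_levelCosets] at hq
    rw [key, if_pos hq, if_neg (by omega), mul_zero, add_zero, one_smul]
  · refine Finset.sum_congr rfl fun q hq => ?_
    rw [mem_levelCosets] at hq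
    rw [key, if_neg (by omega), if_pos hq, mul_one, zero_add]

end Counting

/-! ### The Hecke operators on `L(Γ)` -/

section Psi

variable {p : ℕ} [Fact p.Prime] {X : BL2 (GG p)} (hX : X ∈ groupVN (GG p))

include hX in
theorem powComp_mul_mul_mem (n : ℕ) (a : vnOf (modGroup p)) :
    powComp X n * (a : BL2 (GG p)) * powComp X n ∈ groupVN (GG p) :=
  mul_mem (mul_mem (powComp_mem hX n) (vnOf_le_groupVN _ a.2)) (powComp_mem hX n)

include hX in
theorem isSelfAdjoint_powComp (hsa : IsSelfAdjoint X) (n : ℕ) : IsSelfAdjoint (powComp X n) := by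
  refine groupVN_ext (star_mem (powComp_mem hX n)) (powComp_mem hX n) fun g => ?_
  rw [coeff_star (powComp_mem hX n), coeff_powComp hX, coeff_powComp hX]
  by_cases h : g ∈ dc p n
  · rw [Set.indicator_of_mem h, Set.indicator_of_mem (inv_mem_dc_iff.2 h), symbol_inv hX hsa,
      RCLike.conj_conj]
  · rw [Set.indicator_of_notMem h, Set.indicator_of_notMem fun h' => h (inv_mem_dc_iff.1 h'),
      map_zero]

/-- The map `a ↦ E(X_n a X_n)` on `L(Γ)`. -/
def psi (n : ℕ) : Module.End ℂ (vnOf (modGroup p)) where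
  toFun a := ⟨condExp (modGroup p) (powComp X n * a * powComp X n),
    condExp_mem (powComp_mul_mul_mem hX n a)⟩
  map_add' a b := Subtype.ext (by
    change condExp (modGroup p) (powComp X n * ((a : BL2 (GG p)) + b) * powComp X n) =
      condExp (modGroup p) (powComp X n * a * powComp X n) +
        condExp (modGroup p) (powComp X n * b * powComp X n)
    rw [mul_add, add_mul, condExp_add (powComp_mul_mul_mem hX n a) (powComp_mul_mul_mem hX n b)])
  map_smul' c a := Subtype.ext (by
    change condExp (modGroup p) (powComp X n * (c • (a : BL2 (GG p))) * powComp X n) =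
      c • condExp (modGroup p) (powComp X n * a * powComp X n)
    rw [mul_smul_comm, smul_mul_assoc, condExp_smul c (powComp_mul_mul_mem hX n a)])

theorem coe_psi (n : ℕ) (a : vnOf (modGroup p)) : (psi hX n a : BL2 (GG p)) =
    condExp (modGroup p) (powComp X n * (a : BL2 (GG p)) * powComp X n) := rfl

theorem isCP_psi (hsa : IsSelfAdjoint X) (n : ℕ) : IsCP (psi hX n) := by
  intro m M hM
  exact posMatrix_condExp (fun i j => vnOf_le_groupVN _ (M i j).2) hM (powComp_mem hX n)
    (isSelfAdjoint_powComp hX hsa n)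

variable (hsa : IsSelfAdjoint X) (h : SymbolMul X)

theorem compress_psi (n : ℕ) (a : vnOf (modGroup p)) :
    compress (modGroup p) (psi hX n a : BL2 (GG p)) = ∑ q ∈ levelCosets p n,
      conjOp (isMatrixCoeff_symbol hX hsa h) (compress (modGroup p) (a : BL2 (GG p))) q.out :=
  compress_condExp _ a.2 (powComp_mem hX n) (isSelfAdjoint_powComp hX hsa n)
    (coeff_powComp hX n) (fun _ hγ _ => dc_mul_left_iff hγ) (fun _ hγ _ => dc_mul_right_iff hγ) _
    fun _ => cosetMk_mem_levelCosets.trans mem_dc_iff_level.symm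

include hX in
theorem powComp_zero : powComp X 0 = 1 := by
  classical
  refine groupVN_ext (powComp_mem hX 0) (one_mem _) fun g => ?_
  rw [coeff_powComp hX, coeff_one]
  by_cases h : g ∈ modGroup p
  · rw [Set.indicator_of_mem (mem_dc_zero_iff.2 h)]
    split_ifs with hg
    · rw [hg, symbol_one hX]
    · exact symbol_of_mem hX h hg
  · rw [Set.indicator_of_notMem fun h' => h (mem_dc_zero_iff.1 h'),
      if_neg (by rintro rfl; exact h (one_mem _))]

theorem psi_zero : psi hX 0 = 1 :=
  LinearMap.ext fun a => Subtype.ext (by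
    rw [coe_psi, powComp_zero hX, one_mul, mul_one, condExp_of_mem a.2]
    rfl)

include hsa h in
-- After compression the composite is the double sum of π(q r)* T π(q r) over cosets of levels n + 1
-- and 1, where r = (`nbr i`)⁻¹; `sum_nbr_sum_levelCosets` regroups it.
theorem psi_one_mul (n : ℕ) :
    psi hX 1 * psi hX (n + 1) = psi hX (n + 2) + recCoeff p n • psi hX n := by
  set ht := isMatrixCoeff_symbol hX hsa h with h_ht
  refine LinearMap.ext fun a => Subtype.ext (compress_injOn (Subtype.mem _) (Subtype.mem _) ?_)
  set F := conjOp ht (compress (modGroup p) (a : BL2 (GG p))) with hF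
  have hFinv : ∀ γ ∈ modGroup p, ∀ g, F (γ * g) = F g := fun γ hγ g =>
    conjOp_compress_mul ht (vnOf_le_groupVN _ a.2) hγ g
  change compress (modGroup p) (psi hX 1 (psi hX (n + 1) a) : BL2 (GG p)) =
    compress (modGroup p) ((psi hX (n + 2) a : BL2 (GG p)) +
      recCoeff p n • (psi hX n a : BL2 (GG p)))
  rw [map_add, map_smul, compress_psi hX hsa h (n + 2), compress_psi hX hsa h n,
    ← sum_nbr_sum_levelCosets hFinv, compress_psi hX hsa h 1, sum_levelCosets_one fun γ hγ g =>
      conjOp_compress_mul ht (vnOf_le_groupVN _ (psi hX (n + 1) a).2) hγ g]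
  refine Finset.sum_congr rfl fun i _ => ?_
  rw [conjOp, compress_psi hX hsa h (n + 1), Finset.mul_sum, Finset.sum_mul]
  exact Finset.sum_congr rfl fun q _ => (conjOp_mul ht _ _ _).symm

/-- The Hecke algebra is a polynomial algebra. -/
def heckeEquiv (p : ℕ) [Fact p.Prime] : Polynomial ℂ ≃ₐ[ℂ] heckeAlg (modGroup p) :=
  AlgEquiv.ofBijective (Polynomial.aeval (heckeAlgMk (modGroup p) (sigma p 1))) (by
    have hval : ∀ q : Polynomial ℂ,
        ((Polynomial.aeval (heckeAlgMk (modGroup p) (sigma p 1)) q : heckeAlg (modGroup p)) :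
          BL2 (CosetSpace (modGroup p))) = Polynomial.aeval (heckeT p 1) q := fun q =>
      (Polynomial.aeval_algHom_apply (heckeAlg (modGroup p)).subtype.toAlgHom _ q).symm
    refine ⟨fun q r hqr => aeval_heckeT_one_injective (p := p) ?_, fun x => ?_⟩
    · rw [← hval, ← hval, hqr]
    · obtain ⟨q, hq⟩ := exists_aeval_of_mem_heckeAlg x.2
      exact ⟨q, Subtype.ext ((hval q).trans hq.symm)⟩)

theorem heckeEquiv_heckePoly (n : ℕ) :
    heckeEquiv p (heckePoly p n) = heckeAlgMk (modGroup p) (sigma p n) := by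
  refine (eq_aeval_heckePoly (fun n => heckeAlgMk (modGroup p) (sigma p n)) ?_ (fun n => ?_) n).symm
  · exact Subtype.ext heckeT_zero
  · exact Subtype.ext (heckeT_one_mul n)

include hX hsa h in
-- Since `heckeAlg` is a polynomial algebra, T₁ ↦ `psi` at 1 extends to a homomorphism, and the
-- common recursion sends T_n to `psi` at n. Its values are polynomials in a single completely
-- positive map.
theorem exists_heckeRep : ∃ Ψ : heckeAlg (modGroup p) →ₐ[ℂ] Module.End ℂ (vnOf (modGroup p)),
    (∀ n : ℕ, IsCP (Ψ (heckeAlgMk (modGroup p) (sigma p n))) ∧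
      ∀ a : vnOf (modGroup p), (Ψ (heckeAlgMk (modGroup p) (sigma p n)) a : BL2 (GG p)) =
        condExp (modGroup p) (powComp X n * (a : BL2 (GG p)) * powComp X n)) ∧
    ∀ x, Ψ x ∈ Algebra.adjoin ℂ {φ : Module.End ℂ (vnOf (modGroup p)) | IsCP φ} := by
  have key : ∀ n, (Polynomial.aeval (psi hX 1)).comp (heckeEquiv p).symm.toAlgHom
      (heckeAlgMk (modGroup p) (sigma p n)) = psi hX n := fun n => by
    rw [← heckeEquiv_heckePoly]
    refine (congrArg _ ((heckeEquiv p).symm_apply_apply _)).trans ?_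
    exact (eq_aeval_heckePoly (psi hX) (psi_zero hX) (psi_one_mul hX hsa h) n).symm
  refine ⟨(Polynomial.aeval (psi hX 1)).comp (heckeEquiv p).symm.toAlgHom, fun n => ?_,
    fun x => ?_⟩
  rotate_left
  · exact Algebra.adjoin_mono (Set.singleton_subset_iff.2 (isCP_psi hX hsa 1))
      (Polynomial.aeval_mem_adjoin_singleton ℂ _)
  · rw [key]
    exact ⟨isCP_psi hX hsa n, coe_psi hX n⟩

end Psi

end HeckeRep

end

/-! ### Assembly of the theorem -/

theorem mainTheorem12 (p : ℕ) [Fact p.Prime] (X : HeckeRep.BL2 (HeckeRep.GG p))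
    (hX : X ∈ HeckeRep.groupVN (HeckeRep.GG p)) (hsa : IsSelfAdjoint X)
    (hsupp : ∀ g, g ∉ HeckeRep.dc p 1 → HeckeRep.coeff X g = 0) :
    (Odd p →
      ((∃ Φ : HeckeRep.heckeAlg (HeckeRep.modGroup p) →⋆ₐ[ℂ] HeckeRep.groupVN (HeckeRep.GG p),
          (∀ a, HeckeRep.trace (Φ a : HeckeRep.BL2 (HeckeRep.GG p)) =
            HeckeRep.heckeTrace (HeckeRep.modGroup p) a) ∧
          ∀ n : ℕ, (Φ (HeckeRep.heckeAlgMk (HeckeRep.modGroup p) (HeckeRep.sigma p 1) ^ n) :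
            HeckeRep.BL2 (HeckeRep.GG p)) = X ^ n) ↔
        ∀ n : ℕ, HeckeRep.trace (X ^ n) =
          HeckeRep.trace (HeckeRep.chiOne ((p + 1) / 2) ^ n)) ∧
      ((∃ Φ : HeckeRep.heckeVN (HeckeRep.modGroup p) →⋆ₐ[ℂ] HeckeRep.groupVN (HeckeRep.GG p),
          (∀ a, HeckeRep.trace (Φ a : HeckeRep.BL2 (HeckeRep.GG p)) =
            HeckeRep.heckeTrace (HeckeRep.modGroup p) a) ∧
          ∀ n : ℕ, (Φ (HeckeRep.heckeVNMk (HeckeRep.modGroup p) (HeckeRep.sigma p 1) ^ n) :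
            HeckeRep.BL2 (HeckeRep.GG p)) = X ^ n) ↔
        ∀ n : ℕ, HeckeRep.trace (X ^ n) =
          HeckeRep.trace (HeckeRep.chiOne ((p + 1) / 2) ^ n))) ∧
    (HeckeRep.ComesFromRep (HeckeRep.modGroup p) (HeckeRep.dc p 1) X ↔
      HeckeRep.CosetRelations X) ∧
    (HeckeRep.CosetRelations X →
      ∃ Ψ : HeckeRep.heckeAlg (HeckeRep.modGroup p) →ₐ[ℂ]
          Module.End ℂ (HeckeRep.vnOf (HeckeRep.modGroup p)),
        (∀ n : ℕ,
          HeckeRep.IsCP (Ψ (HeckeRep.heckeAlgMk (HeckeRep.modGroup p) (HeckeRep.sigma p n))) ∧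
          ∀ a : HeckeRep.vnOf (HeckeRep.modGroup p),
            (Ψ (HeckeRep.heckeAlgMk (HeckeRep.modGroup p) (HeckeRep.sigma p n)) a :
              HeckeRep.BL2 (HeckeRep.GG p)) = HeckeRep.condExp (HeckeRep.modGroup p)
              (HeckeRep.powComp X n * (a : HeckeRep.BL2 (HeckeRep.GG p)) *
                HeckeRep.powComp X n)) ∧
        ∀ h, Ψ h ∈ Algebra.adjoin ℂ
          {φ : Module.End ℂ (HeckeRep.vnOf (HeckeRep.modGroup p)) | HeckeRep.IsCP φ}) ∧
    (HeckeRep.WeakCosetRelations X → HeckeRep.CosetRelations X) ∧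
    (HeckeRep.ActsAsHecke X → HeckeRep.CosetRelations X) := by
  have hcr := HeckeRep.cosetRelations_iff hX hsa
  exact ⟨fun hp => ⟨HeckeRep.exists_heckeHom_iff hX hsa _ (HeckeRep.heckeAlg_le_heckeVN _) _ rfl hp,
      HeckeRep.exists_heckeHom_iff hX hsa _ le_rfl _ rfl hp⟩,
    (HeckeRep.comesFromRep_iff hX hsa hsupp).trans hcr.symm,
    fun h => HeckeRep.exists_heckeRep hX hsa (hcr.1 h),
    fun h => hcr.2 (HeckeRep.symbolMul_of_weakCosetRelations hX h),
    fun h => hcr.2 (HeckeRep.symbolMul_of_actsAsHecke hX h)⟩
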